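/- **Setting.** An instance of discrete Bamboo Garden Trimming consists of $n\ge 1$ growth rates $h_1\ge h_2\ge\dots\ge h_n>0$; let $H=\sum_i h_i$. Pairs $(p_i,q_i)$, $1\le i\le n$, of a non-negative and a positive integer represent a gap-free cyclic schedule if, when item $i$ is placed at the positions $p_i+kq_i$, $k\ge 0$, each of the positions $0,1,2,\dots$ receives exactly one item. **The Main Algorithm.** 1. Let $\delta=3\sqrt{h_1/H}$ and $f''_i=(1+\delta)H/h_i$. Let $\mathit{min}$ be the largest integer with $2^{\mathit{min}}\le f''_1$, let $\mathit{max}$ be the smallest integer with $2^{\mathit{max}+1}>f''_n$, and let $C=2^{\lfloor \mathit{min}/2\rfloor}$. 2. Let $f_i$ be the largest number $\le f''_i$ of the form $2^k(1+j/C)$ with integers $k\ge \mathit{min}$ and $0\le j\le C-1$. The frequencies equal to $2^k(1+j/C)$ form group $j$ of layer $k$. Start with the multiset of frequencies $f_1,\dots,f_n$. Combining $m$ equal frequencies $v$ means replacing them by one frequency $v/m$; this is recorded in an ordered tree, whose leaves are the items and whose nodes are the combined frequencies. 3. For $k=\mathit{max},\dots,\mathit{min}+1$ and $j=C-1,\dots,1$: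 combine pairs of frequencies in group $j$ of layer $k$ as many times as possible. 4. For $j=C-1,\dots,1$: combine $C+j$ frequencies in group $j$ of layer $\mathit{min}$ as many times as possible. 5. For $k=\mathit{max},\dots,\mathit{min}$ and $j=C-1,\dots,1$: combine the frequencies in group $j$ of layer $k$ as many times as possible, in pairs if $k>\mathit{min}$ and $C+j$ at a time if $k=\mathit{min}$; then reduce every frequency left in this group to $2^k(1+(j-1)/C)$. 6. While there are at least two frequencies, replace two largest ones $a\le b$ by one frequency $a/2$, again recorded by a tree node, with the tree of $a$ as first child and that of $b$ as second. The last frequency receives all positions $0+k\cdot 1$, $k\ge 0$. Expand the trees: if a node with $m$ children is placed at the positions $p+kq$, $k\ge 0$, then its child number $l\in\{0,\dots,m-1\}$ is placed at the positions $(p+lq)+k(mq)$. Output the pairs $(p_i,q_i)$ of the items. Which of several equal frequencies are combined, and in which order, is left open, so an instance may have several possible outputs. **Machine.** A real RAM has registers and arrays that hold real numbers. It runs a fixed finite program (assignment, sequence, conditional, while loop) in which only integer constants occur. Each constant, each register or array access (with a computed index, rounded down), each operation $+,-,\cdot,/,\sqrt{\ },\log,\lfloor\ \rfloor$ on real numbers,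 each comparison, each Boolean connective, and each assignment, branch or loop test costs a bounded number of steps. **Theorem.** There are real-RAM programs $\mathtt{main}$, $\mathtt{setup}$, $\mathtt{next}$ and a constant $c$ such that the following hold. (a) For all $n\ge1$ and $h_1\ge\dots\ge h_n>0$, the program $\mathtt{main}$, started with only $n$ and $h_1,\dots,h_n$ in memory, halts after at most $c\,n\log(n+1)$ steps (that is, in time $O(n\log n)$ for $n\ge 2$). Its memory then holds pairs $(p_i,q_i)$ that are an output of the Main Algorithm for $(h_1,\dots,h_n)$ and that represent a gap-free cyclic schedule. (b) For every $n$ and all pairs $(p_i,q_i)$, $1\le i\le n$, that represent a gap-free cyclic schedule (in particular for those of (a)), the schedule can be generated step by step with a priority queue, as follows. Started with only $n$ and the pairs in memory, $\mathtt{setup}$ halts after at most $c\,n\log(n+1)$ steps and leaves a binary min-heap of the pairs $(i,t_i)$ with key $t_i$, where $t_i=p_i$. After this, $\mathtt{next}$ is run once for each of $T=0,1,2,\dots$, each time on the memory left by the previous run. Each run takes at most $c\log(n+1)$ steps, outputs the item $i$ whose $t_i$ is smallest, replaces $t_i$ by $t_i+q_i$, and leaves a binary min-heap of the updated pairs. The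 item output in run $T$ is the item scheduled at position $T$. -/

import Mathlib

namespace BambooGarden

/-! ### The real random access machine: structured programs with a step count -/

/-- The memory of the machine: scalar registers and one-dimensional arrays, all holding real
numbers. A program mentions only finitely many registers and arrays. -/
structure Mem where
  reg : ℕ → ℝ
  arr : ℕ → ℕ → ℝ

/-- Expressions over the registers and the array cells. Only integers occur as constants. -/
inductive RExpr where
  | const (z : ℤ)
  | reg (r : ℕ)
  | cell (a : ℕ) (index : RExpr)
  | add (x y : RExpr)
  | sub (x y : RExpr)
  | mul (x y : RExpr)
  | divide (x y : RExpr)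
  | sqrt (x : RExpr)
  | log (x : RExpr)
  | floor (x : RExpr)

/-- The value of an expression. An array index is rounded down to a natural number. -/
noncomputable def RExpr.eval (σ : Mem) : RExpr → ℝ
  | const z => (z : ℝ)
  | reg r => σ.reg r
  | cell a e => σ.arr a ⌊e.eval σ⌋₊
  | add x y => x.eval σ + y.eval σ
  | sub x y => x.eval σ - y.eval σ
  | mul x y => x.eval σ * y.eval σ
  | divide x y => x.eval σ / y.eval σ
  | sqrt x => Real.sqrt (x.eval σ)
  | log x => Real.log (x.eval σ)
  | floor x => ((⌊x.eval σ⌋ : ℤ) : ℝ)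

/-- The cost of an expression: one step for each constant, memory access and operation. -/
def RExpr.cost : RExpr → ℕ
  | const _ => 1
  | reg _ => 1
  | cell _ e => e.cost + 1
  | add x y => x.cost + y.cost + 1
  | sub x y => x.cost + y.cost + 1
  | mul x y => x.cost + y.cost + 1
  | divide x y => x.cost + y.cost + 1
  | sqrt x => x.cost + 1
  | log x => x.cost + 1
  | floor x => x.cost + 1

/-- Boolean tests. -/
inductive RTest where
  | le (x y : RExpr)
  | not (b : RTest)
  | and (b c : RTest)

/-- The truth value of a test. -/
def RTest.holds (σ : Mem) : RTest → Prop
  | le x y => x.eval σ ≤ y.eval σ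
  | not b => ¬ b.holds σ
  | and b c => b.holds σ ∧ c.holds σ

/-- The cost of evaluating a test. -/
def RTest.cost : RTest → ℕ
  | le x y => x.cost + y.cost + 1
  | not b => b.cost + 1
  | and b c => b.cost + c.cost + 1

/-- Programs. A program is a finite object that does not depend on the input. -/
inductive Prog where
  | skip
  | setReg (r : ℕ) (e : RExpr)
  | setCell (a : ℕ) (index e : RExpr)
  | seq (P Q : Prog)
  | ite (b : RTest) (P Q : Prog)
  | loop (b : RTest) (P : Prog)

/-- The memory after assigning `x` to register `r`. -/
def Mem.setReg (σ : Mem) (r : ℕ) (x : ℝ) : Mem :=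
  { σ with reg := Function.update σ.reg r x }

/-- The memory after assigning `x` to cell `i` of array `a`. -/
def Mem.setCell (σ : Mem) (a i : ℕ) (x : ℝ) : Mem :=
  { σ with arr := Function.update σ.arr a (Function.update (σ.arr a) i x) }

/-- `Exec P σ σ' τ`: started with memory `σ`, the program `P` halts with memory `σ'` after
exactly `τ` steps. -/
inductive Exec : Prog → Mem → Mem → ℕ → Prop
  | skip (σ : Mem) : Exec Prog.skip σ σ 1
  | setReg (σ : Mem) (r : ℕ) (e : RExpr) :
      Exec (Prog.setReg r e) σ (σ.setReg r (e.eval σ)) (e.cost + 1)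
  | setCell (σ : Mem) (a : ℕ) (i e : RExpr) :
      Exec (Prog.setCell a i e) σ (σ.setCell a ⌊i.eval σ⌋₊ (e.eval σ)) (i.cost + e.cost + 1)
  | seq {P Q : Prog} {σ σ' σ'' : Mem} {τ τ' : ℕ} (hP : Exec P σ σ' τ) (hQ : Exec Q σ' σ'' τ') :
      Exec (Prog.seq P Q) σ σ'' (τ + τ')
  | iteTrue {b : RTest} {P Q : Prog} {σ σ' : Mem} {τ : ℕ} (hb : b.holds σ)
      (hP : Exec P σ σ' τ) : Exec (Prog.ite b P Q) σ σ' (b.cost + 1 + τ)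
  | iteFalse {b : RTest} {P Q : Prog} {σ σ' : Mem} {τ : ℕ} (hb : ¬ b.holds σ)
      (hQ : Exec Q σ σ' τ) : Exec (Prog.ite b P Q) σ σ' (b.cost + 1 + τ)
  | loopDone {b : RTest} {P : Prog} {σ : Mem} (hb : ¬ b.holds σ) :
      Exec (Prog.loop b P) σ σ (b.cost + 1)
  | loopNext {b : RTest} {P : Prog} {σ σ' σ'' : Mem} {τ τ' : ℕ} (hb : b.holds σ)
      (hP : Exec P σ σ' τ) (hL : Exec (Prog.loop b P) σ' σ'' τ') :
      Exec (Prog.loop b P) σ σ'' (b.cost + 1 + τ + τ')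

/-- The memory that holds `n` in register `0`, the vector `h` in array `0`, and `0` elsewhere. -/
noncomputable def inputMem {n : ℕ} (h : Fin n → ℝ) : Mem where
  reg r := if r = 0 then (n : ℝ) else 0
  arr a i := if hi : i < n then (if a = 0 then h ⟨i, hi⟩ else 0) else 0

/-- The memory that holds `n` in register `0`, the vectors `p` and `q` in the arrays `1` and `2`,
and `0` elsewhere. -/
noncomputable def pairsMem {n : ℕ} (p q : Fin n → ℕ) : Mem where
  reg r := if r = 0 then (n : ℝ) else 0
  arr a i := if hi : i < n then
    (if a = 1 then (p ⟨i, hi⟩ : ℝ) else if a = 2 then (q ⟨i, hi⟩ : ℝ) else 0) else 0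

/-- The arrays `1` and `2` of the memory `σ` hold the vectors `p` and `q`. -/
def HoldsPairs {n : ℕ} (σ : Mem) (p q : Fin n → ℕ) : Prop :=
  ∀ i : Fin n, σ.arr 1 i = (p i : ℝ) ∧ σ.arr 2 i = (q i : ℝ)

/-- The arrays `3` and `4` of the memory `σ` hold the pairs `(i, t i)` as a binary heap with
smallest key `t i` at the top: position `j` holds the pair of the item `e j`, and the parent of
a position `j > 0` is the position `(j - 1) / 2`. -/
def HoldsQueue {n : ℕ} (σ : Mem) (t : Fin n → ℕ) : Prop :=
  ∃ e : Equiv.Perm (Fin n),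
    (∀ j : Fin n, σ.arr 3 j = ((e j : ℕ) : ℝ) ∧ σ.arr 4 j = (t (e j) : ℝ)) ∧
    ∀ j : ℕ, 0 < j → j < n → σ.arr 4 ((j - 1) / 2) ≤ σ.arr 4 j

/-! ### Cyclic schedules -/

/-- The pairs `(p i, q i)` represent a cyclic schedule without gaps: when item `i` is placed at the
positions `p i + k * q i`, `k ≥ 0`, every position `0, 1, 2, …` receives exactly one item. -/
def IsCyclicSchedule {n : ℕ} (p q : Fin n → ℕ) : Prop :=
  (∀ i, 0 < q i) ∧ ∀ T : ℕ, ∃! i : Fin n, ∃ k : ℕ, T = p i + k * q i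

/-! ### The Main Algorithm

The algorithm leaves open which of several equal frequencies are combined and in which order, so
it is given as a relation between its input and its possible outputs. -/

/-- Ordered trees that record how frequencies are combined. The leaf `i` is the frequency of
item `i`; a node with `m` children is a frequency that replaces `m` frequencies. -/
inductive FTree (n : ℕ) where
  | leaf (i : Fin n)
  | node (m : ℕ) (child : Fin m → FTree n)

/-- `Places t p q i p' q'`: if the frequency with tree `t` is placed at the positions `p + k * q`,
then expanding the tree places item `i` at the positions `p' + k * q'`. The occurrences of a node
are given to its `m` children in turn. -/
inductive Places {n : ℕ} : FTree n → ℕ → ℕ → Fin n → ℕ → ℕ → Prop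
  | leaf (i : Fin n) (p q : ℕ) : Places (FTree.leaf i) p q i p q
  | node {m : ℕ} {child : Fin m → FTree n} {p q : ℕ} {i : Fin n} {p' q' : ℕ} (l : Fin m)
      (hl : Places (child l) (p + (l : ℕ) * q) (m * q) i p' q') :
      Places (FTree.node m child) p q i p' q'

/-- A current sequence of frequencies, each with its value and its tree; only the
multiset matters. -/
abbrev Freqs (n : ℕ) := Multiset (ℝ × FTree n)

/-- Replace `m` frequencies of the same value `v` by one frequency `v / m`. -/
inductive Combine {n : ℕ} (m : ℕ) (v : ℝ) : Freqs n → Freqs n → Prop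
  | mk (R : Freqs n) (child : Fin m → FTree n) :
      Combine m v (R + Finset.univ.val.map fun l => (v, child l))
        (R + {(v / m, FTree.node m child)})

/-- Combine groups of `m` frequencies of value `v` as many times as possible. -/
def CombineAll {n : ℕ} (m : ℕ) (v : ℝ) (S S' : Freqs n) : Prop :=
  Relation.ReflTransGen (Combine m v) S S' ∧ Multiset.countP (fun x => x.1 = v) S' < m

/-- Change every frequency of value `v` to the value `w`. -/
noncomputable def pushDown {n : ℕ} (v w : ℝ) (S : Freqs n) : Freqs n :=
  S.map fun x => if x.1 = v then (w, x.2) else x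

/-- Perform the steps `R a` one after another, for the entries `a` of a list in this order. -/
def ForEach {α β : Type} (R : α → β → β → Prop) : List α → β → β → Prop
  | [] => Eq
  | a :: l => Relation.Comp (R a) (ForEach R l)

/-- The frequency `2 ^ k * (1 + j / C)`, of group `j` in layer `k`. -/
noncomputable def gridFreq (C k j : ℕ) : ℝ := 2 ^ k * (1 + (j : ℝ) / C)

/-- The list `b, b - 1, …, a`. -/
def downTo (b a : ℕ) : List ℕ := (List.Ico a (b + 1)).reverse

/-- Step 3: for `k = hi, …, lo + 1` and `1 ≤ j ≤ C - 1`, combine pairs of frequencies. -/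
def Step3 {n : ℕ} (lo hi C : ℕ) : Freqs n → Freqs n → Prop :=
  ForEach (fun k => ForEach (fun j => CombineAll 2 (gridFreq C k j)) (downTo (C - 1) 1))
    (downTo hi (lo + 1))

/-- Step 4: in layer `lo`, for `1 ≤ j ≤ C - 1`, combine `C + j` frequencies of group `j`. -/
def Step4 {n : ℕ} (lo C : ℕ) : Freqs n → Freqs n → Prop :=
  ForEach (fun j => CombineAll (C + j) (gridFreq C lo j)) (downTo (C - 1) 1)

/-- Step 5: for `k = hi, …, lo` and `j = C - 1, …, 1`, combine the frequencies of group `j` in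
layer `k`, in pairs if `k > lo` and by `C + j` if `k = lo`, and push the remaining ones down to
group `j - 1`. -/
def Step5 {n : ℕ} (lo hi C : ℕ) : Freqs n → Freqs n → Prop :=
  ForEach (fun k => ForEach (fun j S S' => ∃ S₁,
      CombineAll (if k = lo then C + j else 2) (gridFreq C k j) S S₁ ∧
      S' = pushDown (gridFreq C k j) (gridFreq C k (j - 1)) S₁) (downTo (C - 1) 1))
    (downTo hi lo)

/-- One reduction of the scheduler for powers-of-two frequencies: two largest frequencies `a ≤ b`
are replaced by one frequency `a / 2`, whose occurrences they share alternatingly. -/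
inductive MergeLargest {n : ℕ} : Freqs n → Freqs n → Prop
  | mk (R : Freqs n) (a b : ℝ) (s t : FTree n) (hab : a ≤ b) (hR : ∀ x ∈ R, x.1 ≤ a) :
      MergeLargest (R + {(a, s), (b, t)}) (R + {(a / 2, FTree.node 2 ![s, t])})

/-- Step 6: merge the frequencies into a single one, use that one in every position `0 + k * 1`,
and expand its tree. -/
def Step6 {n : ℕ} (S : Freqs n) (p q : Fin n → ℕ) : Prop :=
  ∃ (v : ℝ) (t : FTree n), Relation.ReflTransGen MergeLargest S {(v, t)} ∧
    ∀ i, Places t 0 1 i (p i) (q i)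

/-- The parameter `δ = 3 √(h₁ / H)`, where `H` is the sum of the growth rates. -/
noncomputable def delta {n : ℕ} (hn : 0 < n) (h : Fin n → ℝ) : ℝ :=
  3 * Real.sqrt (h ⟨0, hn⟩ / ∑ i, h i)

/-- The initial frequencies `(1 + δ) H / h i`. -/
noncomputable def initialFreq {n : ℕ} (hn : 0 < n) (h : Fin n → ℝ) (i : Fin n) : ℝ :=
  (1 + delta hn h) * (∑ j, h j) / h i

/-- `MainAlgorithm hn h p q`: the pairs `(p i, q i)` are a possible output of the Main Algorithm
for the growth rates `h`. -/
def MainAlgorithm {n : ℕ} (hn : 0 < n) (h : Fin n → ℝ) (p q : Fin n → ℕ) : Prop :=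
  ∃ (lo hi C : ℕ) (f : Fin n → ℝ) (S₃ S₄ S₅ : Freqs n),
    IsGreatest {m : ℕ | (2 : ℝ) ^ m ≤ initialFreq hn h ⟨0, hn⟩} lo ∧
    IsLeast {m : ℕ | initialFreq hn h ⟨n - 1, Nat.sub_lt hn one_pos⟩ < (2 : ℝ) ^ (m + 1)} hi ∧
    C = 2 ^ (lo / 2) ∧
    (∀ i, IsGreatest
      {x : ℝ | x ≤ initialFreq hn h i ∧ ∃ k j : ℕ, lo ≤ k ∧ j < C ∧ x = gridFreq C k j} (f i)) ∧
    Step3 lo hi C (Finset.univ.val.map fun i => (f i, FTree.leaf i)) S₃ ∧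
    Step4 lo C S₃ S₄ ∧
    Step5 lo hi C S₄ S₅ ∧
    Step6 S₅ p q

end BambooGarden

/-!
A frequency `2 ^ k * (1 + j / C)` of the grid is stored as its integer key `k * C + j`. The order of
the frequencies is that of their keys, halving subtracts `C` from the key, and for `C = 2 ^ c`
dividing a frequency of layer `k` and group `j` by `C + j` gives key `(k - c) * C`. Hence the
algorithm needs nothing but integer keys in a binary heap, largest key first.

One descent through the keys performs Steps 3 and 4, a second one performs Step 5. At each key it
takes the frequencies of this key out of the heap, combines them, and puts the combinations, whose
keys are smaller, back into the heap. A combination of `r ≥ 2` frequencies lowers their number by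
`r - 1`, so there are `O(n)` heap operations in total. Step 6 takes two frequencies out of the heap
and puts one back. Most keys of the grid may have no frequency, hence a descent jumps from one key
that occurs to the next.

A node of a tree is a number, and every other node keeps its parent, its index among the children
and their number, so a single pass from the root to the leaves expands the tree. The output is a
cyclic schedule because every combination splits the positions of a node among its children, and no
step loses an item.

In the queue of part (b), `t i` is the first position of item `i` from `T` on. The item scheduled at
`T` is the one with `t i = T`, which is the smallest value.
-/

namespace BambooGarden

/-! ### A program logic with step counts -/

section Expressions

variable (σ : Mem) (x y : RExpr)

instance : Add RExpr := ⟨RExpr.add⟩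
instance : Sub RExpr := ⟨RExpr.sub⟩
instance : Mul RExpr := ⟨RExpr.mul⟩
instance : Div RExpr := ⟨RExpr.divide⟩
instance (k : ℕ) : OfNat RExpr k := ⟨RExpr.const k⟩

attribute [simp] RExpr.eval RExpr.cost RTest.holds RTest.cost

@[simp] theorem RExpr.eval_add : (x + y).eval σ = x.eval σ + y.eval σ := rfl
@[simp] theorem RExpr.eval_sub : (x - y).eval σ = x.eval σ - y.eval σ := rfl
@[simp] theorem RExpr.eval_mul : (x * y).eval σ = x.eval σ * y.eval σ := rfl
@[simp] theorem RExpr.eval_div : (x / y).eval σ = x.eval σ / y.eval σ := rfl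

@[simp] theorem RExpr.eval_zero : (0 : RExpr).eval σ = 0 := Int.cast_zero
@[simp] theorem RExpr.eval_one : (1 : RExpr).eval σ = 1 := Int.cast_one
@[simp] theorem RExpr.eval_ofNat (k : ℕ) [k.AtLeastTwo] :
    (ofNat(k) : RExpr).eval σ = ofNat(k) := Int.cast_natCast k

@[simp] theorem RExpr.cost_add : (x + y).cost = x.cost + y.cost + 1 := rfl
@[simp] theorem RExpr.cost_sub : (x - y).cost = x.cost + y.cost + 1 := rfl
@[simp] theorem RExpr.cost_mul : (x * y).cost = x.cost + y.cost + 1 := rfl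
@[simp] theorem RExpr.cost_div : (x / y).cost = x.cost + y.cost + 1 := rfl
@[simp] theorem RExpr.cost_ofNat (k : ℕ) : (no_index (OfNat.ofNat k) : RExpr).cost = 1 := rfl

/-- The test `x < y`. -/
def RTest.lt : RTest := .not (.le y x)

/-- The test `x = y`. -/
def RTest.eq : RTest := .and (.le x y) (.le y x)

@[simp] theorem RTest.holds_lt : (RTest.lt x y).holds σ ↔ x.eval σ < y.eval σ := not_le

@[simp] theorem RTest.holds_eq : (RTest.eq x y).holds σ ↔ x.eval σ = y.eval σ :=
  le_antisymm_iff.symm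

@[simp] theorem RTest.cost_lt : (RTest.lt x y).cost = y.cost + x.cost + 2 := rfl

@[simp] theorem RTest.cost_eq :
    (RTest.eq x y).cost = (x.cost + y.cost + 1) + (y.cost + x.cost + 1) + 1 := rfl

end Expressions

infixr:50 " ;; " => Prog.seq
infix:55 " ≔ " => Prog.setReg

section Memory

variable (σ : Mem) (r a i : ℕ) (x : ℝ)

@[simp] theorem Mem.reg_setReg (r' : ℕ) :
    (σ.setReg r x).reg r' = if r' = r then x else σ.reg r' := by
  simp [Mem.setReg, Function.update_apply]

@[simp] theorem Mem.arr_setReg : (σ.setReg r x).arr = σ.arr := rfl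

@[simp] theorem Mem.reg_setCell : (σ.setCell a i x).reg = σ.reg := rfl

@[simp] theorem Mem.arr_setCell (a' i' : ℕ) :
    (σ.setCell a i x).arr a' i' =
      if a' = a then (if i' = i then x else σ.arr a i') else σ.arr a' i' := by
  by_cases h : a' = a
  · subst h; simp [Mem.setCell, Function.update_apply]
  · simp [Mem.setCell, h]

end Memory

/-- Started with memory `σ`, the program `P` halts, and the final memory and the number of steps
satisfy `Q`. -/
def Runs (P : Prog) (σ : Mem) (Q : Mem → ℕ → Prop) : Prop :=
  ∃ σ' τ, Exec P σ σ' τ ∧ Q σ' τ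

namespace Runs

variable {P P' : Prog} {σ : Mem} {Q Q' : Mem → ℕ → Prop} {b : RTest}

theorem mono (h : Runs P σ Q) (hQ : ∀ σ' τ, Q σ' τ → Q' σ' τ) : Runs P σ Q' := by
  obtain ⟨σ', τ, h, hq⟩ := h
  exact ⟨σ', τ, h, hQ _ _ hq⟩

theorem skip (h : Q σ 1) : Runs Prog.skip σ Q := ⟨_, _, Exec.skip σ, h⟩

theorem setReg {r : ℕ} {e : RExpr} (h : Q (σ.setReg r (e.eval σ)) (e.cost + 1)) :
    Runs (r ≔ e) σ Q := ⟨_, _, Exec.setReg σ r e, h⟩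

theorem setCell {a : ℕ} {i e : RExpr}
    (h : Q (σ.setCell a ⌊i.eval σ⌋₊ (e.eval σ)) (i.cost + e.cost + 1)) :
    Runs (Prog.setCell a i e) σ Q := ⟨_, _, Exec.setCell σ a i e, h⟩

theorem seq (h : Runs P σ fun σ₁ τ₁ => Runs P' σ₁ fun σ₂ τ₂ => Q σ₂ (τ₁ + τ₂)) :
    Runs (P ;; P') σ Q := by
  obtain ⟨σ₁, τ₁, h₁, σ₂, τ₂, h₂, hq⟩ := h
  exact ⟨_, _, Exec.seq h₁ h₂, hq⟩

theorem ite (h₁ : b.holds σ → Runs P σ fun σ' τ => Q σ' (b.cost + 1 + τ))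
    (h₂ : ¬ b.holds σ → Runs P' σ fun σ' τ => Q σ' (b.cost + 1 + τ)) :
    Runs (Prog.ite b P P') σ Q := by
  by_cases hb : b.holds σ
  · obtain ⟨σ', τ, h, hq⟩ := h₁ hb
    exact ⟨_, _, Exec.iteTrue hb h, hq⟩
  · obtain ⟨σ', τ, h, hq⟩ := h₂ hb
    exact ⟨_, _, Exec.iteFalse hb h, hq⟩

/-- The loop invariant `I` carries a budget of steps that pays for the tests and the runs of the
body still to come, except for the last test. -/
theorem loop (I : Mem → ℕ → Prop) (B : ℕ) (hI : I σ B)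
    (hbody : ∀ σ B, I σ B → b.holds σ →
      Runs P σ fun σ' τ => ∃ B', I σ' B' ∧ τ + B' + (b.cost + 1) ≤ B)
    (hQ : ∀ σ' τ B', I σ' B' → ¬ b.holds σ' → τ + B' ≤ B + (b.cost + 1) → Q σ' τ) :
    Runs (Prog.loop b P) σ Q := by
  suffices H : ∀ B σ, I σ B → ∃ σ' τ B', Exec (Prog.loop b P) σ σ' τ ∧ I σ' B' ∧ ¬ b.holds σ' ∧
      τ + B' ≤ B + (b.cost + 1) by
    obtain ⟨σ', τ, B', h₁, h₂, h₃, h₄⟩ := H B σ hI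
    exact ⟨σ', τ, h₁, hQ _ _ _ h₂ h₃ h₄⟩
  intro B
  induction B using Nat.strong_induction_on with
  | _ B ih =>
    intro σ hI
    by_cases hb : b.holds σ
    · obtain ⟨σ₁, τ₁, h₁, B₁, hI₁, hB₁⟩ := hbody σ B hI hb
      obtain ⟨σ₂, τ₂, B₂, h₂, hI₂, hb₂, hB₂⟩ := ih B₁ (by lia) σ₁ hI₁
      exact ⟨σ₂, _, B₂, Exec.loopNext hb h₁ h₂, hI₂, hb₂, by lia⟩
    · exact ⟨σ, _, B, Exec.loopDone hb, hI, hb, by lia⟩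

end Runs

/-- Whether a program has an assignment to the register `r`. -/
def Prog.writesReg (r : ℕ) : Prog → Bool
  | skip => false
  | setReg r' _ => r == r'
  | setCell _ _ _ => false
  | seq P Q => P.writesReg r || Q.writesReg r
  | ite _ P Q => P.writesReg r || Q.writesReg r
  | loop _ P => P.writesReg r

/-- Whether a program has an assignment to the array `a`. -/
def Prog.writesArr (a : ℕ) : Prog → Bool
  | skip => false
  | setReg _ _ => false
  | setCell a' _ _ => a == a'
  | seq P Q => P.writesArr a || Q.writesArr a
  | ite _ P Q => P.writesArr a || Q.writesArr a
  | loop _ P => P.writesArr a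

/-- The memories `σ` and `σ'` agree on the registers and arrays to which `P` has no assignment. For
a concrete program, `rfl` proves that it has none to a given register or array. -/
structure Frame (P : Prog) (σ σ' : Mem) : Prop where
  reg : ∀ r, P.writesReg r = false → σ'.reg r = σ.reg r
  arr : ∀ a, P.writesArr a = false → σ'.arr a = σ.arr a

theorem Exec.frame {P : Prog} {σ σ' : Mem} {τ : ℕ} (h : Exec P σ σ' τ) : Frame P σ σ' := by
  induction h with
  | skip => exact ⟨fun _ _ => rfl, fun _ _ => rfl⟩
  | setReg σ r e =>
    refine ⟨fun r' h => ?_, fun a _ => rfl⟩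
    have : r' ≠ r := by simpa [Prog.writesReg] using h
    simp [this]
  | setCell σ a i e =>
    refine ⟨fun _ _ => rfl, fun a' h => ?_⟩
    have : a' ≠ a := by simpa [Prog.writesArr] using h
    funext i'
    simp [this]
  | seq _ _ ih₁ ih₂ =>
    refine ⟨fun r h => ?_, fun a h => ?_⟩
    · obtain ⟨h₁, h₂⟩ := Bool.or_eq_false_iff.1 h
      exact (ih₂.reg r h₂).trans (ih₁.reg r h₁)
    · obtain ⟨h₁, h₂⟩ := Bool.or_eq_false_iff.1 h
      exact (ih₂.arr a h₂).trans (ih₁.arr a h₁)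
  | iteTrue _ _ ih =>
    exact ⟨fun r h => ih.reg r (Bool.or_eq_false_iff.1 h).1,
      fun a h => ih.arr a (Bool.or_eq_false_iff.1 h).1⟩
  | iteFalse _ _ ih =>
    exact ⟨fun r h => ih.reg r (Bool.or_eq_false_iff.1 h).2,
      fun a h => ih.arr a (Bool.or_eq_false_iff.1 h).2⟩
  | loopDone => exact ⟨fun _ _ => rfl, fun _ _ => rfl⟩
  | loopNext _ _ _ ih₁ ih₂ =>
    exact ⟨fun r h => (ih₂.reg r h).trans (ih₁.reg r h),
      fun a h => (ih₂.arr a h).trans (ih₁.arr a h)⟩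

namespace Runs

variable {P P' : Prog} {σ : Mem} {Q R : Mem → ℕ → Prop}

theorem frame (h : Runs P σ Q) : Runs P σ fun σ' τ => Frame P σ σ' ∧ Q σ' τ := by
  obtain ⟨σ', τ, h, hq⟩ := h
  exact ⟨σ', τ, h, h.frame, hq⟩

theorem seq_of_spec (h : Runs P σ Q)
    (h' : ∀ σ₁ τ₁, Frame P σ σ₁ → Q σ₁ τ₁ → Runs P' σ₁ fun σ₂ τ₂ => R σ₂ (τ₁ + τ₂)) :
    Runs (P ;; P') σ R :=
  seq (h.frame.mono fun _ _ hq => h' _ _ hq.1 hq.2)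

end Runs

/-! ### Registers and arrays of the programs -/

-- The numbers of `itemCount`, `output`, `rate`, `start`, `period`, `heapName` and `heapKey` are
-- those of `inputMem`, `pairsMem`, `HoldsPairs` and `HoldsQueue`.

namespace Reg

@[simp] abbrev itemCount : ℕ := 0
@[simp] abbrev output : ℕ := 1
@[simp] abbrev heapSize : ℕ := 2
@[simp] abbrev cursor : ℕ := 3
@[simp] abbrev target : ℕ := 4
@[simp] abbrev scratch : ℕ := 5
@[simp] abbrev key : ℕ := 6
@[simp] abbrev name : ℕ := 7
@[simp] abbrev counter : ℕ := 8
@[simp] abbrev nodeCount : ℕ := 9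
@[simp] abbrev listSize : ℕ := 10
@[simp] abbrev batchSize : ℕ := 11
@[simp] abbrev rateSum : ℕ := 12
@[simp] abbrev scaledSum : ℕ := 13
@[simp] abbrev minLayer : ℕ := 14
@[simp] abbrev halfMinLayer : ℕ := 15
@[simp] abbrev groups : ℕ := 16
@[simp] abbrev logRest : ℕ := 17
@[simp] abbrev group : ℕ := 18
@[simp] abbrev stride : ℕ := 19
@[simp] abbrev currentKey : ℕ := 20
@[simp] abbrev layer : ℕ := 21
@[simp] abbrev arity : ℕ := 22
@[simp] abbrev active : ℕ := 23
@[simp] abbrev pushing : ℕ := 24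
@[simp] abbrev parentNode : ℕ := 25

end Reg

namespace Arr

@[simp] abbrev rate : ℕ := 0
@[simp] abbrev start : ℕ := 1
@[simp] abbrev period : ℕ := 2
@[simp] abbrev heapName : ℕ := 3
@[simp] abbrev heapKey : ℕ := 4
@[simp] abbrev parent : ℕ := 5
@[simp] abbrev childIndex : ℕ := 6
@[simp] abbrev childCount : ℕ := 7
@[simp] abbrev listKey : ℕ := 8
@[simp] abbrev listName : ℕ := 9
@[simp] abbrev batch : ℕ := 10

end Arr

open RExpr Reg Arr

/-! ### Binary heaps -/

section HeapOrder

variable {α : Type*} [Preorder α] {K K' : ℕ → α} {s s' j c : ℕ}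

/-- The keys `K` below position `s` are in heap order: no key is smaller than the one at the parent
position. -/
def HeapOrdered (K : ℕ → α) (s : ℕ) : Prop :=
  ∀ i, 0 < i → i < s → K ((i - 1) / 2) ≤ K i

/-- No child of `j` has a smaller key than the parent of `j`. -/
def GrandparentOrdered (K : ℕ → α) (s j : ℕ) : Prop :=
  ∀ i, 0 < i → i < s → (i - 1) / 2 = j → 0 < j → K ((j - 1) / 2) ≤ K i

/-- The keys are in heap order, except that the key at `j` may be too small for its place. -/
structure HeapOrderedAbove (K : ℕ → α) (s j : ℕ) : Prop where
  ordered : ∀ i, 0 < i → i < s → i ≠ j → K ((i - 1) / 2) ≤ K i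
  grandparent : GrandparentOrdered K s j

/-- The keys are in heap order, except that the key at `j` may be too large for its place. -/
structure HeapOrderedBelow (K : ℕ → α) (s j : ℕ) : Prop where
  ordered : ∀ i, 0 < i → i < s → (i - 1) / 2 ≠ j → K ((i - 1) / 2) ≤ K i
  grandparent : GrandparentOrdered K s j

theorem HeapOrdered.le (h : HeapOrdered K s) : ∀ i, i < s → K 0 ≤ K i := by
  intro i
  induction i using Nat.strong_induction_on with
  | _ i ih =>
    intro hi
    rcases Nat.eq_zero_or_pos i with rfl | h0
    · exact le_rfl
    · exact (ih _ (by lia) (by lia)).trans (h i h0 hi)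

theorem HeapOrderedAbove.heapOrdered (h : HeapOrderedAbove K s j)
    (hj : 0 < j → K ((j - 1) / 2) ≤ K j) : HeapOrdered K s := by
  intro i h0 hi
  by_cases hij : i = j
  · exact hij ▸ hj (hij ▸ h0)
  · exact h.ordered i h0 hi hij

theorem HeapOrderedBelow.heapOrdered (h : HeapOrderedBelow K s j)
    (hl : 2 * j + 1 < s → K j ≤ K (2 * j + 1)) (hr : 2 * j + 2 < s → K j ≤ K (2 * j + 2)) :
    HeapOrdered K s := by
  intro i h0 hi
  by_cases hij : (i - 1) / 2 = j
  · obtain rfl | rfl : i = 2 * j + 1 ∨ i = 2 * j + 2 := by lia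
    · rw [hij]; exact hl hi
    · rw [hij]; exact hr hi
  · exact h.ordered i h0 hi hij

theorem HeapOrdered.heapOrderedAbove_succ (h : HeapOrdered K s) (hK : ∀ i < s, K' i = K i) :
    HeapOrderedAbove K' (s + 1) s := by
  refine ⟨fun i h0 hi his => ?_, fun _ _ _ _ _ => by lia⟩
  rw [hK i (by lia), hK _ (by lia)]
  exact h i h0 (by lia)

theorem HeapOrdered.heapOrderedBelow_zero (h : HeapOrdered K s) (hs : s' ≤ s)
    (hK : ∀ i, 0 < i → K' i = K i) : HeapOrderedBelow K' s' 0 := by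
  refine ⟨fun i h0 hi hi0 => ?_, fun _ _ _ _ h => absurd h (lt_irrefl _)⟩
  rw [hK i h0, hK _ (by lia)]
  exact h i h0 (by lia)

theorem HeapOrderedAbove.swap (h : HeapOrderedAbove K s j) (hj : 0 < j) (hs : j < s)
    (hK : K j < K ((j - 1) / 2)) :
    HeapOrderedAbove (K ∘ Equiv.swap j ((j - 1) / 2)) s ((j - 1) / 2) := by
  obtain ⟨h₁, h₂⟩ := h
  set p := (j - 1) / 2 with hp
  have hpj : p < j := by lia
  refine ⟨fun i hi his hip => ?_, fun i hi his hip hp0 => ?_⟩ <;>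
    simp only [Function.comp_apply]
  · by_cases hij : i = j
    · subst hij
      simpa only [Equiv.swap_apply_left, ← hp, Equiv.swap_apply_right] using hK.le
    · rw [Equiv.swap_apply_of_ne_of_ne hij hip]
      by_cases hc : (i - 1) / 2 = j
      · rw [hc, Equiv.swap_apply_left]
        exact h₂ i hi his hc hj
      · by_cases hc' : (i - 1) / 2 = p
        · rw [hc', Equiv.swap_apply_right]
          exact hK.le.trans (hc' ▸ h₁ i hi his hij)
        · rw [Equiv.swap_apply_of_ne_of_ne hc hc']
          exact h₁ i hi his hij
  · have hg := h₁ p hp0 (by lia) (by lia)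
    rw [Equiv.swap_apply_of_ne_of_ne (a := j) (b := p) (x := (p - 1) / 2) (by lia) (by lia)]
    by_cases hij : i = j
    · subst hij
      rwa [Equiv.swap_apply_left]
    · rw [Equiv.swap_apply_of_ne_of_ne hij (by lia)]
      exact hg.trans (hip ▸ h₁ i hi his hij)

theorem HeapOrderedBelow.swap (h : HeapOrderedBelow K s j) (hc : (c - 1) / 2 = j) (hc0 : 0 < c)
    (hs : c < s) (hK : K c < K j) (hmin : ∀ i, 0 < i → i < s → (i - 1) / 2 = j → K c ≤ K i) :
    HeapOrderedBelow (K ∘ Equiv.swap j c) s c := by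
  obtain ⟨h₁, h₂⟩ := h
  have hpj : j < c := by lia
  refine ⟨fun i hi his hip => ?_, fun i hi his hip _ => ?_⟩ <;>
    simp only [Function.comp_apply]
  · by_cases hij : i = j
    · subst hij
      rw [Equiv.swap_apply_left, Equiv.swap_apply_of_ne_of_ne (by lia) hip]
      exact h₂ c hc0 hs hc hi
    · by_cases hic : i = c
      · subst hic
        rw [hc, Equiv.swap_apply_left, Equiv.swap_apply_right]
        exact hK.le
      · rw [Equiv.swap_apply_of_ne_of_ne hij hic]
        by_cases hcj : (i - 1) / 2 = j
        · rw [hcj, Equiv.swap_apply_left]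
          exact hmin i hi his hcj
        · rw [Equiv.swap_apply_of_ne_of_ne hcj hip]
          exact h₁ i hi his hcj
  · rw [hc, Equiv.swap_apply_left, Equiv.swap_apply_of_ne_of_ne (by lia) (by lia)]
    simpa only [hip] using h₁ i hi his (by lia)

end HeapOrder

theorem map_range_swap {α : Type*} (f : ℕ → α) {s j c : ℕ} (hj : j < s) (hc : c < s) :
    (Multiset.range s).map (fun i => f (Equiv.swap j c i)) = (Multiset.range s).map f := by
  have hsub : {i | Equiv.swap j c i ≠ i} ⊆ (Finset.range s : Set ℕ) := by
    intro i hi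
    rcases Equiv.swap_apply_ne_self_iff.1 hi with ⟨-, rfl | rfl⟩ <;> simpa
  calc (Multiset.range s).map (fun i => f (Equiv.swap j c i))
      = ((Finset.range s).map (Equiv.swap j c).toEmbedding).val.map f := by
        simp [Finset.map_val]
    _ = (Multiset.range s).map f := by rw [Finset.map_perm hsub]; rfl

theorem map_range_succ {α : Type*} (f : ℕ → α) (s : ℕ) :
    (Multiset.range (s + 1)).map f = f 0 ::ₘ (Multiset.range s).map fun i => f (i + 1) := by
  change Multiset.map f (Multiset.ofList (List.range (s + 1))) =
    f 0 ::ₘ Multiset.map _ (Multiset.ofList (List.range s))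
  rw [List.range_succ_eq_map]
  simp [Function.comp_def]

/-- The pairs of a key and a name at the positions below `s` of the heap arrays. -/
def heapEntries (σ : Mem) (s : ℕ) : Multiset (ℝ × ℝ) :=
  (Multiset.range s).map fun i => (σ.arr heapKey i, σ.arr heapName i)

/-- The heap arrays and the register of the heap size hold the entries `M`, each a pair of a key
and a name, as a binary heap with smallest key at the top. -/
structure HoldsHeap (σ : Mem) (M : Multiset (ℝ × ℝ)) : Prop where
  size : σ.reg heapSize = M.card
  entries : heapEntries σ M.card = M
  ordered : HeapOrdered (σ.arr heapKey) M.card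

theorem HoldsHeap.congr {σ σ' : Mem} {M : Multiset (ℝ × ℝ)} (h : HoldsHeap σ M)
    (hs : σ'.reg heapSize = σ.reg heapSize) (hn : σ'.arr heapName = σ.arr heapName)
    (hk : σ'.arr heapKey = σ.arr heapKey) : HoldsHeap σ' M :=
  ⟨hs.trans h.size, by simpa only [heapEntries, hn, hk] using h.entries, hk ▸ h.ordered⟩

theorem HoldsHeap.of_entries {σ : Mem} {s : ℕ} (hs : σ.reg heapSize = s)
    (ho : HeapOrdered (σ.arr heapKey) s) : HoldsHeap σ (heapEntries σ s) := by
  have hcard : (heapEntries σ s).card = s := by simp [heapEntries]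
  exact ⟨by rw [hcard, hs], by rw [hcard], by rwa [hcard]⟩

theorem HoldsHeap.top_mem {σ : Mem} {M : Multiset (ℝ × ℝ)} (h : HoldsHeap σ M) (hM : M ≠ 0) :
    (σ.arr heapKey 0, σ.arr heapName 0) ∈ M := by
  have : (σ.arr heapKey 0, σ.arr heapName 0) ∈ heapEntries σ M.card :=
    Multiset.mem_map.2 ⟨0, Multiset.mem_range.2 (Multiset.card_pos.2 hM), rfl⟩
  rwa [h.entries] at this

theorem HoldsHeap.top_le {σ : Mem} {M : Multiset (ℝ × ℝ)} (h : HoldsHeap σ M) :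
    ∀ x ∈ M, σ.arr heapKey 0 ≤ x.1 := by
  intro x hx
  rw [← h.entries] at hx
  obtain ⟨i, hi, rfl⟩ := Multiset.mem_map.1 hx
  exact h.ordered.le i (Multiset.mem_range.1 hi)

/-- Swap the heap entries at the positions `cursor` and `target`, and move the cursor to the
latter. -/
def swapEntries : Prog :=
  scratch ≔ cell heapKey (reg cursor) ;;
  .setCell heapKey (reg cursor) (cell heapKey (reg target)) ;;
  .setCell heapKey (reg target) (reg scratch) ;;
  scratch ≔ cell heapName (reg cursor) ;;
  .setCell heapName (reg cursor) (cell heapName (reg target)) ;;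
  .setCell heapName (reg target) (reg scratch) ;;
  cursor ≔ reg target

theorem swapEntries_spec {σ : Mem} {j c : ℕ} (hj : σ.reg cursor = j) (hc : σ.reg target = c) :
    Runs swapEntries σ fun σ' τ => τ ≤ 30 ∧ σ'.reg cursor = c ∧
      σ'.arr heapKey = σ.arr heapKey ∘ Equiv.swap j c ∧
      ∀ s, j < s → c < s → heapEntries σ' s = heapEntries σ s := by
  have hswap : Runs swapEntries σ fun σ' τ => τ ≤ 30 ∧ σ'.reg cursor = c ∧
      σ'.arr heapKey = σ.arr heapKey ∘ Equiv.swap j c ∧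
      σ'.arr heapName = σ.arr heapName ∘ Equiv.swap j c := by
    unfold swapEntries
    repeat' first | apply Runs.seq | apply Runs.setReg | apply Runs.setCell
    refine ⟨by simp, by simp [hc], funext fun i => ?_, funext fun i => ?_⟩ <;>
    · simp only [Function.comp_apply, Equiv.swap_apply_def]
      split_ifs <;> simp_all
  refine hswap.mono fun σ' τ ⟨hτ, hcur, hk, hn⟩ => ⟨hτ, hcur, hk, fun s hjs hcs => ?_⟩
  simpa only [heapEntries, hk, hn, Function.comp_apply] using
    map_range_swap (fun i => (σ.arr heapKey i, σ.arr heapName i)) hjs hcs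

theorem floor_parent (j : ℕ) : ⌊((j : ℝ) - 1) / 2⌋₊ = (j - 1) / 2 := by
  rw [Nat.floor_div_ofNat, Nat.floor_sub_one, Nat.floor_natCast]

/-- Move the heap entry at the cursor up to its place. -/
def siftUp : Prog :=
  .loop (.and (.le 1 (reg cursor))
      (.lt (cell heapKey (reg cursor)) (cell heapKey ((reg cursor - 1) / 2)))) <|
    target ≔ floor ((reg cursor - 1) / 2) ;;
    swapEntries

theorem siftUp_step {σ : Mem} {s j : ℕ} (hj : σ.reg cursor = j) (hjs : j < s) (h0 : 0 < j)
    (hK : HeapOrderedAbove (σ.arr heapKey) s j)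
    (hlt : σ.arr heapKey j < σ.arr heapKey ((j - 1) / 2)) :
    Runs (target ≔ floor ((reg cursor - 1) / 2) ;; swapEntries) σ fun σ' τ => τ ≤ 37 ∧
      σ'.reg cursor = ((j - 1) / 2 : ℕ) ∧ heapEntries σ' s = heapEntries σ s ∧
      HeapOrderedAbove (σ'.arr heapKey) s ((j - 1) / 2) := by
  have hfloor : ((⌊((j : ℝ) - 1) / 2⌋ : ℤ) : ℝ) = ((j - 1) / 2 : ℕ) := by
    have : (1 : ℝ) ≤ j := by exact_mod_cast h0
    rw [← floor_parent, natCast_floor_eq_intCast_floor (by linarith)]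
  refine .seq (.setReg ((swapEntries_spec (j := j) (c := (j - 1) / 2) (by simp [hj])
    (by simp [hj, hfloor])).mono fun σ' τ ⟨hτ, hcur, hk, hent⟩ => ⟨?_, hcur, ?_, ?_⟩))
  · simp
    lia
  · simpa [heapEntries] using hent s hjs (by lia)
  · simpa [hk] using hK.swap h0 hjs hlt

theorem siftUp_spec {σ : Mem} {s j : ℕ} (hs : σ.reg heapSize = s) (hj : σ.reg cursor = j)
    (hjs : j < s) (hK : HeapOrderedAbove (σ.arr heapKey) s j) :
    Runs siftUp σ fun σ' τ => τ ≤ 60 * Nat.log 2 (j + 1) + 20 ∧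
      HoldsHeap σ' (heapEntries σ s) := by
  refine Runs.loop (fun σ' B => ∃ j : ℕ, σ'.reg heapSize = s ∧ σ'.reg cursor = j ∧ j < s ∧
    heapEntries σ' s = heapEntries σ s ∧ HeapOrderedAbove (σ'.arr heapKey) s j ∧
    B = 60 * Nat.log 2 (j + 1)) (60 * Nat.log 2 (j + 1)) ⟨j, hs, hj, hjs, rfl, hK, rfl⟩ ?_ ?_
  · rintro σ₁ B ⟨j, hs, hj, hjs, hM, hK, rfl⟩ hb
    obtain ⟨h0, hlt⟩ : 1 ≤ j ∧ σ₁.arr heapKey j < σ₁.arr heapKey ((j - 1) / 2) := by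
      simpa [hj, floor_parent] using hb
    refine (siftUp_step hj hjs h0 hK hlt).frame.mono fun σ' τ ⟨hfr, hτ, hcur, hent, hK'⟩ =>
      ⟨_, ⟨(j - 1) / 2, (hfr.reg heapSize rfl).trans hs, hcur, by lia, hent.trans hM, hK', rfl⟩, ?_⟩
    have hlog : Nat.log 2 (j + 1) = Nat.log 2 ((j - 1) / 2 + 1) + 1 := by
      rw [Nat.log_of_one_lt_of_le (by lia) (by lia)]
      congr 2; lia
    simp
    lia
  · rintro σ' τ B' ⟨j, hs, hj, hjs, hM, hK, rfl⟩ hb hτ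
    have hdone : 0 < j → σ'.arr heapKey ((j - 1) / 2) ≤ σ'.arr heapKey j := by
      simpa [hj, floor_parent, Nat.one_le_iff_ne_zero, Nat.pos_iff_ne_zero] using hb
    refine ⟨?_, hM ▸ .of_entries hs (hK.heapOrdered hdone)⟩
    simp at hτ
    lia

/-- The left child of the cursor. -/
def leftChild : RExpr := 2 * reg cursor + 1

/-- The right child of the cursor. -/
def rightChild : RExpr := 2 * reg cursor + 2

theorem eval_leftChild {σ : Mem} {j : ℕ} (hj : σ.reg cursor = j) :
    leftChild.eval σ = (2 * j + 1 : ℕ) := by simp [leftChild, hj]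

theorem eval_rightChild {σ : Mem} {j : ℕ} (hj : σ.reg cursor = j) :
    rightChild.eval σ = (2 * j + 2 : ℕ) := by simp [rightChild, hj]

/-- The position `e` belongs to the heap and has a smaller key than the cursor. -/
def belongsAboveCursor (e : RExpr) : RTest :=
  .and (.lt e (reg heapSize)) (.lt (cell heapKey e) (cell heapKey (reg cursor)))

/-- Set the target to the child of the cursor with the smaller key. -/
def targetSmallerChild : Prog :=
  .ite (.and (.lt rightChild (reg heapSize))
      (.le (cell heapKey rightChild) (cell heapKey leftChild)))
    (target ≔ rightChild) (target ≔ leftChild)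

/-- Move the heap entry at the cursor down to its place. -/
def siftDown : Prog :=
  .loop (.not (.and (.not (belongsAboveCursor leftChild))
      (.not (belongsAboveCursor rightChild)))) <|
    targetSmallerChild ;;
    swapEntries

theorem belongsAboveCursor_holds {σ : Mem} {s j c : ℕ} {e : RExpr} (hs : σ.reg heapSize = s)
    (hj : σ.reg cursor = j) (he : e.eval σ = c) :
    (belongsAboveCursor e).holds σ ↔ c < s ∧ σ.arr heapKey c < σ.arr heapKey j := by
  simp [belongsAboveCursor, hs, hj, he]

theorem targetSmallerChild_spec {σ : Mem} {s j : ℕ} (hs : σ.reg heapSize = s)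
    (hj : σ.reg cursor = j)
    (hlt : (2 * j + 1 < s ∧ σ.arr heapKey (2 * j + 1) < σ.arr heapKey j) ∨
      (2 * j + 2 < s ∧ σ.arr heapKey (2 * j + 2) < σ.arr heapKey j)) :
    Runs targetSmallerChild σ fun σ' τ => τ ≤ 40 ∧ ∃ c : ℕ, σ'.reg target = c ∧
      (c = 2 * j + 1 ∨ c = 2 * j + 2) ∧ c < s ∧ σ.arr heapKey c < σ.arr heapKey j ∧
      ∀ i, 0 < i → i < s → (i - 1) / 2 = j → σ.arr heapKey c ≤ σ.arr heapKey i := by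
  have hchild : ∀ i, 0 < i → (i - 1) / 2 = j → i = 2 * j + 1 ∨ i = 2 * j + 2 := by lia
  refine .ite (fun hb => .setReg ⟨by simp [leftChild, rightChild], 2 * j + 2, ?_⟩)
    (fun hb => .setReg ⟨by simp [leftChild, rightChild], 2 * j + 1, ?_⟩)
  · obtain ⟨hrs, hrl⟩ : 2 * j + 2 < s ∧ σ.arr heapKey (2 * j + 2) ≤ σ.arr heapKey (2 * j + 1) := by
      simpa only [RTest.holds, RTest.holds_lt, eval, eval_leftChild hj, eval_rightChild hj, hs,
        Nat.floor_natCast, Nat.cast_lt] using hb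
    refine ⟨by simp [eval_rightChild hj], .inr rfl, hrs, ?_, fun i h0 hi hij => ?_⟩
    · exact hlt.elim (fun h => hrl.trans_lt h.2) (·.2)
    · obtain rfl | rfl := hchild i h0 hij
      exacts [hrl, le_rfl]
  · have hlr : 2 * j + 2 < s → σ.arr heapKey (2 * j + 1) < σ.arr heapKey (2 * j + 2) := by
      simpa only [RTest.holds, RTest.holds_lt, eval, eval_leftChild hj, eval_rightChild hj, hs,
        Nat.floor_natCast, Nat.cast_lt, not_and, not_le] using hb
    refine ⟨by simp [eval_leftChild hj], .inl rfl, ?_, ?_, fun i h0 hi hij => ?_⟩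
    · exact hlt.elim (·.1) (fun h => by lia)
    · exact hlt.elim (·.2) (fun h => (hlr h.1).trans h.2)
    · obtain rfl | rfl := hchild i h0 hij
      exacts [le_rfl, (hlr hi).le]

theorem siftDown_step {σ : Mem} {s j : ℕ} (hs : σ.reg heapSize = s) (hj : σ.reg cursor = j)
    (hK : HeapOrderedBelow (σ.arr heapKey) s j)
    (hlt : (2 * j + 1 < s ∧ σ.arr heapKey (2 * j + 1) < σ.arr heapKey j) ∨
      (2 * j + 2 < s ∧ σ.arr heapKey (2 * j + 2) < σ.arr heapKey j)) :
    Runs (targetSmallerChild ;; swapEntries) σ fun σ' τ => τ ≤ 70 ∧ ∃ c : ℕ,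
      (c = 2 * j + 1 ∨ c = 2 * j + 2) ∧ c < s ∧ σ'.reg cursor = c ∧
      heapEntries σ' s = heapEntries σ s ∧ HeapOrderedBelow (σ'.arr heapKey) s c := by
  refine .seq_of_spec (targetSmallerChild_spec hs hj hlt) ?_
  rintro σ₁ τ₁ hfr ⟨hτ₁, c, htar, hc, hcs, hcj, hmin⟩
  refine (swapEntries_spec ((hfr.reg cursor rfl).trans hj) htar).mono
    fun σ' τ ⟨hτ, hcur, hk, hent⟩ => ⟨by lia, c, hc, hcs, hcur, ?_, ?_⟩
  · rw [hent s (by lia) hcs, heapEntries, hfr.arr heapKey rfl, hfr.arr heapName rfl, heapEntries]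
  · rw [hk, hfr.arr heapKey rfl]
    exact hK.swap (by lia) (by lia) hcs hcj hmin

theorem siftDown_spec {σ : Mem} {s j : ℕ} (hs : σ.reg heapSize = s) (hj : σ.reg cursor = j)
    (hK : HeapOrderedBelow (σ.arr heapKey) s j) :
    Runs siftDown σ fun σ' τ => τ ≤ 150 * Nat.log 2 s + 50 ∧ HoldsHeap σ' (heapEntries σ s) := by
  refine Runs.loop (fun σ' B => ∃ j : ℕ, σ'.reg heapSize = s ∧ σ'.reg cursor = j ∧
    heapEntries σ' s = heapEntries σ s ∧ HeapOrderedBelow (σ'.arr heapKey) s j ∧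
    B = 150 * (Nat.log 2 s - Nat.log 2 (j + 1)))
    (150 * (Nat.log 2 s - Nat.log 2 (j + 1))) ⟨j, hs, hj, rfl, hK, rfl⟩ ?_ ?_
  · rintro σ₁ B ⟨j, hs, hj, hM, hK, rfl⟩ hb
    rw [RTest.holds, RTest.holds, RTest.holds, RTest.holds,
      belongsAboveCursor_holds hs hj (eval_leftChild hj),
      belongsAboveCursor_holds hs hj (eval_rightChild hj), ← not_or, not_not] at hb
    refine (siftDown_step hs hj hK hb).frame.mono ?_
    rintro σ' τ ⟨hfr, hτ, c, hc, hcs, hcur, hent, hK'⟩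
    refine ⟨_, ⟨c, (hfr.reg heapSize rfl).trans hs, hcur, hent.trans hM, hK', rfl⟩, ?_⟩
    have hlog : Nat.log 2 (c + 1) = Nat.log 2 (j + 1) + 1 := by
      rw [Nat.log_of_one_lt_of_le (by lia) (by lia)]
      congr 2; lia
    have hlog_le : Nat.log 2 (c + 1) ≤ Nat.log 2 s := Nat.log_mono_right (by lia)
    simp [belongsAboveCursor, leftChild, rightChild]
    lia
  · rintro σ' τ B' ⟨j, hs, hj, hM, hK, rfl⟩ hb hτ
    rw [RTest.holds, not_not, RTest.holds, RTest.holds, RTest.holds,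
      belongsAboveCursor_holds hs hj (eval_leftChild hj),
      belongsAboveCursor_holds hs hj (eval_rightChild hj)] at hb
    simp only [not_and, not_lt] at hb
    refine ⟨?_, hM ▸ .of_entries hs (hK.heapOrdered hb.1 hb.2)⟩
    simp [belongsAboveCursor, leftChild, rightChild] at hτ
    lia

/-- Insert an entry with the given key and name into the heap. -/
def heapInsert : Prog :=
  .setCell heapKey (reg heapSize) (reg key) ;;
  .setCell heapName (reg heapSize) (reg name) ;;
  cursor ≔ reg heapSize ;;
  heapSize ≔ reg heapSize + 1 ;;
  siftUp

theorem heapInsert_spec {σ : Mem} {M : Multiset (ℝ × ℝ)} (h : HoldsHeap σ M) :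
    Runs heapInsert σ fun σ' τ => τ ≤ 60 * Nat.log 2 (M.card + 1) + 40 ∧
      HoldsHeap σ' ((σ.reg key, σ.reg name) ::ₘ M) := by
  have hs := h.size
  unfold heapInsert
  repeat' first | apply Runs.seq | apply Runs.setReg | apply Runs.setCell
  refine (siftUp_spec (s := M.card + 1) (j := M.card) (by simp [hs]) (by simp [hs]) (by lia)
    (h.ordered.heapOrderedAbove_succ fun i hi => ?_)).mono fun σ' τ ⟨hτ, hH⟩ => ⟨?_, ?_⟩
  · simp [hs, hi.ne]
  · simp
    lia
  · convert hH
    conv_lhs => rw [← h.entries]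
    simp only [heapEntries, Multiset.range_succ, Multiset.map_cons]
    congr 1
    · simp [hs]
    · refine Multiset.map_congr rfl fun i hi => ?_
      simp [hs, (Multiset.mem_range.1 hi).ne]

/-- Remove the entry at the top of the heap, and read its key and name. -/
def heapPop : Prog :=
  key ≔ cell heapKey 0 ;;
  name ≔ cell heapName 0 ;;
  heapSize ≔ reg heapSize - 1 ;;
  .setCell heapKey 0 (cell heapKey (reg heapSize)) ;;
  .setCell heapName 0 (cell heapName (reg heapSize)) ;;
  cursor ≔ 0 ;;
  siftDown

theorem cons_map_range_update_zero {α : Type*} (f : ℕ → α) (s : ℕ) :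
    f 0 ::ₘ (Multiset.range s).map (Function.update f 0 (f s)) =
      (Multiset.range (s + 1)).map f := by
  rcases s with _ | s
  · simp
  · rw [map_range_succ, Multiset.range_succ, Multiset.map_cons, map_range_succ f,
      Multiset.cons_swap]
    simp

theorem heapPop_spec {σ : Mem} {M : Multiset (ℝ × ℝ)} (h : HoldsHeap σ M) (hM : M ≠ 0) :
    Runs heapPop σ fun σ' τ => τ ≤ 150 * Nat.log 2 M.card + 80 ∧ σ'.reg key = σ.arr heapKey 0 ∧
      ∃ M', M = (σ'.reg key, σ'.reg name) ::ₘ M' ∧ HoldsHeap σ' M' := by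
  obtain ⟨s, hs⟩ : ∃ s, M.card = s + 1 := Nat.exists_eq_add_one.2 (Multiset.card_pos.2 hM)
  have hsize : σ.reg heapSize - 1 = s := by simp [h.size, hs]
  have hlog : Nat.log 2 s ≤ Nat.log 2 M.card := Nat.log_mono_right (by lia)
  unfold heapPop
  repeat' first | apply Runs.seq | apply Runs.setReg | apply Runs.setCell
  refine (siftDown_spec (s := s) (j := 0) (by simpa using hsize) (by simp)
    (h.ordered.heapOrderedBelow_zero (by lia) fun i hi => ?_)).frame.mono
    fun σ' τ ⟨hfr, hτ, hH⟩ => ?_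
  · simp [hi.ne']
  · have hkey : σ'.reg key = σ.arr heapKey 0 := by simpa using hfr.reg key rfl
    have hname : σ'.reg name = σ.arr heapName 0 := by simpa using hfr.reg name rfl
    refine ⟨by simp; lia, hkey, _, ?_, hH⟩
    rw [hkey, hname, ← h.entries, hs, heapEntries,
      ← cons_map_range_update_zero fun i => (σ.arr heapKey i, σ.arr heapName i)]
    congr 1
    refine Multiset.map_congr rfl fun i _ => ?_
    have hfloor : ⌊σ.reg heapSize⌋₊ - 1 = s := by
      rw [h.size, Nat.floor_natCast, hs, Nat.add_sub_cancel]
    by_cases hi : i = 0 <;> simp [hi, hfloor]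

/-! ### Generating a schedule with a priority queue -/

theorem map_univ_fin_eq_map_range {α : Type*} (n : ℕ) (f : ℕ → α) :
    (Finset.univ : Finset (Fin n)).val.map (fun i : Fin n => f i) = (Multiset.range n).map f := by
  rw [Fin.univ_val_map]
  change Multiset.ofList (List.ofFn fun i : Fin n => f i) = Multiset.map f (List.range n)
  rw [Multiset.map_coe]
  congr 1
  apply List.ext_getElem <;> simp

theorem exists_perm_of_map_univ_eq {ι α : Type*} [Fintype ι] {f g : ι → α}
    (hg : Function.Injective g) (h : Finset.univ.val.map f = Finset.univ.val.map g) :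
    ∃ e : Equiv.Perm ι, f = g ∘ e := by
  have hmem : ∀ j, ∃ i, g i = f j := fun j => by
    have := Multiset.mem_map_of_mem f (Finset.mem_univ_val j)
    rw [h] at this
    simpa using this
  choose e he using hmem
  have hsurj : Function.Surjective e := fun i => by
    have := Multiset.mem_map_of_mem g (Finset.mem_univ_val i)
    rw [← h] at this
    obtain ⟨j, hj⟩ : ∃ j, f j = g i := by simpa using this
    exact ⟨j, hg ((he j).trans hj)⟩
  exact ⟨.ofBijective e (Finite.surjective_iff_bijective.1 hsurj), funext fun j => (he j).symm⟩

section Positions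

variable {n : ℕ} {p q : Fin n → ℕ} {T : ℕ} {i : Fin n}

/-- The positions `p + k * q`, `k ≥ 0`. -/
def positions (p q : ℕ) : Set ℕ := {T | ∃ k : ℕ, T = p + k * q}

theorem isLeast_positions_zero (p q : ℕ) : IsLeast (positions p q ∩ Set.Ici 0) p :=
  ⟨⟨⟨0, by simp⟩, Nat.zero_le p⟩, by rintro _ ⟨⟨k, rfl⟩, -⟩; exact Nat.le_add_right p _⟩

theorem isLeast_positions_add {p q : ℕ} (hq : 0 < q) (hT : T ∈ positions p q) :
    IsLeast (positions p q ∩ Set.Ici (T + 1)) (T + q) := by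
  obtain ⟨k, rfl⟩ := hT
  refine ⟨⟨⟨k + 1, by ring⟩, Set.mem_Ici.2 (by lia)⟩, ?_⟩
  rintro _ ⟨⟨k', rfl⟩, hk : p + k * q + 1 ≤ p + k' * q⟩
  have hlt : k < k' := lt_of_mul_lt_mul_right (a := q) (by lia) hq.le
  calc p + k * q + q = p + (k + 1) * q := by ring
    _ ≤ p + k' * q := by gcongr; lia

theorem isLeast_positions_succ {p q t : ℕ} (h : IsLeast (positions p q ∩ Set.Ici T) t)
    (ht : t ≠ T) : IsLeast (positions p q ∩ Set.Ici (T + 1)) t :=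
  ⟨⟨h.1.1, Nat.lt_of_le_of_ne h.1.2 ht.symm⟩,
    fun _ hx => h.2 ⟨hx.1, (Nat.le_succ T).trans hx.2⟩⟩

theorem IsCyclicSchedule.eq_of_mem (h : IsCyclicSchedule p q) {j : Fin n}
    (hi : T ∈ positions (p i) (q i)) (hj : T ∈ positions (p j) (q j)) : i = j :=
  (h.2 T).unique hi hj

theorem IsCyclicSchedule.eq_of_forall_le (h : IsCyclicSchedule p q) {t : Fin n → ℕ}
    (ht : ∀ j, IsLeast (positions (p j) (q j) ∩ Set.Ici T) (t j)) (hi : ∀ j, t i ≤ t j) :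
    t i = T := by
  obtain ⟨j, hj, -⟩ := h.2 T
  exact le_antisymm ((hi j).trans ((ht j).2 ⟨hj, le_refl T⟩)) (ht i).1.2

theorem IsCyclicSchedule.isLeast_update (h : IsCyclicSchedule p q) {t : Fin n → ℕ}
    (ht : ∀ j, IsLeast (positions (p j) (q j) ∩ Set.Ici T) (t j)) (hi : t i = T) (j : Fin n) :
    IsLeast (positions (p j) (q j) ∩ Set.Ici (T + 1)) (Function.update t i (t i + q i) j) := by
  have hTi : T ∈ positions (p i) (q i) := hi ▸ (ht i).1.1
  by_cases hj : j = i
  · subst hj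
    rw [Function.update_self, hi]
    exact isLeast_positions_add (h.1 j) hTi
  · rw [Function.update_of_ne hj]
    exact isLeast_positions_succ (ht j) fun hjT => hj (h.eq_of_mem (hjT ▸ (ht j).1.1) hTi)

end Positions

/-- The heap entries of the pairs `(i, t i)`. -/
def queueEntries {n : ℕ} (t : Fin n → ℕ) : Multiset (ℝ × ℝ) :=
  Finset.univ.val.map fun i => ((t i : ℝ), ((i : ℕ) : ℝ))

@[simp] theorem card_queueEntries {n : ℕ} (t : Fin n → ℕ) : (queueEntries t).card = n := by
  simp [queueEntries]

theorem HoldsHeap.holdsQueue {n : ℕ} {σ : Mem} {t : Fin n → ℕ}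
    (h : HoldsHeap σ (queueEntries t)) : HoldsQueue σ t := by
  obtain ⟨-, hent, hord⟩ := h
  rw [card_queueEntries] at hent hord
  rw [heapEntries,
    ← map_univ_fin_eq_map_range n fun i => (σ.arr heapKey i, σ.arr heapName i)] at hent
  have hinj : Function.Injective fun i : Fin n => ((t i : ℝ), ((i : ℕ) : ℝ)) := fun i j hij =>
    Fin.ext (Nat.cast_injective (Prod.ext_iff.1 hij).2)
  obtain ⟨e, he⟩ := exists_perm_of_map_univ_eq hinj hent
  have hj (j : Fin n) := Prod.ext_iff.1 (congrFun he j)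
  exact ⟨e, fun j => ⟨(hj j).2, (hj j).1⟩, hord⟩

/-- Build the heap of the pairs `(i, p i)`. -/
def setupProg : Prog :=
  .loop (.lt (reg heapSize) (reg itemCount)) <|
    key ≔ cell start (reg heapSize) ;;
    name ≔ reg heapSize ;;
    heapInsert

theorem setupProg_spec_range {n : ℕ} {σ : Mem} (hn : σ.reg itemCount = n)
    (hs : σ.reg heapSize = 0) :
    Runs setupProg σ fun σ' τ => τ ≤ n * (60 * Nat.log 2 n + 60) + 10 ∧
      HoldsHeap σ' ((Multiset.range n).map fun i => (σ.arr start i, (i : ℝ))) := by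
  let entries (s : ℕ) : Multiset (ℝ × ℝ) :=
    (Multiset.range s).map fun i => (σ.arr start i, (i : ℝ))
  have hcard : ∀ s, (entries s).card = s := by simp [entries]
  refine Runs.loop (fun σ' B => ∃ s ≤ n, σ'.reg itemCount = n ∧ σ'.arr start = σ.arr start ∧
    HoldsHeap σ' (entries s) ∧ B = (n - s) * (60 * Nat.log 2 n + 60))
    (n * (60 * Nat.log 2 n + 60))
    ⟨0, by lia, hn, rfl, ⟨by simp [hs, entries], rfl, fun i _ h => by simp [entries] at h⟩, rfl⟩
    ?_ ?_
  · rintro σ₁ B ⟨s, -, hn, hp, hH, rfl⟩ hb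
    have hsize : σ₁.reg heapSize = s := by rw [hH.size, hcard]
    have hsn : s < n := by simpa only [RTest.holds_lt, eval, hsize, hn, Nat.cast_lt] using hb
    refine .seq (.setReg (.seq (.setReg ?_)))
    refine (heapInsert_spec (hH.congr (by simp) (by rfl) (by rfl))).frame.mono
      fun σ' τ ⟨hfr, hτ, hH'⟩ => ⟨_, ⟨s + 1, hsn, ?_, ?_, ?_, rfl⟩, ?_⟩
    · simpa [hn] using hfr.reg itemCount rfl
    · simpa [hp] using hfr.arr start rfl
    · simpa [entries, hsize, hp] using hH'
    · have hlog : Nat.log 2 (s + 1) ≤ Nat.log 2 n := Nat.log_mono_right hsn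
      rw [hcard] at hτ
      rw [show n - s = n - (s + 1) + 1 by lia, add_mul]
      simp
      lia
  · rintro σ' τ B' ⟨s, hs, hn, _, hH, rfl⟩ hb hτ
    obtain rfl : s = n := by
      refine hs.antisymm ?_
      simpa only [RTest.holds_lt, eval, hH.size, hcard, hn, Nat.cast_lt, not_lt] using hb
    refine ⟨?_, hH⟩
    simp at hτ
    lia

theorem setupProg_spec {n : ℕ} (p q : Fin n → ℕ) :
    Runs setupProg (pairsMem p q) fun σ' τ => τ ≤ n * (60 * Nat.log 2 n + 60) + 10 ∧
      HoldsHeap σ' (queueEntries p) ∧ ∀ i : Fin n, σ'.arr period i = q i := by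
  refine (setupProg_spec_range (n := n) (by simp [pairsMem]) (by simp [pairsMem])).frame.mono
    fun σ' τ ⟨hfr, hτ, hH⟩ => ⟨hτ, ?_, fun i => ?_⟩
  · rw [← map_univ_fin_eq_map_range n fun i => ((pairsMem p q).arr start i, (i : ℝ))] at hH
    simpa only [queueEntries, pairsMem, Fin.is_lt, dite_true, Fin.eta, if_true] using hH
  · rw [hfr.arr period rfl]
    simp [pairsMem]

/-- Output the item with the smallest key, and move it to its next position. -/
def nextProg : Prog :=
  output ≔ cell heapName 0 ;;
  .setCell heapKey 0 (cell heapKey 0 + cell period (reg output)) ;;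
  cursor ≔ 0 ;;
  siftDown

theorem HoldsQueue.heapEntries_update {n : ℕ} {σ σ' : Mem} {t : Fin n → ℕ}
    {e : Equiv.Perm (Fin n)} {o : Fin n} {x : ℕ}
    (he : ∀ j : Fin n, σ.arr heapName j = (e j : ℕ) ∧ σ.arr heapKey j = t (e j))
    (hn : σ'.arr heapName = σ.arr heapName)
    (hk : σ'.arr heapKey = Function.update (σ.arr heapKey) o (x : ℝ)) :
    heapEntries σ' n = queueEntries (Function.update t (e o) x) := by
  rw [heapEntries, queueEntries,
    ← map_univ_fin_eq_map_range n fun i => (σ'.arr heapKey i, σ'.arr heapName i)]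
  conv_rhs => rw [← Multiset.map_univ_val_equiv e, Multiset.map_map]
  refine Multiset.map_congr rfl fun j _ => ?_
  by_cases hj : j = o
  · subst hj
    simp [hn, hk, he]
  · have : (j : ℕ) ≠ o := fun h => hj (Fin.ext h)
    simp [hn, hk, he, hj, this]

theorem nextProg_spec {n : ℕ} (hn : 0 < n) {σ : Mem} {t q : Fin n → ℕ}
    (hH : HoldsHeap σ (queueEntries t)) (hq : ∀ i : Fin n, σ.arr period i = q i) :
    ∃ i : Fin n, (∀ j, t i ≤ t j) ∧ Runs nextProg σ fun σ' τ =>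
      τ ≤ 150 * Nat.log 2 n + 80 ∧
      HoldsHeap σ' (queueEntries (Function.update t i (t i + q i))) ∧
      (∀ i : Fin n, σ'.arr period i = q i) ∧ σ'.reg output = (i : ℕ) := by
  obtain ⟨e, he, hord⟩ := hH.holdsQueue
  let top : Fin n := ⟨0, hn⟩
  have hname : σ.arr heapName 0 = (e top : ℕ) := (he top).1
  have hkey : σ.arr heapKey 0 = t (e top) := (he top).2
  refine ⟨e top, fun j => ?_, ?_⟩
  · have := hH.top_le ((t j : ℝ), ((j : ℕ) : ℝ)) (Multiset.mem_map_of_mem _ (Finset.mem_univ_val j))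
    rwa [hkey, Nat.cast_le] at this
  · unfold nextProg
    repeat' first | apply Runs.seq | apply Runs.setReg | apply Runs.setCell
    refine (siftDown_spec (s := n) (j := 0) (by simpa using hH.size) (by simp)
      (HeapOrdered.heapOrderedBelow_zero hord le_rfl fun i hi => ?_)).frame.mono
      fun σ' τ ⟨hfr, hτ, hH'⟩ => ⟨?_, ?_, fun i => ?_, ?_⟩
    · simp [hi.ne']
    · simp
      lia
    · convert hH'
      refine (HoldsQueue.heapEntries_update he (by rfl) (funext fun i => ?_)).symm
      simp [hname, hkey, hq, Function.update_apply, top]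
    · simpa [hq] using congrFun (hfr.arr period rfl) i
    · simpa [hname] using hfr.reg output rfl

/-- The memory between the runs of `nextProg` before position `T`: the key of each item in the queue
is the first of its positions from `T` on. -/
structure QueueAt {n : ℕ} (p q : Fin n → ℕ) (T : ℕ) (σ : Mem) (t : Fin n → ℕ) : Prop where
  heap : HoldsHeap σ (queueEntries t)
  period : ∀ i : Fin n, σ.arr Arr.period i = q i
  next : ∀ i, IsLeast (positions (p i) (q i) ∩ Set.Ici T) (t i)

theorem QueueAt.step {n : ℕ} {p q : Fin n → ℕ} (hpq : IsCyclicSchedule p q) {T : ℕ} {σ : Mem}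
    {t : Fin n → ℕ} (h : QueueAt p q T σ t) :
    ∃ i : Fin n, (∀ j, t i ≤ t j) ∧ T ∈ positions (p i) (q i) ∧ ∃ σ' τ, Exec nextProg σ σ' τ ∧
      τ ≤ 150 * Nat.log 2 n + 80 ∧ σ'.reg output = (i : ℕ) ∧
      QueueAt p q (T + 1) σ' (Function.update t i (t i + q i)) := by
  have hn : 0 < n := (hpq.2 T).choose.pos
  obtain ⟨i, hmin, σ', τ, hrun, hτ, hheap, hperiod, hout⟩ := nextProg_spec hn h.heap h.period
  have hi : t i = T := hpq.eq_of_forall_le h.next hmin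
  exact ⟨i, hmin, hi ▸ (h.next i).1.1, σ', τ, hrun, hτ, hout, hheap, hperiod,
    hpq.isLeast_update h.next hi⟩

theorem exists_queue_run {n : ℕ} {p q : Fin n → ℕ} (hpq : IsCyclicSchedule p q) :
    ∃ (σ : ℕ → Mem) (t : ℕ → Fin n → ℕ) (item : ℕ → Fin n) (τ₀ : ℕ) (τ : ℕ → ℕ),
      Exec setupProg (pairsMem p q) (σ 0) τ₀ ∧ τ₀ ≤ n * (60 * Nat.log 2 n + 60) + 10 ∧
      t 0 = p ∧ ∀ T : ℕ, HoldsQueue (σ T) (t T) ∧ (∀ i, t T (item T) ≤ t T i) ∧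
        t (T + 1) = Function.update (t T) (item T) (t T (item T) + q (item T)) ∧
        Exec nextProg (σ T) (σ (T + 1)) (τ T) ∧ τ T ≤ 150 * Nat.log 2 n + 80 ∧
        (σ (T + 1)).reg output = (item T : ℕ) ∧ T ∈ positions (p (item T)) (q (item T)) := by
  obtain ⟨σ₀, τ₀, hrun, hτ₀, hheap, hperiod⟩ := setupProg_spec p q
  let Queue (T : ℕ) : Type := {x : Mem × (Fin n → ℕ) // QueueAt p q T x.1 x.2}
  have hstep (T : ℕ) (x : Queue T) := x.2.step hpq
  choose item hmin hpos σ' τ hexec hτ hout hnext using hstep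
  let queue (T : ℕ) : Queue T := T.rec
    ⟨(σ₀, p), hheap, hperiod, fun i => isLeast_positions_zero (p i) (q i)⟩
    fun T x => ⟨(σ' T x, _), hnext T x⟩
  exact ⟨fun T => (queue T).1.1, fun T => (queue T).1.2, fun T => item T (queue T), τ₀,
    fun T => τ T (queue T), hrun, hτ₀, rfl, fun T => ⟨(queue T).2.heap.holdsQueue, hmin T _, rfl,
      hexec T _, hτ T _, hout T _, hpos T _⟩⟩

/-! ### Expanding trees -/

section Schedule

variable {n m : ℕ} {i i' : Fin n} {t : FTree n} {p q p₁ q₁ p₂ q₂ : ℕ} {child : Fin m → FTree n}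

/-- The items at the leaves of a tree. -/
def FTree.leaves : FTree n → Multiset (Fin n)
  | leaf i => {i}
  | node _ child => ∑ l, (child l).leaves

/-- Every node of the tree has a child, so that none of its occurrences is lost in the
expansion. -/
def FTree.Full : FTree n → Prop
  | leaf _ => True
  | node m child => 0 < m ∧ ∀ l, (child l).Full

theorem Places.period_pos (h : Places t p q i p₁ q₁) (hq : 0 < q) : 0 < q₁ := by
  induction h with
  | leaf => exact hq
  | node l _ ih => exact ih (Nat.mul_pos l.pos hq)

theorem Places.mem_leaves (h : Places t p q i p₁ q₁) : i ∈ t.leaves := by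
  induction h with
  | leaf => exact Multiset.mem_singleton_self _
  | node l _ ih => exact Multiset.mem_sum.2 ⟨l, Finset.mem_univ l, ih⟩

theorem Places.exists_root_position (h : Places t p q i p₁ q₁) (k : ℕ) :
    ∃ k', p₁ + k * q₁ = p + k' * q := by
  induction h with
  | leaf => exact ⟨k, rfl⟩
  | @node m _ p q _ p₁ q₁ l _ ih =>
    obtain ⟨k', hk'⟩ := ih
    exact ⟨l + k' * m, by rw [hk']; ring⟩

theorem FTree.Full.exists_places (ht : t.Full) (p q k : ℕ) :
    ∃ i p' q' k', Places t p q i p' q' ∧ p + k * q = p' + k' * q' := by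
  induction t generalizing p q k with
  | leaf i => exact ⟨i, p, q, k, .leaf i p q, rfl⟩
  | node m child ih =>
    let l : Fin m := ⟨k % m, Nat.mod_lt _ ht.1⟩
    obtain ⟨i, p', q', k', hplaces, hpos⟩ := ih l (ht.2 l) (p + l * q) (m * q) (k / m)
    refine ⟨i, p', q', k', .node l hplaces, ?_⟩
    calc p + k * q = p + (k % m + m * (k / m)) * q := by rw [Nat.mod_add_div]
      _ = p + k % m * q + k / m * (m * q) := by ring
      _ = p' + k' * q' := hpos

theorem Places.item_eq_of_position_eq (h : Places t p q i p₁ q₁) (hq : 0 < q)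
    (h' : Places t p q i' p₂ q₂) {k₁ k₂ : ℕ} (heq : p₁ + k₁ * q₁ = p₂ + k₂ * q₂) : i = i' := by
  induction h with
  | leaf => cases h'; rfl
  | @node m child p q i p₁ q₁ l hl ih =>
    cases h' with
    | node l' hl' =>
      obtain ⟨a, ha⟩ := hl.exists_root_position k₁
      obtain ⟨b, hb⟩ := hl'.exists_root_position k₂
      have hab : l + a * m = l' + b * m := by
        refine Nat.eq_of_mul_eq_mul_right hq (Nat.add_left_cancel (n := p) ?_)
        linear_combination ha.symm.trans (heq.trans hb)
      obtain rfl : l = l' := by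
        have hmod := congrArg (· % m) hab
        simp only [Nat.add_mul_mod_self_right, Nat.mod_eq_of_lt l.2, Nat.mod_eq_of_lt l'.2] at hmod
        exact Fin.ext hmod
      exact ih (Nat.mul_pos l.pos hq) hl' heq

theorem FTree.nodup_leaves_child (h : (FTree.node m child).leaves.Nodup) (l : Fin m) :
    (child l).leaves.Nodup :=
  Multiset.nodup_of_le (Finset.single_le_sum (f := fun l => (child l).leaves)
    (fun _ _ => Multiset.zero_le _) (Finset.mem_univ l)) h

theorem FTree.child_unique (h : (FTree.node m child).leaves.Nodup) {l l' : Fin m}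
    (hl : i ∈ (child l).leaves) (hl' : i ∈ (child l').leaves) : l = l' := by
  by_contra hne
  have hle : (child l).leaves + (child l').leaves ≤ (FTree.node m child).leaves := by
    rw [FTree.leaves, ← Finset.sum_pair (f := fun l => (child l).leaves) hne]
    exact Finset.sum_le_sum_of_subset (Finset.subset_univ _)
  exact Multiset.disjoint_left.1 (Multiset.nodup_add.1 (Multiset.nodup_of_le hle h)).2.2 hl hl'

theorem Places.unique (h : Places t p q i p₁ q₁) (ht : t.leaves.Nodup)
    (h' : Places t p q i p₂ q₂) : p₁ = p₂ ∧ q₁ = q₂ := by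
  induction h with
  | leaf => cases h'; exact ⟨rfl, rfl⟩
  | node l hl ih =>
    cases h' with
    | node l' hl' =>
      obtain rfl := FTree.child_unique ht hl.mem_leaves hl'.mem_leaves
      exact ih (FTree.nodup_leaves_child ht l) hl'

theorem isCyclicSchedule_of_places (ht : t.Full) (hl : t.leaves = Finset.univ.val)
    {p q : Fin n → ℕ} (h : ∀ i, Places t 0 1 i (p i) (q i)) : IsCyclicSchedule p q := by
  refine ⟨fun i => (h i).period_pos one_pos, fun T => ?_⟩
  obtain ⟨i, p', q', k, hplaces, hT⟩ := ht.exists_places 0 1 T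
  obtain ⟨rfl, rfl⟩ := hplaces.unique (hl ▸ Finset.univ.nodup) (h i)
  rw [mul_one, zero_add] at hT
  refine ⟨i, ⟨k, hT⟩, ?_⟩
  rintro i' ⟨k', hT'⟩
  exact (h i').item_eq_of_position_eq one_pos (h i) (hT'.symm.trans hT)

/-- The trees of the frequencies partition the items, and none of them has a node without
children. All steps of the Main Algorithm preserve this. -/
structure Freqs.Covers (S : Freqs n) : Prop where
  leaves : (S.map fun x => x.2.leaves).sum = Finset.univ.val
  full : ∀ x ∈ S, x.2.Full

variable {S S' : Freqs n} {v : ℝ}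

theorem Combine.covers (h : Combine m v S S') (hm : 0 < m) (hS : S.Covers) : S'.Covers := by
  obtain ⟨R, child⟩ := h
  refine ⟨?_, fun x hx => ?_⟩
  · rw [← hS.leaves]
    simp only [Multiset.map_add, Multiset.sum_add, Multiset.map_singleton, Multiset.sum_singleton,
      Multiset.map_map, FTree.leaves]
    rfl
  · rcases Multiset.mem_add.1 hx with hx | hx
    · exact hS.full x (Multiset.mem_add.2 (.inl hx))
    · rw [Multiset.mem_singleton.1 hx]
      exact ⟨hm, fun l => hS.full (v, child l)
        (Multiset.mem_add.2 (.inr (Multiset.mem_map_of_mem _ (Finset.mem_univ_val l))))⟩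

theorem CombineAll.covers (h : CombineAll m v S S') (hS : S.Covers) : S'.Covers := by
  obtain ⟨hsteps, hcount⟩ := h
  have hm : 0 < m := Nat.zero_lt_of_lt hcount
  clear hcount
  induction hsteps with
  | refl => exact hS
  | tail _ h ih => exact h.covers hm ih

theorem Freqs.Covers.pushDown (hS : S.Covers) (v w : ℝ) : (pushDown v w S).Covers := by
  have hsnd : ∀ x : ℝ × FTree n, (if x.1 = v then (w, x.2) else x).2 = x.2 := by
    intro x; split_ifs <;> rfl
  refine ⟨?_, fun x hx => ?_⟩
  · rw [← hS.leaves, BambooGarden.pushDown, Multiset.map_map]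
    simp only [Function.comp_def, hsnd]
  · obtain ⟨y, hy, rfl⟩ := Multiset.mem_map.1 hx
    rw [hsnd]
    exact hS.full y hy

theorem MergeLargest.covers (h : MergeLargest S S') (hS : S.Covers) : S'.Covers := by
  obtain ⟨R, a, b, s, t, -, -⟩ := h
  refine ⟨?_, fun x hx => ?_⟩
  · rw [← hS.leaves]
    simp only [Multiset.map_add, Multiset.sum_add, Multiset.insert_eq_cons, Multiset.map_cons,
      Multiset.map_singleton, Multiset.sum_cons, Multiset.sum_singleton, FTree.leaves,
      Fin.sum_univ_two, Matrix.cons_val_zero, Matrix.cons_val_one]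
  · rcases Multiset.mem_add.1 hx with hx | hx
    · exact hS.full x (Multiset.mem_add.2 (.inl hx))
    · rw [Multiset.mem_singleton.1 hx]
      exact ⟨two_pos, Fin.forall_fin_two.2
        ⟨hS.full (a, s) (by simp), hS.full (b, t) (by simp)⟩⟩

theorem Freqs.covers_leaves (f : Fin n → ℝ) :
    Freqs.Covers (Finset.univ.val.map fun i => (f i, FTree.leaf i)) := by
  refine ⟨?_, fun x hx => ?_⟩
  · rw [Multiset.map_map]
    exact Multiset.sum_map_singleton _
  · obtain ⟨i, -, rfl⟩ := Multiset.mem_map.1 hx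
    trivial

theorem Step6.isCyclicSchedule {p q : Fin n → ℕ} (h : Step6 S p q) (hS : S.Covers) :
    IsCyclicSchedule p q := by
  obtain ⟨v, t, hmerge, hplaces⟩ := h
  have hcov : Freqs.Covers {(v, t)} := by
    generalize ({(v, t)} : Freqs n) = S' at hmerge
    induction hmerge with
    | refl => exact hS
    | tail _ h ih => exact h.covers ih
  refine isCyclicSchedule_of_places (hcov.full (v, t) (Multiset.mem_singleton_self _)) ?_ hplaces
  simpa only [Multiset.map_singleton, Multiset.sum_singleton] using hcov.leaves

theorem ForEach.invariant {α β : Type} {R : α → β → β → Prop} {I : β → Prop}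
    (hR : ∀ a S S', R a S S' → I S → I S') {l : List α} {S S' : β} (h : ForEach R l S S')
    (hS : I S) : I S' := by
  induction l generalizing S with
  | nil => exact h ▸ hS
  | cons a l ih =>
    obtain ⟨S₁, hstep, hrest⟩ := h
    exact ih hrest (hR _ _ _ hstep hS)

theorem MainAlgorithm.isCyclicSchedule {hn : 0 < n} {h : Fin n → ℝ} {p q : Fin n → ℕ}
    (H : MainAlgorithm hn h p q) : IsCyclicSchedule p q := by
  obtain ⟨lo, hi, C, f, S₃, S₄, S₅, -, -, -, -, h₃, h₄, h₅, h₆⟩ := H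
  have hS₃ : S₃.Covers := h₃.invariant (fun _ _ _ h => h.invariant fun _ _ _ h => h.covers)
    (Freqs.covers_leaves f)
  have hS₄ : S₄.Covers := h₄.invariant (fun _ _ _ h => h.covers) hS₃
  have hS₅ : S₅.Covers := h₅.invariant (fun _ _ _ h => h.invariant
    fun _ _ _ ⟨_, h, h'⟩ hS => h' ▸ (h.covers hS).pushDown _ _) hS₄
  exact h₆.isCyclicSchedule hS₅

end Schedule

/-! ### Grid frequencies, indexed by integers -/

section Grid

variable {C lo : ℕ} {k j κ : ℤ}

/-- The frequency `2 ^ k * (1 + j / C)`, written as a function of the single integer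
`κ = k * C + j`, its key. -/
noncomputable def gridVal (C : ℕ) (κ : ℤ) : ℝ :=
  2 ^ (κ / (C : ℤ)) * (1 + ((κ % (C : ℤ) : ℤ) : ℝ) / C)

theorem mul_add_ediv_of_lt (h0 : 0 ≤ j) (hj : j < C) : (k * C + j) / (C : ℤ) = k := by
  rw [add_comm, Int.add_mul_ediv_right _ _ (by lia), Int.ediv_eq_zero_of_lt h0 hj, zero_add]

theorem mul_add_emod_of_lt (h0 : 0 ≤ j) (hj : j < C) : (k * C + j) % (C : ℤ) = j := by
  rw [add_comm, Int.add_mul_emod_self_right, Int.emod_eq_of_lt h0 hj]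

theorem gridVal_mul_add (h0 : 0 ≤ j) (hj : j < C) :
    gridVal C (k * C + j) = 2 ^ k * (1 + (j : ℝ) / C) := by
  rw [gridVal, mul_add_ediv_of_lt h0 hj, mul_add_emod_of_lt h0 hj]

theorem gridFreq_eq_gridVal {k j : ℕ} (hj : j < C) :
    gridFreq C k j = gridVal C (k * C + j) := by
  rw [gridVal_mul_add (by lia) (by lia), gridFreq]
  simp only [zpow_natCast, Int.cast_natCast]

theorem gridVal_mul_add_succ (h0 : 0 ≤ j) (hj : j < C) :
    gridVal C (k * C + j + 1) = 2 ^ k * (1 + ((j : ℝ) + 1) / C) := by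
  rcases lt_or_eq_of_le (show j + 1 ≤ C from hj) with h | h
  · rw [add_assoc, gridVal_mul_add (by lia) h]
    push_cast
    rfl
  · have hC : (C : ℝ) ≠ 0 := Nat.cast_ne_zero.2 (by lia)
    have h' : (j : ℝ) + 1 = C := by exact_mod_cast h
    rw [show k * (C : ℤ) + j + 1 = (k + 1) * C + 0 by rw [add_assoc, h]; ring,
      gridVal_mul_add le_rfl (by lia), zpow_add_one₀ two_ne_zero, h', div_self hC]
    push_cast
    ring

theorem gridVal_strictMono (hC : 0 < C) : StrictMono (gridVal C) := by
  refine strictMono_int_of_lt_succ fun κ => ?_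
  have h0 := Int.emod_nonneg κ (show (C : ℤ) ≠ 0 by lia)
  have h1 := Int.emod_lt_of_pos κ (show (0 : ℤ) < C by lia)
  have hκ := Int.ediv_mul_add_emod κ C
  calc gridVal C κ = 2 ^ (κ / (C : ℤ)) * (1 + ((κ % (C : ℤ) : ℤ) : ℝ) / C) := rfl
    _ < 2 ^ (κ / (C : ℤ)) * (1 + (((κ % (C : ℤ) : ℤ) : ℝ) + 1) / C) := by gcongr; linarith
    _ = gridVal C (κ + 1) := by rw [← gridVal_mul_add_succ h0 h1, hκ]

theorem gridVal_sub (hC : 0 < C) (κ : ℤ) : gridVal C (κ - C) = gridVal C κ / 2 := by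
  have hC' : (C : ℤ) ≠ 0 := by lia
  rw [gridVal, gridVal, Int.sub_emod_right, Int.sub_ediv_of_dvd _ (dvd_refl _),
    Int.ediv_self hC', zpow_sub_one₀ two_ne_zero]
  ring

/-- Since `C` is a power of two, `2 ^ k * (1 + j / C)` divided by `C + j` is the power of two
`2 ^ k / C`. -/
theorem gridVal_div_add {c : ℕ} (h0 : 0 ≤ j) (hj : j < (2 ^ c : ℕ)) :
    gridVal (2 ^ c) (k * (2 ^ c : ℕ) + j) / ((2 ^ c : ℕ) + j : ℤ) =
      gridVal (2 ^ c) ((k - c) * (2 ^ c : ℕ)) := by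
  have hpow := gridVal_mul_add (C := 2 ^ c) (k := k - c) (j := 0) le_rfl (by positivity)
  rw [add_zero] at hpow
  rw [gridVal_mul_add h0 hj, hpow, zpow_sub₀ two_ne_zero]
  have hj0 : (0 : ℝ) ≤ j := by exact_mod_cast h0
  push_cast
  field_simp
  simp only [add_zero, zpow_natCast]

/-- A key whose frequencies the Steps 3, 4 and 5 combine. -/
def Active (C lo : ℕ) (κ : ℤ) : Prop := lo ≤ κ / (C : ℤ) ∧ κ % (C : ℤ) ≠ 0

/-- The number of frequencies that are combined at a key. -/
noncomputable def combineArity (C lo : ℕ) (κ : ℤ) : ℕ :=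
  if κ / (C : ℤ) = lo then C + (κ % (C : ℤ)).toNat else 2

/-- The key of a combined frequency, for `C = 2 ^ c`. -/
noncomputable def combinedKey (c lo : ℕ) (κ : ℤ) : ℤ :=
  if κ / ((2 ^ c : ℕ) : ℤ) = lo then (lo - c) * (2 ^ c : ℕ) else κ - (2 ^ c : ℕ)

theorem gridVal_combinedKey {c : ℕ} :
    gridVal (2 ^ c) (combinedKey c lo κ) = gridVal (2 ^ c) κ / combineArity (2 ^ c) lo κ := by
  have hC : ((2 ^ c : ℕ) : ℤ) ≠ 0 := by positivity
  unfold combinedKey combineArity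
  split_ifs with h
  · have h0 := Int.emod_nonneg κ hC
    have h1 := Int.emod_lt_of_pos κ (show (0 : ℤ) < (2 ^ c : ℕ) by positivity)
    rw [← gridVal_div_add (k := lo) h0 h1, ← h, Int.ediv_mul_add_emod, ← Int.cast_natCast (_ + _),
      Nat.cast_add, Int.toNat_of_nonneg h0]
  · rw [gridVal_sub (by positivity), Nat.cast_ofNat]

theorem combinedKey_lt {c : ℕ} (h : Active (2 ^ c) lo κ) : combinedKey c lo κ < κ := by
  have hC : (0 : ℤ) < (2 ^ c : ℕ) := by positivity
  have h0 := Int.emod_nonneg κ hC.ne'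
  have hκ := Int.ediv_mul_add_emod κ (2 ^ c : ℕ)
  unfold combinedKey
  split_ifs with hk
  · have hne := h.2
    have hc : (0 : ℤ) ≤ c * (2 ^ c : ℕ) := by positivity
    rw [hk] at hκ
    rw [sub_mul]
    lia
  · lia

theorem cast_combineArity_of_ediv_eq (hC : 0 < C) (h : κ / (C : ℤ) = lo) :
    (combineArity C lo κ : ℤ) = κ - (lo - 1) * C := by
  have h0 := Int.emod_nonneg κ (show (C : ℤ) ≠ 0 by lia)
  have hκ := Int.ediv_mul_add_emod κ C
  rw [h] at hκ
  rw [combineArity, if_pos h, Nat.cast_add, Int.toNat_of_nonneg h0]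
  linear_combination hκ

theorem two_le_combineArity (hC : 0 < C) (h : Active C lo κ) : 2 ≤ combineArity C lo κ := by
  have h0 := Int.emod_nonneg κ (show (C : ℤ) ≠ 0 by lia)
  have hne := h.2
  unfold combineArity
  split_ifs <;> lia

theorem combineArity_le (hC : 0 < C) (h : Active C lo κ) :
    (combineArity C lo κ : ℤ) ≤ κ - (lo - 1) * C := by
  by_cases hlo : κ / (C : ℤ) = lo
  · exact (cast_combineArity_of_ediv_eq hC hlo).le
  · have hlt : ((lo : ℤ) + 1) * C ≤ κ :=
      Int.mul_le_of_le_ediv (by lia) (Int.add_one_le_of_lt (h.1.lt_of_ne' hlo))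
    rw [combineArity, if_neg hlo]
    lia

end Grid

/-! ### The Steps 3, 4 and 5 as descents along the keys -/

section StepsDown

variable {β : Type} {R : ℤ → β → β → Prop} {b κ : ℤ} {S₀ S : β}

/-- `StepsDown R b S₀ κ S`: performing the steps `R b, R (b - 1), …, R (κ + 1)` leads from `S₀` to
`S`. -/
inductive StepsDown (R : ℤ → β → β → Prop) (b : ℤ) (S₀ : β) : ℤ → β → Prop
  | start : StepsDown R b S₀ b S₀
  | step {κ : ℤ} {S S' : β} (h : StepsDown R b S₀ κ S) (hR : R κ S S') :
      StepsDown R b S₀ (κ - 1) S'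

theorem StepsDown.le (h : StepsDown R b S₀ κ S) : κ ≤ b := by
  induction h with
  | start => exact le_rfl
  | step _ _ ih => lia

theorem StepsDown.eq_of_le (h : StepsDown R b S₀ κ S) (hκ : b ≤ κ) : S₀ = S := by
  cases h with
  | start => rfl
  | step h _ => exact absurd h.le (by lia)

theorem StepsDown.exists_head (h : StepsDown R b S₀ κ S) (hκ : κ < b) :
    ∃ S₁, R b S₀ S₁ ∧ StepsDown R (b - 1) S₁ κ S := by
  induction h with
  | start => exact absurd hκ (lt_irrefl b)
  | @step κ S S' h hR ih =>
    rcases h.le.eq_or_lt with rfl | hlt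
    · exact ⟨S', h.eq_of_le le_rfl ▸ hR, .start⟩
    · obtain ⟨S₁, hb, hrest⟩ := ih hlt
      exact ⟨S₁, hb, hrest.step hR⟩

theorem downTo_succ {b a : ℕ} (h : a ≤ b + 1) : downTo (b + 1) a = (b + 1) :: downTo b a := by
  rw [downTo, List.Ico.succ_top h, List.reverse_append, List.reverse_singleton, downTo,
    List.singleton_append]

theorem downTo_eq_append {b a : ℕ} (h : a ≤ b) : downTo b a = downTo b (a + 1) ++ [a] := by
  rw [downTo, List.Ico.eq_cons (Nat.lt_succ_of_le h), List.reverse_cons, downTo]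

theorem mem_downTo {b a k : ℕ} : k ∈ downTo b a ↔ a ≤ k ∧ k ≤ b := by
  rw [downTo, List.mem_reverse, List.Ico.mem, Nat.lt_succ_iff]

theorem StepsDown.exists_forEach {G : ℕ → β → β → Prop} {base : ℤ} {m : ℕ}
    (hG : ∀ j S S', 0 < j → j ≤ m → R (base + j) S S' → G j S S') (hκ : κ ≤ base)
    (h : StepsDown R (base + m) S₀ κ S) :
    ∃ S₁, ForEach G (downTo m 1) S₀ S₁ ∧ StepsDown R base S₁ κ S := by
  induction m generalizing S₀ with
  | zero => exact ⟨S₀, rfl, by simpa using h⟩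
  | succ m ih =>
    obtain ⟨S₁, hstep, hrest⟩ := h.exists_head (by lia)
    obtain ⟨S₂, heach, hbase⟩ := ih (fun j S S' h0 hj => hG j S S' h0 (by lia))
      (by simpa [← add_assoc] using hrest)
    rw [downTo_succ (by lia)]
    exact ⟨S₂, ⟨S₁, hG _ _ _ (by lia) le_rfl hstep, heach⟩, hbase⟩

theorem StepsDown.forEach_forEach {C lo hi : ℕ} (hC : 0 < C) {G : ℕ → ℕ → β → β → Prop}
    (hG : ∀ k j S S', lo ≤ k → 0 < j → j < C → R ((k : ℤ) * C + j) S S' → G k j S S')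
    (h0 : ∀ (k : ℕ) S S', R ((k : ℤ) * C) S S' → S = S')
    (h : StepsDown R ((hi + 1 : ℕ) * C - 1) S₀ (lo * C - 1) S) :
    ForEach (fun k => ForEach (G k) (downTo (C - 1) 1)) (downTo hi lo) S₀ S := by
  change ForEach _ (List.Ico lo (hi + 1)).reverse S₀ S
  have hC' : (0 : ℤ) < C := by lia
  generalize hi + 1 = m at h ⊢
  induction m generalizing S₀ with
  | zero =>
    have hlo : lo ≤ 0 := by
      exact_mod_cast le_of_mul_le_mul_right (sub_le_sub_iff_right 1 |>.1 h.le) hC'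
    rw [List.Ico.eq_nil_of_le lo.zero_le]
    exact h.eq_of_le (by simp [Nat.le_zero.1 hlo])
  | succ k ih =>
    have hlo : lo ≤ k + 1 := by
      exact_mod_cast le_of_mul_le_mul_right (sub_le_sub_iff_right 1 |>.1 h.le) hC'
    rcases hlo.eq_or_lt with rfl | hlt
    · rw [List.Ico.eq_nil_of_le le_rfl]
      exact h.eq_of_le le_rfl
    · have hk : lo ≤ k := Nat.lt_succ_iff.1 hlt
      have hbase : (lo : ℤ) * C ≤ k * C := by gcongr
      rw [show ((k + 1 : ℕ) : ℤ) * C - 1 = k * C + (C - 1 : ℕ) by push_cast [hC]; ring] at h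
      obtain ⟨S₁, hgroups, hrest⟩ := h.exists_forEach
        (fun j S S' hj0 hj => hG k j S S' hk hj0 (by lia)) (by lia)
      obtain ⟨S₂, hS₂, hlower⟩ := hrest.exists_head (by lia)
      obtain rfl := h0 k _ _ hS₂
      rw [List.Ico.succ_top hk, List.reverse_append, List.reverse_singleton]
      exact ⟨S₁, hgroups, ih hlower⟩

end StepsDown

section ForEach

variable {α β : Type} {R R' : α → β → β → Prop} {l l' : List α} {S S' : β}

theorem ForEach.exists_of_append (h : ForEach R (l ++ l') S S') :
    ∃ S₁, ForEach R l S S₁ ∧ ForEach R l' S₁ S' := by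
  induction l generalizing S with
  | nil => exact ⟨S, rfl, h⟩
  | cons b l ih =>
    obtain ⟨S₁, hb, hrest⟩ := h
    obtain ⟨S₂, hl, hl'⟩ := ih hrest
    exact ⟨S₂, ⟨S₁, hb, hl⟩, hl'⟩

theorem ForEach.imp (h : ForEach R l S S') (hR : ∀ a ∈ l, ∀ S S', R a S S' → R' a S S') :
    ForEach R' l S S' := by
  induction l generalizing S with
  | nil => exact h
  | cons b l ih =>
    obtain ⟨S₁, hb, hrest⟩ := h
    exact ⟨S₁, hR b List.mem_cons_self _ _ hb,
      ih hrest fun a ha => hR a (List.mem_cons_of_mem b ha)⟩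

end ForEach

section Descent

variable {n : ℕ} {push : Bool} {C lo : ℕ} {b κ : ℤ} {S₀ S S' : Freqs n}

/-- The step at key `κ`; the frequencies left over are pushed down if `push` is true. -/
def KeyStep (push : Bool) (C lo : ℕ) (κ : ℤ) (S S' : Freqs n) : Prop :=
  open Classical in
  if Active C lo κ then
    ∃ S₁, CombineAll (combineArity C lo κ) (gridVal C κ) S S₁ ∧
      S' = if push then pushDown (gridVal C κ) (gridVal C (κ - 1)) S₁ else S₁
  else S = S'

theorem KeyStep.exists_combineAll {k j : ℕ} (hk : lo ≤ k) (hj0 : 0 < j) (hj : j < C)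
    (h : KeyStep push C lo (k * C + j) S S') :
    ∃ S₁, CombineAll (if k = lo then C + j else 2) (gridFreq C k j) S S₁ ∧
      S' = if push then pushDown (gridFreq C k j) (gridFreq C k (j - 1)) S₁ else S₁ := by
  have hdiv : ((k : ℤ) * C + j) / (C : ℤ) = k := mul_add_ediv_of_lt (by lia) (by lia)
  have hmod : ((k : ℤ) * C + j) % (C : ℤ) = j := mul_add_emod_of_lt (by lia) (by lia)
  have hact : Active C lo ((k : ℤ) * C + j) := by
    rw [Active, hdiv, hmod]
    lia
  rw [KeyStep, if_pos hact] at h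
  rw [gridFreq_eq_gridVal hj, gridFreq_eq_gridVal (by lia), Nat.cast_sub hj0, Nat.cast_one,
    ← add_sub_assoc]
  simpa only [combineArity, hdiv, hmod, Nat.cast_inj, Int.toNat_natCast] using h

theorem StepsDown.forEach_of_keyStep {hi : ℕ} (hC : 0 < C)
    {G : ℕ → ℕ → Freqs n → Freqs n → Prop}
    (hG : ∀ k j S S', lo ≤ k → 0 < j → j < C → ∀ S₁,
      CombineAll (if k = lo then C + j else 2) (gridFreq C k j) S S₁ →
      S' = (if push then pushDown (gridFreq C k j) (gridFreq C k (j - 1)) S₁ else S₁) → G k j S S')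
    (h : StepsDown (KeyStep push C lo) ((hi + 1 : ℕ) * C - 1) S₀ (lo * C - 1) S) :
    ForEach (fun k => ForEach (G k) (downTo (C - 1) 1)) (downTo hi lo) S₀ S := by
  refine h.forEach_forEach hC (fun k j S S' hk hj0 hj hR => ?_) fun k S S' hR => ?_
  · obtain ⟨S₁, hcombine, hS'⟩ := hR.exists_combineAll hk hj0 hj
    exact hG k j S S' hk hj0 hj S₁ hcombine hS'
  · rwa [KeyStep, if_neg fun h => h.2 (Int.mul_emod_left _ _)] at hR

theorem StepsDown.of_not_active {κ' : ℤ} (h : StepsDown (KeyStep push C lo) b S₀ κ S)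
    (hκ : κ ≤ κ') (hb : κ' ≤ b) (hna : ∀ x ≤ κ', ¬ Active C lo x) :
    StepsDown (KeyStep push C lo) b S₀ κ' S := by
  induction h with
  | start =>
    rw [hb.antisymm hκ]
    exact .start
  | @step κ S S' h hR ih =>
    rcases hκ.eq_or_lt with rfl | hlt
    · exact h.step hR
    · have hle : κ ≤ κ' := by lia
      rw [KeyStep, if_neg (hna κ hle)] at hR
      exact hR ▸ ih hle

/-- The frequencies with the keys and the tree names of `M`, where `tr` gives the tree of each
name. -/
noncomputable def keyedFreqs (C : ℕ) (tr : ℕ → FTree n) (M : Multiset (ℤ × ℕ)) : Freqs n :=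
  M.map fun x => (gridVal C x.1, tr x.2)

theorem countP_keyedFreqs (hC : 0 < C) (tr : ℕ → FTree n) (M : Multiset (ℤ × ℕ)) (κ : ℤ) :
    (keyedFreqs C tr M).countP (fun x => x.1 = gridVal C κ) = M.countP fun x => x.1 = κ := by
  rw [keyedFreqs, Multiset.countP_map, Multiset.countP_eq_card_filter]
  simp only [(gridVal_strictMono hC).injective.eq_iff]

theorem pushDown_keyedFreqs (hC : 0 < C) (tr : ℕ → FTree n) (M : Multiset (ℤ × ℕ)) (κ κ' : ℤ) :
    pushDown (gridVal C κ) (gridVal C κ') (keyedFreqs C tr M) =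
      keyedFreqs C tr (M.map fun x => if x.1 = κ then (κ', x.2) else x) := by
  rw [keyedFreqs, pushDown, keyedFreqs, Multiset.map_map, Multiset.map_map]
  refine Multiset.map_congr rfl fun x _ => ?_
  simp only [Function.comp, (gridVal_strictMono hC).injective.eq_iff]
  split_ifs <;> rfl

/-- All steps above `κ`, and possibly some combinations at `κ`, have led from `S₀` to `S`. -/
def Reach (push : Bool) (C lo : ℕ) (b : ℤ) (S₀ : Freqs n) (κ : ℤ) (S : Freqs n) : Prop :=
  ∃ S₁, StepsDown (KeyStep push C lo) b S₀ κ S₁ ∧ Relation.ReflTransGen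
    (fun S S' => Active C lo κ ∧ Combine (combineArity C lo κ) (gridVal C κ) S S') S₁ S

theorem Reach.stepsDown (h : Reach push C lo b S₀ κ S) (hna : ¬ Active C lo κ) :
    StepsDown (KeyStep push C lo) b S₀ κ S := by
  obtain ⟨S₁, hD, hR⟩ := h
  cases hR using Relation.ReflTransGen.head_induction_on with
  | refl => exact hD
  | head h _ => exact absurd h.1 hna

theorem Reach.sub_one (h : Reach push C lo b S₀ κ S)
    (hcount : Active C lo κ → S.countP (fun x => x.1 = gridVal C κ) < combineArity C lo κ)
    (hpush : Active C lo κ → push = true → S' = pushDown (gridVal C κ) (gridVal C (κ - 1)) S)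
    (hkeep : ¬ (Active C lo κ ∧ push = true) → S' = S) : Reach push C lo b S₀ (κ - 1) S' := by
  by_cases hact : Active C lo κ
  · obtain ⟨S₁, hD, hR⟩ := h
    refine ⟨S', hD.step ?_, .refl⟩
    rw [KeyStep, if_pos hact]
    refine ⟨S, ⟨hR.lift id fun _ _ h => h.2, hcount hact⟩, ?_⟩
    split_ifs with hp
    · exact hpush hact hp
    · exact hkeep fun h => hp h.2
  · refine ⟨S', (h.stepsDown hact).step ?_, .refl⟩
    rw [KeyStep, if_neg hact, hkeep fun h => hact h.1]

/-- The state of a descent that uses a heap: of the current frequencies, `H` is in the heap, those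
named in `T` have been taken out at the key `κ`, and the descent is done with those of `L`. -/
structure Descent (push : Bool) (C lo : ℕ) (b : ℤ) (S₀ : Freqs n) (tr : ℕ → FTree n) (κ : ℤ)
    (H : Multiset (ℤ × ℕ)) (T : Multiset ℕ) (L : Multiset (ℤ × ℕ)) : Prop where
  reach : Reach push C lo b S₀ κ (keyedFreqs C tr (H + T.map (fun i => (κ, i)) + L))
  heap_le : ∀ x ∈ H, x.1 ≤ κ
  list_le : ∀ x ∈ L, x.1 ≤ b
  list_done : ∀ x ∈ L, ¬ Active C lo x.1 ∨ (push = false ∧ κ < x.1)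
  taken_le : Active C lo κ → T.card ≤ combineArity C lo κ

namespace Descent

variable {tr tr' : ℕ → FTree n} {H L : Multiset (ℤ × ℕ)} {T : Multiset ℕ} {κ' : ℤ}

theorem le (h : Descent push C lo b S₀ tr κ H T L) : κ ≤ b := by
  obtain ⟨S₁, hD, -⟩ := h.reach
  exact hD.le

theorem start (hb : ∀ x ∈ H, x.1 ≤ b) :
    Descent push C lo b (keyedFreqs C tr H) tr b H 0 0 where
  reach := ⟨_, .start, by simpa only [Multiset.map_zero, add_zero] using .refl⟩
  heap_le := hb
  list_le := by simp
  list_done := by simp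
  taken_le := by simp

theorem pop {i : ℕ} (h : Descent push C lo b S₀ tr κ ((κ, i) ::ₘ H) T L)
    (hT : Active C lo κ → T.card < combineArity C lo κ) :
    Descent push C lo b S₀ tr κ H (i ::ₘ T) L where
  reach := by
    simpa only [Multiset.map_cons, Multiset.add_cons, Multiset.cons_add] using h.reach
  heap_le x hx := h.heap_le x (Multiset.mem_cons_of_mem hx)
  list_le := h.list_le
  list_done := h.list_done
  taken_le hact := by
    rw [Multiset.card_cons]
    exact hT hact

theorem combine {c r new : ℕ} {t : ℕ → ℕ}
    (h : Descent push (2 ^ c) lo b S₀ tr κ H ((Multiset.range r).map t) L)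
    (hact : Active (2 ^ c) lo κ) (hr : r = combineArity (2 ^ c) lo κ)
    (htr : ∀ x ∈ H + L, tr' x.2 = tr x.2) (hnew : tr' new = .node r fun l => tr (t l)) :
    Descent push (2 ^ c) lo b S₀ tr' κ ((combinedKey c lo κ, new) ::ₘ H) 0 L where
  reach := by
    obtain ⟨S₁, hD, hR⟩ := h.reach
    refine ⟨S₁, hD, hR.tail ⟨hact, ?_⟩⟩
    have hrest : keyedFreqs (2 ^ c) tr' (H + L) = keyedFreqs (2 ^ c) tr (H + L) :=
      Multiset.map_congr rfl fun x hx => by rw [htr x hx]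
    have hbefore : keyedFreqs (2 ^ c) tr
        (H + ((Multiset.range r).map t).map (fun i => (κ, i)) + L) = keyedFreqs (2 ^ c) tr (H + L) +
          Finset.univ.val.map fun l : Fin r => (gridVal (2 ^ c) κ, tr (t l)) := by
      rw [map_univ_fin_eq_map_range r fun l => (gridVal (2 ^ c) κ, tr (t l)), add_right_comm]
      simp only [keyedFreqs, Multiset.map_add, Multiset.map_map, Function.comp_def]
    have hafter : keyedFreqs (2 ^ c) tr' ((combinedKey c lo κ, new) ::ₘ H +
        (0 : Multiset ℕ).map (fun i => (κ, i)) + L) = keyedFreqs (2 ^ c) tr (H + L) +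
          {(gridVal (2 ^ c) κ / (r : ℝ), .node r fun l => tr (t l))} := by
      rw [← hrest, hr, ← gridVal_combinedKey, ← hr, ← hnew, add_comm _ {_},
        Multiset.singleton_add]
      simp only [keyedFreqs, Multiset.map_zero, add_zero, Multiset.cons_add, Multiset.map_cons]
    rw [hbefore, hafter, ← hr]
    exact .mk _ _
  heap_le x hx := by
    rcases Multiset.mem_cons.1 hx with rfl | hx
    · exact (combinedKey_lt hact).le
    · exact h.heap_le x hx
  list_le := h.list_le
  list_done := h.list_done
  taken_le := by simp

theorem list_ne (h : Descent push C lo b S₀ tr κ H T L) (hact : Active C lo κ) :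
    ∀ x ∈ L, x.1 ≠ κ := by
  rintro x hx rfl
  rcases h.list_done x hx with hna | ⟨-, hlt⟩
  · exact hna hact
  · exact lt_irrefl _ hlt

theorem countP_eq (hC : 0 < C) (h : Descent push C lo b S₀ tr κ H T L) (hact : Active C lo κ)
    (hH : ∀ x ∈ H, x.1 < κ) :
    (keyedFreqs C tr (H + T.map (fun i => (κ, i)) + L)).countP (fun x => x.1 = gridVal C κ) =
      T.card := by
  have hT : ∀ x ∈ T.map fun i => (κ, i), x.1 = κ := fun x hx => by
    obtain ⟨i, -, rfl⟩ := Multiset.mem_map.1 hx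
    rfl
  rw [countP_keyedFreqs hC, Multiset.countP_add, Multiset.countP_add,
    Multiset.countP_eq_zero.2 fun x hx => (hH x hx).ne, Multiset.countP_eq_card.2 hT,
    Multiset.countP_eq_zero.2 (h.list_ne hact), Multiset.card_map, zero_add, add_zero]

theorem flush (hC : 0 < C) (h : Descent push C lo b S₀ tr κ H T L) (hH : ∀ x ∈ H, x.1 < κ)
    (hT : Active C lo κ → T.card < combineArity C lo κ) (hact : ¬ Active C lo κ ∨ push = false) :
    Descent push C lo b S₀ tr (κ - 1) H 0 (L + T.map fun i => (κ, i)) where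
  reach := by
    refine h.reach.sub_one (fun hact => ?_) (fun h₁ h₂ => ?_) (fun _ => ?_)
    · rw [h.countP_eq hC hact hH]
      exact hT hact
    · exact absurd hact (by simp [h₁, h₂])
    · rw [Multiset.map_zero, add_zero, add_assoc H, add_comm _ L]
  heap_le x hx := Int.le_sub_one_of_lt (hH x hx)
  list_le x hx := by
    rcases Multiset.mem_add.1 hx with hx | hx
    · exact h.list_le x hx
    · obtain ⟨i, -, rfl⟩ := Multiset.mem_map.1 hx
      exact h.le
  list_done x hx := by
    rcases Multiset.mem_add.1 hx with hx | hx
    · exact (h.list_done x hx).imp_right fun h => ⟨h.1, by lia⟩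
    · obtain ⟨i, -, rfl⟩ := Multiset.mem_map.1 hx
      exact hact.imp_right fun h => ⟨h, sub_one_lt κ⟩
  taken_le := by simp

theorem pushDown_eq (hC : 0 < C) (h : Descent push C lo b S₀ tr κ H T L) (hact : Active C lo κ)
    (hH : ∀ x ∈ H, x.1 < κ) :
    pushDown (gridVal C κ) (gridVal C κ') (keyedFreqs C tr (H + T.map (fun i => (κ, i)) + L)) =
      keyedFreqs C tr (H + T.map (fun i => (κ', i)) + L) := by
  have hid : ∀ M : Multiset (ℤ × ℕ), (∀ x ∈ M, x.1 ≠ κ) →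
      (M.map fun x => if x.1 = κ then (κ', x.2) else x) = M := fun M hM =>
    (Multiset.map_congr rfl fun x hx => if_neg (hM x hx)).trans (Multiset.map_id' M)
  rw [pushDown_keyedFreqs hC, Multiset.map_add, Multiset.map_add, Multiset.map_map,
    hid H fun x hx => (hH x hx).ne, hid L (h.list_ne hact)]
  simp only [Function.comp_def, if_true]

theorem down (hC : 0 < C) (h : Descent push C lo b S₀ tr κ H T L) (hH : ∀ x ∈ H, x.1 < κ)
    (hT : T = 0 ∨ (push = true ∧ Active C lo κ ∧ T.card < combineArity C lo κ))
    (hT' : Active C lo (κ - 1) → T.card ≤ combineArity C lo (κ - 1)) :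
    Descent push C lo b S₀ tr (κ - 1) H T L where
  reach := by
    refine h.reach.sub_one (fun hact => ?_) (fun hact _ => ?_) (fun hkeep => ?_)
    · rw [h.countP_eq hC hact hH]
      rcases hT with rfl | hT
      · exact Nat.zero_lt_of_lt (two_le_combineArity hC hact)
      · exact hT.2.2
    · exact (h.pushDown_eq hC hact hH).symm
    · rcases hT with rfl | hT
      · simp only [Multiset.map_zero]
      · exact absurd ⟨hT.2.1, hT.1⟩ hkeep
  heap_le x hx := Int.le_sub_one_of_lt (hH x hx)
  list_le := h.list_le
  list_done x hx := (h.list_done x hx).imp_right fun h => ⟨h.1, by lia⟩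
  taken_le := hT'

theorem move_of_empty (hC : 0 < C) (h : Descent push C lo b S₀ tr κ H 0 L) (hκ : κ' ≤ κ)
    (hH : ∀ x ∈ H, x.1 ≤ κ') : Descent push C lo b S₀ tr κ' H 0 L := by
  induction κ, hκ using Int.leInduction with
  | base => exact h
  | succ κ hκ ih =>
    have hdown := h.down hC (fun x hx => Int.lt_add_one_of_le ((hH x hx).trans hκ)) (.inl rfl)
      (by simp)
    exact ih (add_sub_cancel_right κ 1 ▸ hdown)

theorem move_of_push (hC : 0 < C) (h : Descent true C lo b S₀ tr κ H T L) (hκ : κ' ≤ κ)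
    (hH : ∀ x ∈ H, x.1 ≤ κ') (hact : Active C lo κ) (hT : T.card < combineArity C lo κ)
    (hlayer : κ / C * C ≤ κ') (harity : (lo - 1) * C + (T.card : ℤ) ≤ κ') :
    Descent true C lo b S₀ tr κ' H T L := by
  have hC' : (0 : ℤ) < C := by lia
  induction κ, hκ using Int.leInduction with
  | base => exact h
  | succ κ hκ ih =>
    have hmod := Int.emod_lt_of_pos (κ + 1) hC'
    have hmul := Int.ediv_mul_add_emod (κ + 1) C
    have hdiv : κ / (C : ℤ) = (κ + 1) / C := by
      have := mul_add_ediv_of_lt (C := C) (k := (κ + 1) / C) (j := κ - (κ + 1) / C * C)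
        (by lia) (by lia)
      rwa [add_sub_cancel] at this
    have hcard : combineArity C lo κ = combineArity C lo (κ + 1) ∨
        (combineArity C lo κ : ℤ) = κ - (lo - 1) * C := by
      by_cases hlo : κ / (C : ℤ) = lo
      · exact .inr (cast_combineArity_of_ediv_eq hC hlo)
      · simp only [combineArity, if_neg hlo, if_neg (hdiv ▸ hlo), true_or]
    have hdown := h.down hC (fun x hx => Int.lt_add_one_of_le ((hH x hx).trans hκ))
      (.inr ⟨rfl, hact, hT⟩) (by rw [add_sub_cancel_right]; lia)
    rw [add_sub_cancel_right] at hdown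
    rcases hκ.eq_or_lt with rfl | hlt
    · exact hdown
    · refine ih hdown ⟨hdiv ▸ hact.1, ?_⟩ (by lia) (hdiv ▸ hlayer)
      have := Int.ediv_mul_add_emod κ C
      rw [hdiv] at this
      lia

theorem stepsDown (hC : 0 < C) (hb : (lo : ℤ) * C - 1 ≤ b)
    (h : Descent push C lo b S₀ tr κ 0 0 L) :
    StepsDown (KeyStep push C lo) b S₀ (lo * C - 1) (keyedFreqs C tr L) := by
  have hna : ∀ x ≤ (lo : ℤ) * C - 1, ¬ Active C lo x := by
    rintro x hx ⟨hlo, -⟩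
    have := Int.mul_le_of_le_ediv (show (0 : ℤ) < C by lia) hlo
    lia
  have hle := min_le_right κ ((lo : ℤ) * C - 1)
  have hmove := (h.move_of_empty hC (min_le_left κ ((lo : ℤ) * C - 1)) (by simp)).reach
  rw [Multiset.map_zero, add_zero, zero_add] at hmove
  exact (hmove.stepsDown (hna _ hle)).of_not_active hle hb hna

end Descent

end Descent

variable {n : ℕ}

/-! ### Frequencies and trees in the memory -/

/-- A pair of a key and a tree name as it is stored. Keys are negated, so that the largest one is at
the top of the heap. -/
def entry (x : ℤ × ℕ) : ℝ × ℝ := (-(x.1 : ℝ), (x.2 : ℝ))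

/-- The array `batch` holds the names `T` of trees that wait to be combined. -/
structure HoldsBatch (σ : Mem) (T : Multiset ℕ) : Prop where
  size : σ.reg batchSize = T.card
  names : ∃ t : ℕ → ℕ, T = (Multiset.range T.card).map t ∧ ∀ l < T.card, σ.arr batch l = t l

/-- The arrays `listKey` and `listName` hold the pairs `L` of the frequencies that a phase is done
with. -/
structure HoldsList (σ : Mem) (L : Multiset (ℤ × ℕ)) : Prop where
  size : σ.reg listSize = L.card
  entries : (Multiset.range L.card).map (fun i => (σ.arr listKey i, σ.arr listName i)) =
    L.map entry

/-- The arrays hold a parent of the tree named `i`: its name, the number of `i` among the children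
of the parent, and the number of these children. -/
def HasParent (σ : Mem) (tr : ℕ → FTree n) (cnt i : ℕ) : Prop :=
  ∃ (p m : ℕ) (child : Fin m → FTree n) (l : Fin m), i < p ∧ p < cnt ∧ σ.arr parent i = p ∧
    σ.arr childIndex i = (l : ℕ) ∧ σ.arr childCount p = m ∧ tr p = .node m child ∧ child l = tr i

/-- The memory holds the trees `tr i` with `i < cnt`, of which those named in `A` are the roots. The
bound on their number holds because every node is made of at least two roots. -/
structure HoldsForest (σ : Mem) (tr : ℕ → FTree n) (cnt : ℕ) (A : Multiset ℕ) : Prop where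
  size : σ.reg nodeCount = cnt
  leaf : ∀ i : Fin n, tr i = .leaf i
  le : n ≤ cnt
  root_lt : ∀ i ∈ A, i < cnt
  nodup : A.Nodup
  root_or_hasParent : ∀ i < cnt, i ∈ A ∨ HasParent σ tr cnt i
  card_le : cnt + A.card ≤ 2 * n

section Congr

variable {σ σ' : Mem}

theorem HoldsBatch.congr {T : Multiset ℕ} (h : HoldsBatch σ T)
    (hsize : σ'.reg batchSize = σ.reg batchSize) (hbatch : σ'.arr batch = σ.arr batch) :
    HoldsBatch σ' T :=
  ⟨hsize.trans h.size, hbatch ▸ h.names⟩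

theorem HoldsList.congr {L : Multiset (ℤ × ℕ)} (h : HoldsList σ L)
    (hsize : σ'.reg listSize = σ.reg listSize) (hkey : σ'.arr listKey = σ.arr listKey)
    (hname : σ'.arr listName = σ.arr listName) : HoldsList σ' L :=
  ⟨hsize.trans h.size, by rw [hkey, hname, h.entries]⟩

theorem HoldsForest.congr {tr : ℕ → FTree n} {cnt : ℕ} {A : Multiset ℕ}
    (h : HoldsForest σ tr cnt A) (hcnt : σ'.reg nodeCount = σ.reg nodeCount)
    (hparent : σ'.arr parent = σ.arr parent) (hindex : σ'.arr childIndex = σ.arr childIndex)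
    (hcount : σ'.arr childCount = σ.arr childCount) : HoldsForest σ' tr cnt A where
  size := hcnt.trans h.size
  leaf := h.leaf
  le := h.le
  root_lt := h.root_lt
  nodup := h.nodup
  root_or_hasParent i hi := (h.root_or_hasParent i hi).imp_right fun hp => by
    rwa [HasParent, hparent, hindex, hcount]
  card_le := h.card_le

end Congr

theorem HoldsBatch.zero {σ : Mem} (h : σ.reg batchSize = 0) : HoldsBatch σ 0 :=
  ⟨by simpa using h, fun _ => 0, rfl, by simp⟩

theorem HoldsList.zero {σ : Mem} (h : σ.reg listSize = 0) : HoldsList σ 0 :=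
  ⟨by simpa using h, rfl⟩

/-! ### Heap operations on integer keys -/

theorem heapInsert_entry {σ : Mem} {H : Multiset (ℤ × ℕ)} {κ : ℤ} {i : ℕ}
    (h : HoldsHeap σ (H.map entry)) (hkey : σ.reg key = -κ) (hname : σ.reg name = i) :
    Runs heapInsert σ fun σ' τ => τ ≤ 60 * Nat.log 2 (H.card + 1) + 40 ∧
      HoldsHeap σ' (((κ, i) ::ₘ H).map entry) := by
  simpa only [hkey, hname, Multiset.card_map, Multiset.map_cons, entry] using heapInsert_spec h

theorem heapPop_entry {σ : Mem} {H : Multiset (ℤ × ℕ)} (h : HoldsHeap σ (H.map entry))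
    (hH : H ≠ 0) :
    Runs heapPop σ fun σ' τ => τ ≤ 150 * Nat.log 2 H.card + 80 ∧ ∃ κ i H', H = (κ, i) ::ₘ H' ∧
      (∀ x ∈ H, x.1 ≤ κ) ∧ σ.arr heapKey 0 = -κ ∧ σ'.reg key = -κ ∧ σ'.reg name = i ∧
      HoldsHeap σ' (H'.map entry) := by
  refine (heapPop_spec h (by simpa using hH)).mono fun σ' τ ⟨hτ, hkey, M', hM, hH'⟩ => ?_
  obtain ⟨⟨κ, i⟩, hmem, hentry, rfl⟩ := (Multiset.map_eq_cons entry H M' _).2 hM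
  obtain ⟨hκ, hi⟩ := Prod.ext_iff.1 hentry
  refine ⟨by simpa using hτ, κ, i, _, (Multiset.cons_erase hmem).symm, fun x hx => ?_,
    hkey ▸ hκ.symm, hκ.symm, hi.symm, hH'⟩
  have hle : -(κ : ℝ) ≤ -x.1 :=
    (hκ.trans hkey).trans_le (h.top_le _ (Multiset.mem_map_of_mem entry hx))
  exact_mod_cast neg_le_neg_iff.1 hle

/-! ### Combining the trees of a batch -/

section Combine

variable {σ σ' : Mem} {r cnt : ℕ} {t : ℕ → ℕ} {tr : ℕ → FTree n} {A T : Multiset ℕ}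

/-- The memory `σ'` differs from `σ` in that the trees `t 0, …, t (r - 1)` have become the children
of the tree `cnt`. -/
structure AddsNode (σ σ' : Mem) (t : ℕ → ℕ) (r cnt : ℕ) : Prop where
  child : ∀ l < r, σ'.arr parent (t l) = cnt ∧ σ'.arr childIndex (t l) = l
  other : ∀ i, (∀ l < r, i ≠ t l) →
    σ'.arr parent i = σ.arr parent i ∧ σ'.arr childIndex i = σ.arr childIndex i

/-- Make the trees of the batch the children of a new tree. -/
def adoptBatch : Prog :=
  counter ≔ 0 ;;
  .loop (.lt (reg counter) (reg batchSize))
    (.setCell parent (cell batch (reg counter)) (reg nodeCount) ;;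
    .setCell childIndex (cell batch (reg counter)) (reg counter) ;;
    counter ≔ reg counter + 1)

theorem adoptBatch_spec (hsize : σ.reg batchSize = r) (hcnt : σ.reg nodeCount = cnt)
    (ht : ∀ l < r, σ.arr batch l = t l) (hinj : ∀ l < r, ∀ l' < r, t l = t l' → l = l') :
    Runs adoptBatch σ fun σ' τ => τ ≤ 30 * r + 15 ∧ AddsNode σ σ' t r cnt := by
  apply Runs.seq
  apply Runs.setReg
  refine Runs.loop (fun σ' B => ∃ k ≤ r, σ'.reg counter = k ∧ σ'.reg batchSize = r ∧
    σ'.reg nodeCount = cnt ∧ σ'.arr batch = σ.arr batch ∧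
    (∀ l < k, σ'.arr parent (t l) = cnt ∧ σ'.arr childIndex (t l) = l) ∧
    (∀ i, (∀ l < r, i ≠ t l) →
      σ'.arr parent i = σ.arr parent i ∧ σ'.arr childIndex i = σ.arr childIndex i) ∧
    B = 30 * (r - k)) (30 * r) ?_ ?_ ?_
  · exact ⟨0, by lia, by simp, by simpa using hsize, by simpa using hcnt, rfl, by simp,
      fun i _ => ⟨rfl, rfl⟩, rfl⟩
  · rintro σ' B ⟨k, -, hk, hsize, hcnt, hbatch, hchild, hother, rfl⟩ hb
    have hkr : k < r := by
      simpa only [RTest.holds_lt, eval, hk, hsize, Nat.cast_lt] using hb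
    repeat' first | apply Runs.seq | apply Runs.setReg | apply Runs.setCell
    refine ⟨_, ⟨k + 1, hkr, by simp [hk], by simp [hsize], by simp [hcnt], ?_, fun l hl => ?_,
      fun i hi => ?_, rfl⟩, ?_⟩
    · funext i
      simp [hbatch]
    · by_cases hlk : l = k
      · subst hlk
        simp [hk, hbatch, ht l hkr, hcnt]
      · have hne : t l ≠ t k := fun h => hlk (hinj l (by lia) k hkr h)
        simpa [hk, hbatch, ht k hkr, hne] using hchild l (by lia)
    · simpa [hk, hbatch, ht k hkr, hi k hkr] using hother i hi
    · simp
      lia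
  · rintro σ' τ B' ⟨k, hkr, hk, hsize, -, -, hchild, hother, rfl⟩ hb hτ
    obtain rfl : k = r := hkr.antisymm <| by
      simpa only [RTest.holds_lt, eval, hk, hsize, Nat.cast_lt, not_lt] using hb
    simp only [RTest.cost_lt, RExpr.cost] at hτ
    exact ⟨by simp; lia, hchild, hother⟩

theorem HasParent.of_agree {cnt' i : ℕ} {tr' : ℕ → FTree n} (h : HasParent σ tr cnt i)
    (hcnt : cnt ≤ cnt') (htr : ∀ j < cnt, tr' j = tr j)
    (hparent : σ'.arr parent i = σ.arr parent i)
    (hindex : σ'.arr childIndex i = σ.arr childIndex i)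
    (hcount : ∀ j < cnt, σ'.arr childCount j = σ.arr childCount j) : HasParent σ' tr' cnt' i := by
  obtain ⟨p, m, child, l, hip, hp, hpar, hl, hm, hnode, hchild⟩ := h
  exact ⟨p, m, child, l, hip, hp.trans_le hcnt, hparent ▸ hpar, hindex ▸ hl, hcount p hp ▸ hm,
    htr p hp ▸ hnode, htr i (hip.trans hp) ▸ hchild⟩

theorem HoldsForest.addNode (h : HoldsForest σ tr cnt ((Multiset.range r).map t + A)) (hr : 2 ≤ r)
    (hadd : AddsNode σ σ' t r cnt) (hcnt : σ'.reg nodeCount = (cnt + 1 : ℕ))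
    (hcount : ∀ i, σ'.arr childCount i = if i = cnt then (r : ℝ) else σ.arr childCount i) :
    HoldsForest σ' (Function.update tr cnt (.node r fun l => tr (t l))) (cnt + 1)
      (cnt ::ₘ A) where
  size := hcnt
  leaf i := by rw [Function.update_of_ne (i.2.trans_le h.le).ne, h.leaf]
  le := h.le.trans cnt.le_succ
  root_lt i hi := by
    rcases Multiset.mem_cons.1 hi with rfl | hi
    · exact Nat.lt_succ_self _
    · exact (h.root_lt i (Multiset.mem_add.2 (.inr hi))).trans cnt.lt_succ_self
  nodup := Multiset.nodup_cons.2
    ⟨fun hmem => (h.root_lt cnt (Multiset.mem_add.2 (.inr hmem))).false,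
      (Multiset.nodup_add.1 h.nodup).2.1⟩
  root_or_hasParent i hi := by
    rcases (Nat.lt_succ_iff.1 hi).eq_or_lt with rfl | hi
    · exact .inl (Multiset.mem_cons_self _ _)
    by_cases hit : ∃ l < r, i = t l
    · obtain ⟨l, hl, rfl⟩ := hit
      refine .inr ⟨cnt, r, fun l => tr (t l), ⟨l, hl⟩, hi, cnt.lt_succ_self, (hadd.child l hl).1,
        (hadd.child l hl).2, by rw [hcount, if_pos rfl], Function.update_self .., ?_⟩
      rw [Function.update_of_ne hi.ne]
    · have hne : ∀ l < r, i ≠ t l := fun l hl h => hit ⟨l, hl, h⟩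
      rcases h.root_or_hasParent i hi with hroot | hp
      · rcases Multiset.mem_add.1 hroot with hroot | hroot
        · obtain ⟨l, hl, rfl⟩ := Multiset.mem_map.1 hroot
          exact absurd rfl (hne l (Multiset.mem_range.1 hl))
        · exact .inl (Multiset.mem_cons_of_mem hroot)
      · exact .inr <| hp.of_agree cnt.le_succ (fun j hj => Function.update_of_ne hj.ne _ _)
          (hadd.other i hne).1 (hadd.other i hne).2 fun j hj => by rw [hcount, if_neg hj.ne]
  card_le := by
    have := h.card_le
    rw [Multiset.card_add, Multiset.card_map, Multiset.card_range] at this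
    rw [Multiset.card_cons]
    lia

/-- Combine the trees of the batch, and insert the new tree into the heap with the key in the
register `key`. -/
def combineBatch : Prog :=
  adoptBatch ;;
  .setCell childCount (reg nodeCount) (reg batchSize) ;;
  name ≔ reg nodeCount ;;
  nodeCount ≔ reg nodeCount + 1 ;;
  batchSize ≔ 0 ;;
  heapInsert

theorem combineBatch_spec {H : Multiset (ℤ × ℕ)} {κ : ℤ} (hH : HoldsHeap σ (H.map entry))
    (hT : HoldsBatch σ T) (hF : HoldsForest σ tr cnt (T + A)) (hkey : σ.reg key = -κ)
    (hcard : 2 ≤ T.card) :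
    Runs combineBatch σ fun σ' τ => τ ≤ 30 * T.card + 60 * Nat.log 2 (H.card + 1) + 80 ∧
      ∃ (tr' : ℕ → FTree n) (t : ℕ → ℕ), HoldsHeap σ' (((κ, cnt) ::ₘ H).map entry) ∧
        HoldsBatch σ' 0 ∧ HoldsForest σ' tr' (cnt + 1) (cnt ::ₘ A) ∧ (∀ i < cnt, tr' i = tr i) ∧
        T = (Multiset.range T.card).map t ∧ (∀ l < T.card, σ.arr batch l = t l) ∧
        tr' cnt = .node T.card fun l => tr (t l) := by
  obtain ⟨hsize, t, hTt, ht⟩ := hT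
  have hinj : ∀ l < T.card, ∀ l' < T.card, t l = t l' → l = l' := fun l hl l' hl' =>
    Multiset.inj_on_of_nodup_map (hTt ▸ (Multiset.nodup_add.1 hF.nodup).1) l
      (Multiset.mem_range.2 hl) l' (Multiset.mem_range.2 hl')
  refine Runs.seq_of_spec (adoptBatch_spec hsize hF.size ht hinj) fun σ₁ τ₁ hfr ⟨hτ₁, hadd⟩ => ?_
  have hcnt := (hfr.reg nodeCount rfl).trans hF.size
  have hsize₁ := (hfr.reg batchSize rfl).trans hsize
  have hH₁ := hH.congr (hfr.reg heapSize rfl) (hfr.arr heapName rfl) (hfr.arr heapKey rfl)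
  repeat' with_reducible first | apply Runs.seq | apply Runs.setReg | apply Runs.setCell
  refine (heapInsert_entry (κ := κ) (i := cnt)
    (hH₁.congr (by simp) (by funext; simp) (by funext; simp))
    (by simpa using (hfr.reg key rfl).trans hkey) (by simpa using hcnt)).frame.mono
    fun σ₂ τ₂ ⟨hfr₂, hτ₂, hH₂⟩ => ?_
  have hparent : σ₂.arr parent = σ₁.arr parent := (hfr₂.arr parent rfl).trans (by funext; simp)
  have hindex : σ₂.arr childIndex = σ₁.arr childIndex :=
    (hfr₂.arr childIndex rfl).trans (by funext; simp)
  refine ⟨by simp; lia, _, t, hH₂, .zero (by simpa using hfr₂.reg batchSize rfl),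
    HoldsForest.addNode (hTt ▸ hF) hcard ?_ (by simpa [hcnt] using hfr₂.reg nodeCount rfl)
      fun i => ?_, fun i hi => Function.update_of_ne hi.ne _ _, hTt, ht, Function.update_self ..⟩
  · exact ⟨hparent ▸ hindex ▸ hadd.child, hparent ▸ hindex ▸ hadd.other⟩
  · rw [hfr₂.arr childCount rfl]
    simp [hcnt, hsize₁, hfr.arr childCount rfl]

end Combine

/-! ### Moving the batch to the list, and the list to the heap -/

section Transfer

variable {σ : Mem} {T : Multiset ℕ} {L : Multiset (ℤ × ℕ)} {κ : ℤ}

theorem HoldsBatch.exists_cons {r : ℕ} (h : HoldsBatch σ T) (hr : T.card = r + 1) :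
    ∃ i T', T = i ::ₘ T' ∧ T'.card = r ∧ σ.arr batch r = i ∧
      ∀ σ' : Mem, σ'.reg batchSize = r → σ'.arr batch = σ.arr batch → HoldsBatch σ' T' := by
  obtain ⟨-, t, hTt, ht⟩ := h
  rw [hr] at hTt ht
  have hcard : ((Multiset.range r).map t).card = r := by simp
  refine ⟨t r, (Multiset.range r).map t, ?_, hcard, ht r r.lt_succ_self, fun σ' hsize hbatch => ?_⟩
  · rw [hTt, Multiset.range_succ, Multiset.map_cons]
  · refine ⟨hcard.symm ▸ hsize, t, by rw [hcard], fun l hl => ?_⟩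
    rw [hbatch, ht l (by lia)]

theorem HoldsList.cons {σ' : Mem} {i : ℕ} (h : HoldsList σ L)
    (hsize : σ'.reg listSize = σ.reg listSize + 1)
    (hkey : σ'.arr listKey = Function.update (σ.arr listKey) L.card (-κ))
    (hname : σ'.arr listName = Function.update (σ.arr listName) L.card i) :
    HoldsList σ' ((κ, i) ::ₘ L) where
  size := by simp [hsize, h.size]
  entries := by
    rw [Multiset.card_cons, Multiset.range_succ, Multiset.map_cons, Multiset.map_cons, hkey, hname,
      ← h.entries, Function.update_self, Function.update_self, entry]
    congr 1
    refine Multiset.map_congr rfl fun j hj => ?_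
    rw [Function.update_of_ne (Multiset.mem_range.1 hj).ne,
      Function.update_of_ne (Multiset.mem_range.1 hj).ne]

/-- Move the trees of the batch to the list, with the key in the register `currentKey`. -/
def flushBatch : Prog :=
  .loop (.le 1 (reg batchSize))
    (batchSize ≔ reg batchSize - 1 ;;
    .setCell listKey (reg listSize) (0 - reg currentKey) ;;
    .setCell listName (reg listSize) (cell batch (reg batchSize)) ;;
    listSize ≔ reg listSize + 1)

theorem flushBatch_spec (hT : HoldsBatch σ T) (hL : HoldsList σ L) (hκ : σ.reg currentKey = κ) :
    Runs flushBatch σ fun σ' τ => τ ≤ 40 * T.card + 10 ∧ HoldsBatch σ' 0 ∧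
      HoldsList σ' (L + T.map fun i => (κ, i)) := by
  refine Runs.loop (fun σ' B => ∃ T' L', L' + T'.map (fun i => (κ, i)) =
    L + T.map (fun i => (κ, i)) ∧ HoldsBatch σ' T' ∧ HoldsList σ' L' ∧ σ'.reg currentKey = κ ∧
    B = 40 * T'.card) (40 * T.card) ⟨T, L, rfl, hT, hL, hκ, rfl⟩ ?_ ?_
  · rintro σ₁ B ⟨T', L', hM, hT', hL', hκ, rfl⟩ hb
    have hcard : 1 ≤ T'.card := by simpa [hT'.size] using hb
    obtain ⟨r, hr⟩ := Nat.exists_eq_add_of_le' hcard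
    obtain ⟨i, T', rfl, hT'r, hi, hT''⟩ := hT'.exists_cons hr
    have hbatch : σ₁.reg batchSize - 1 = r := by simp [hT'.size, hr]
    repeat' first | apply Runs.seq | apply Runs.setReg | apply Runs.setCell
    refine ⟨_, ⟨T', (κ, i) ::ₘ L', ?_, hT'' _ (by simpa using hbatch) (by funext; simp), hL'.cons
      (by simp) ?_ ?_, by simpa using hκ, rfl⟩, ?_⟩
    · rw [← hM, Multiset.map_cons, Multiset.cons_add, Multiset.add_cons]
    · funext j
      simp [Function.update_apply, hL'.size, hκ]
    · funext j
      simp [Function.update_apply, hL'.size, hT'.size, hr, hi]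
    · simp
      lia
  · rintro σ' τ B' ⟨T', L', hM, hT', hL', -, rfl⟩ hb hτ
    obtain rfl : T' = 0 := by simpa [hT'.size] using hb
    rw [Multiset.map_zero, add_zero] at hM
    have : τ ≤ 40 * T.card + 4 := by simpa using hτ
    exact ⟨by lia, hT', hM ▸ hL'⟩

/-- Move the list to the heap. -/
def loadList : Prog :=
  counter ≔ 0 ;;
  .loop (.lt (reg counter) (reg listSize))
    (key ≔ cell listKey (reg counter) ;;
    name ≔ cell listName (reg counter) ;;
    counter ≔ reg counter + 1 ;;
    heapInsert) ;;
  listSize ≔ 0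

theorem loadList_spec (hH : HoldsHeap σ 0) (hL : HoldsList σ L) :
    Runs loadList σ fun σ' τ => τ ≤ L.card * (60 * Nat.log 2 L.card + 80) + 20 ∧
      HoldsHeap σ' (L.map entry) ∧ HoldsList σ' 0 := by
  apply Runs.seq
  apply Runs.setReg
  apply Runs.seq
  refine Runs.loop (fun σ' B => ∃ s ≤ L.card, σ'.reg counter = s ∧ σ'.reg listSize = L.card ∧
    σ'.arr listKey = σ.arr listKey ∧ σ'.arr listName = σ.arr listName ∧
    HoldsHeap σ' ((Multiset.range s).map fun i => (σ.arr listKey i, σ.arr listName i)) ∧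
    B = (L.card - s) * (60 * Nat.log 2 L.card + 80)) (L.card * (60 * Nat.log 2 L.card + 80))
    ⟨0, by lia, by simp, by simpa using hL.size, rfl, rfl,
      hH.congr (by simp) (by rfl) (by rfl), rfl⟩ ?_ ?_
  · rintro σ' B ⟨s, -, hs, hsize, hkey, hname, hH, rfl⟩ hb
    have hsL : s < L.card := by
      simpa only [RTest.holds_lt, eval, hs, hsize, Nat.cast_lt] using hb
    repeat' with_reducible first | apply Runs.seq | apply Runs.setReg | apply Runs.setCell
    refine (heapInsert_spec (hH.congr (by simp) (by rfl) (by rfl))).frame.mono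
      fun σ₁ τ₁ ⟨hfr, hτ, hH'⟩ => ?_
    refine ⟨_, ⟨s + 1, hsL, by simpa [hs] using hfr.reg counter rfl,
      by simpa [hsize] using hfr.reg listSize rfl, (hfr.arr listKey rfl).trans hkey,
      (hfr.arr listName rfl).trans hname, ?_, rfl⟩, ?_⟩
    · simpa [hs, hkey, hname] using hH'
    · have hlog : Nat.log 2 (s + 1) ≤ Nat.log 2 L.card := Nat.log_mono_right hsL
      rw [Multiset.card_map, Multiset.card_range] at hτ
      rw [show L.card - s = L.card - (s + 1) + 1 by lia, add_mul]
      simp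
      lia
  · rintro σ' τ B' ⟨s, hsL, hs, hsize, -, -, hH', rfl⟩ hb hτ
    obtain rfl : s = L.card := hsL.antisymm <| by
      simpa only [RTest.holds_lt, eval, hs, hsize, Nat.cast_lt, not_lt] using hb
    apply Runs.setReg
    rw [hL.entries] at hH'
    simp only [RTest.cost_lt, RExpr.cost] at hτ
    exact ⟨by simp; lia, hH'.congr (by simp) (by rfl) (by rfl), .zero (by simp)⟩

end Transfer

/-! ### The descent along the keys -/

/-- The registers hold the parameters of the frequencies, for `C = 2 ^ c` and the lowest layer
`lo`. -/
structure HoldsGrid (σ : Mem) (c lo : ℕ) : Prop where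
  minLayer_eq : σ.reg minLayer = lo
  groups_eq : σ.reg groups = (2 ^ c : ℕ)
  halfMinLayer_eq : σ.reg halfMinLayer = c

theorem HoldsGrid.congr {σ σ' : Mem} {c lo : ℕ} (h : HoldsGrid σ c lo)
    (hmin : σ'.reg minLayer = σ.reg minLayer) (hgroups : σ'.reg groups = σ.reg groups)
    (hhalf : σ'.reg halfMinLayer = σ.reg halfMinLayer) : HoldsGrid σ' c lo :=
  ⟨hmin.trans h.minLayer_eq, hgroups.trans h.groups_eq, hhalf.trans h.halfMinLayer_eq⟩

section Key

variable {σ : Mem} {H : Multiset (ℤ × ℕ)} {c C lo r : ℕ} {κ k : ℤ}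

theorem HoldsHeap.exists_top (h : HoldsHeap σ (H.map entry)) (hH : H ≠ 0) :
    ∃ κ : ℤ, σ.arr heapKey 0 = -κ ∧ (∃ x ∈ H, x.1 = κ) ∧ ∀ x ∈ H, x.1 ≤ κ := by
  obtain ⟨x, hx, hentry⟩ := Multiset.mem_map.1 (h.top_mem (by simpa using hH))
  have htop : -(x.1 : ℝ) = σ.arr heapKey 0 := congrArg Prod.fst hentry
  refine ⟨x.1, htop.symm, ⟨x, hx, rfl⟩, fun y hy => ?_⟩
  have hle : -(x.1 : ℝ) ≤ -y.1 := htop.trans_le (h.top_le _ (Multiset.mem_map_of_mem entry hy))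
  exact_mod_cast neg_le_neg_iff.1 hle

/-- Whether the key of the top of the heap is the current one. -/
def topAtCurrentKey : RTest :=
  .and (.le 1 (reg heapSize)) (.eq (cell heapKey 0) (0 - reg currentKey))

theorem topAtCurrentKey_holds (hH : HoldsHeap σ (H.map entry)) (hkey : σ.reg currentKey = κ)
    (hκ : ∀ x ∈ H, x.1 ≤ κ) : topAtCurrentKey.holds σ ↔ ∃ x ∈ H, x.1 = κ := by
  have hholds : topAtCurrentKey.holds σ ↔ H ≠ 0 ∧ σ.arr heapKey 0 = -κ := by
    simp [topAtCurrentKey, hH.size, hkey, Nat.one_le_iff_ne_zero]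
  rw [hholds]
  constructor
  · rintro ⟨hH0, htop⟩
    obtain ⟨κ₁, hκ₁, hx, -⟩ := hH.exists_top hH0
    rw [hκ₁, neg_inj, Int.cast_inj] at htop
    exact htop ▸ hx
  · rintro ⟨x, hx, rfl⟩
    have hH0 : H ≠ 0 := fun h => Multiset.notMem_zero x (h ▸ hx)
    obtain ⟨κ₁, hκ₁, ⟨y, hy, rfl⟩, hmax⟩ := hH.exists_top hH0
    exact ⟨hH0, by rw [hκ₁, (hmax x hx).antisymm (hκ y hy)]⟩

/-- Compute the number of frequencies that are combined at the current key. -/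
def setArity : Prog :=
  .ite (.eq (reg layer) (reg minLayer))
    (arity ≔ reg groups + (reg currentKey - reg layer * reg groups)) (arity ≔ 2)

/-- Compute whether frequencies are combined at the current key. -/
def setActive : Prog :=
  .ite (.and (.le (reg minLayer) (reg layer))
      (.not (.eq (reg layer * reg groups) (reg currentKey))))
    (active ≔ 1) (active ≔ 0)

/-- Compute the layer of the current key, and what happens there. -/
def classifyKey : Prog :=
  layer ≔ .floor (reg currentKey / reg groups) ;; setArity ;; setActive

/-- The current key is `κ`, and the registers hold what `classifyKey` computes. -/
structure HoldsKey (σ : Mem) (C lo : ℕ) (κ : ℤ) : Prop where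
  key_eq : σ.reg currentKey = κ
  layer_eq : σ.reg layer = (κ / (C : ℤ) : ℤ)
  arity_eq : σ.reg arity = combineArity C lo κ
  active_iff : σ.reg active = 1 ↔ Active C lo κ

theorem setArity_spec (hC : 0 < C) (hkey : σ.reg currentKey = κ) (hgroups : σ.reg groups = C)
    (hmin : σ.reg minLayer = lo) (hlayer : σ.reg layer = (κ / (C : ℤ) : ℤ)) :
    Runs setArity σ fun σ' τ => τ ≤ 20 ∧ σ'.reg arity = combineArity C lo κ := by
  have hlo : ((κ / (C : ℤ) : ℤ) : ℝ) = lo ↔ κ / (C : ℤ) = lo := by norm_cast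
  apply Runs.ite
  · intro hb
    replace hb : κ / (C : ℤ) = lo := by
      simpa only [RTest.holds_eq, eval, hlayer, hmin, hlo] using hb
    have harity : (combineArity C lo κ : ℝ) = κ - (lo - 1) * C := by
      exact_mod_cast cast_combineArity_of_ediv_eq hC hb
    apply Runs.setReg
    refine ⟨by simp, ?_⟩
    simp only [Mem.reg_setReg, if_true, eval_sub, eval, hgroups, hkey, hlayer,
      harity, hb]
    push_cast
    ring
  · intro hb
    replace hb : κ / (C : ℤ) ≠ lo := by
      simpa only [RTest.holds_eq, eval, hlayer, hmin, hlo] using hb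
    apply Runs.setReg
    exact ⟨by simp, by simp [combineArity, hb]⟩

theorem setActive_spec (hkey : σ.reg currentKey = κ) (hgroups : σ.reg groups = C)
    (hmin : σ.reg minLayer = lo) (hlayer : σ.reg layer = (κ / (C : ℤ) : ℤ)) :
    Runs setActive σ fun σ' τ => τ ≤ 20 ∧ (σ'.reg active = 1 ↔ Active C lo κ) := by
  have hmod : ((κ / (C : ℤ) : ℤ) : ℝ) * C = κ ↔ κ % (C : ℤ) = 0 := by
    have hκ := Int.ediv_mul_add_emod κ C
    have : κ % (C : ℤ) = 0 ↔ κ / (C : ℤ) * C = κ := by lia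
    rw [this]
    norm_cast
  have hlo : (lo : ℝ) ≤ ((κ / (C : ℤ) : ℤ) : ℝ) ↔ lo ≤ κ / (C : ℤ) := by norm_cast
  apply Runs.ite <;> intro hb <;> apply Runs.setReg <;> refine ⟨by simp, ?_⟩ <;>
    simpa [hkey, hgroups, hmin, hlayer, hmod, hlo, Active] using hb

theorem classifyKey_spec (hkey : σ.reg currentKey = κ) (hgrid : HoldsGrid σ c lo) :
    Runs classifyKey σ fun σ' τ => τ ≤ 60 ∧ HoldsKey σ' (2 ^ c) lo κ := by
  have hfloor : ⌊(κ : ℝ) / (2 ^ c : ℕ)⌋ = κ / ((2 ^ c : ℕ) : ℤ) := by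
    rw [Int.floor_div_natCast, Int.floor_intCast]
  apply Runs.seq
  apply Runs.setReg
  set σ₁ := σ.setReg layer ((RExpr.floor (reg currentKey / reg groups)).eval σ)
  have hlayer₁ : σ₁.reg layer = (κ / ((2 ^ c : ℕ) : ℤ) : ℤ) := by
    rw [← hfloor]
    simp [σ₁, hkey, hgrid.groups_eq]
  have hkey₁ : σ₁.reg currentKey = κ := by simpa [σ₁] using hkey
  have hgroups₁ : σ₁.reg groups = (2 ^ c : ℕ) := by simpa [σ₁] using hgrid.groups_eq
  have hmin₁ : σ₁.reg minLayer = lo := by simpa [σ₁] using hgrid.minLayer_eq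
  refine Runs.seq_of_spec (setArity_spec (by positivity) hkey₁ hgroups₁ hmin₁ hlayer₁)
    fun σ₂ τ₂ hfr₂ ⟨hτ₂, harity⟩ => ?_
  refine (setActive_spec ((hfr₂.reg currentKey rfl).trans hkey₁)
    ((hfr₂.reg groups rfl).trans hgroups₁) ((hfr₂.reg minLayer rfl).trans hmin₁)
    ((hfr₂.reg layer rfl).trans hlayer₁)).frame.mono fun σ₃ τ₃ ⟨hfr₃, hτ₃, hactive⟩ => ?_
  exact ⟨by simp; lia, (hfr₃.reg currentKey rfl).trans ((hfr₂.reg currentKey rfl).trans hkey₁),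
    (hfr₃.reg layer rfl).trans ((hfr₂.reg layer rfl).trans hlayer₁),
    (hfr₃.reg arity rfl).trans harity, hactive⟩

/-- Make the layer of the current key its lower bound. -/
def raiseToLayer : Prog :=
  .ite (.lt (reg currentKey) (reg layer * reg groups)) (currentKey ≔ reg layer * reg groups) .skip

theorem raiseToLayer_spec (hkey : σ.reg currentKey = κ) (hlayer : σ.reg layer = k)
    (hgroups : σ.reg groups = C) :
    Runs raiseToLayer σ fun σ' τ => τ ≤ 15 ∧ σ'.reg currentKey = ((max κ (k * C) : ℤ) : ℝ) := by
  have hlt : (κ : ℝ) < k * C ↔ κ < k * C := by norm_cast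
  have hle : (k : ℝ) * C ≤ κ ↔ k * C ≤ κ := by norm_cast
  apply Runs.ite <;> intro hb
  · replace hb : κ < k * C := by simpa [hkey, hlayer, hgroups, hlt] using hb
    apply Runs.setReg
    exact ⟨by simp, by simp [hlayer, hgroups, max_eq_right hb.le]⟩
  · replace hb : k * C ≤ κ := by simpa [hkey, hlayer, hgroups, hle] using hb
    exact Runs.skip ⟨by simp, by rw [hkey, max_eq_left hb]⟩

/-- Make the key of the top of the heap a lower bound of the current one. -/
def raiseToTop : Prog :=
  .ite (.and (.le 1 (reg heapSize)) (.lt (reg currentKey) (0 - cell heapKey 0)))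
    (currentKey ≔ 0 - cell heapKey 0) .skip

theorem raiseToTop_spec (hH : HoldsHeap σ (H.map entry)) (hkey : σ.reg currentKey = κ) :
    Runs raiseToTop σ fun σ' τ => τ ≤ 25 ∧ ∃ κ' : ℤ, σ'.reg currentKey = κ' ∧ κ ≤ κ' ∧
      (∀ x ∈ H, x.1 ≤ κ') ∧ (κ' = κ ∨ ∃ x ∈ H, x.1 = κ') := by
  apply Runs.ite
  · intro hb
    obtain ⟨hH0, hlt⟩ : H ≠ 0 ∧ (κ : ℝ) < -σ.arr heapKey 0 := by
      simpa [hH.size, hkey, Nat.one_le_iff_ne_zero] using hb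
    obtain ⟨κ₁, hκ₁, hx, hmax⟩ := hH.exists_top hH0
    rw [hκ₁, neg_neg, Int.cast_lt] at hlt
    apply Runs.setReg
    exact ⟨by simp, κ₁, by simpa using neg_eq_iff_eq_neg.2 hκ₁, hlt.le, hmax, .inr hx⟩
  · intro hb
    replace hb : H ≠ 0 → -σ.arr heapKey 0 ≤ κ := by
      simpa [hH.size, hkey, Nat.one_le_iff_ne_zero] using hb
    refine Runs.skip ⟨by simp, κ, hkey, le_rfl, fun x hx => ?_, .inl rfl⟩
    have hH0 : H ≠ 0 := fun h => Multiset.notMem_zero x (h ▸ hx)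
    obtain ⟨κ₁, hκ₁, -, hmax⟩ := hH.exists_top hH0
    have hle := hb hH0
    rw [hκ₁, neg_neg, Int.cast_le] at hle
    exact (hmax x hx).trans hle

/-- Move the current key down to the next one where the batch is stopped: by the end of its layer,
by its own size, which the number of frequencies to be combined has come down to, or by a frequency
in the heap. -/
def jumpKey : Prog :=
  currentKey ≔ (reg minLayer - 1) * reg groups + reg batchSize ;; raiseToLayer ;; raiseToTop

theorem jumpKey_spec (hH : HoldsHeap σ (H.map entry)) (hr : σ.reg batchSize = r)
    (hlayer : σ.reg layer = k) (hgrid : HoldsGrid σ c lo) :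
    Runs jumpKey σ fun σ' τ => τ ≤ 60 ∧ ∃ κ : ℤ, σ'.reg currentKey = κ ∧
      k * (2 ^ c : ℕ) ≤ κ ∧ (lo - 1) * (2 ^ c : ℕ) + (r : ℤ) ≤ κ ∧ (∀ x ∈ H, x.1 ≤ κ) ∧
      (κ = k * (2 ^ c : ℕ) ∨ κ = (lo - 1) * (2 ^ c : ℕ) + (r : ℤ) ∨ ∃ x ∈ H, x.1 = κ) := by
  apply Runs.seq
  apply Runs.setReg
  refine Runs.seq_of_spec (raiseToLayer_spec (κ := (lo - 1) * (2 ^ c : ℕ) + (r : ℤ)) (k := k)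
    (C := 2 ^ c) ?_ (by simpa using hlayer) (by simpa using hgrid.groups_eq))
    fun σ₁ τ₁ hfr ⟨hτ₁, hkey₁⟩ => ?_
  · simp [hgrid.minLayer_eq, hgrid.groups_eq, hr]
  refine (raiseToTop_spec (hH.congr (by simpa using hfr.reg heapSize rfl) (hfr.arr heapName rfl)
    (hfr.arr heapKey rfl)) hkey₁).mono fun σ₂ τ₂ ⟨hτ₂, κ, hkey, hle, hmax, hκ⟩ => ?_
  refine ⟨by simp; lia, κ, hkey, by lia, by lia, hmax, ?_⟩
  rcases hκ with rfl | hx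
  · rcases max_choice ((lo - 1) * (2 ^ c : ℕ) + (r : ℤ)) (k * (2 ^ c : ℕ)) with h | h
    · exact .inr (.inl h)
    · exact .inl h
  · exact .inr (.inr hx)

end Key

section Descent

variable {push : Bool} {c lo cnt : ℕ} {b κ : ℤ} {S₀ : Freqs n} {σ σ' : Mem} {tr : ℕ → FTree n}
  {H L : Multiset (ℤ × ℕ)} {T : Multiset ℕ}

/-- The current frequencies and their trees are in the memory: those of `H` in the heap, those of
`T` in the batch, and those of `L` in the list. -/
structure HoldsFreqs (c lo : ℕ) (σ : Mem) (tr : ℕ → FTree n) (cnt : ℕ) (H : Multiset (ℤ × ℕ))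
    (T : Multiset ℕ) (L : Multiset (ℤ × ℕ)) : Prop where
  grid : HoldsGrid σ c lo
  heap : HoldsHeap σ (H.map entry)
  batch : HoldsBatch σ T
  list : HoldsList σ L
  forest : HoldsForest σ tr cnt (T + (H + L).map Prod.snd)

theorem HoldsFreqs.card_le (h : HoldsFreqs c lo σ tr cnt H T L) :
    H.card + T.card + L.card ≤ n := by
  have hcard := h.forest.card_le
  have hle := h.forest.le
  simp only [Multiset.card_add, Multiset.card_map] at hcard
  lia

theorem HoldsFreqs.congr (h : HoldsFreqs c lo σ tr cnt H T L)
    (hreg : ∀ r ∈ [minLayer, groups, halfMinLayer, heapSize, batchSize, listSize, nodeCount],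
      σ'.reg r = σ.reg r) (harr : σ'.arr = σ.arr) : HoldsFreqs c lo σ' tr cnt H T L where
  grid := h.grid.congr (hreg _ (by simp)) (hreg _ (by simp)) (hreg _ (by simp))
  heap := h.heap.congr (hreg _ (by simp)) (by rw [harr]) (by rw [harr])
  batch := h.batch.congr (hreg _ (by simp)) (by rw [harr])
  list := h.list.congr (hreg _ (by simp)) (by rw [harr]) (by rw [harr])
  forest := h.forest.congr (hreg _ (by simp)) (by rw [harr]) (by rw [harr]) (by rw [harr])

theorem HoldsFreqs.of_frame {P : Prog} (h : HoldsFreqs c lo σ tr cnt H T L) (hfr : Frame P σ σ')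
    (hreg : ∀ r ∈ [minLayer, groups, halfMinLayer, heapSize, batchSize, listSize, nodeCount],
      P.writesReg r = false) (harr : ∀ a, P.writesArr a = false) :
    HoldsFreqs c lo σ' tr cnt H T L :=
  h.congr (fun r hr => hfr.reg r (hreg r hr)) (funext fun a => hfr.arr a (harr a))

/-- The memory during a descent with the state `Descent`. -/
structure DescentAt (push : Bool) (c lo : ℕ) (b : ℤ) (S₀ : Freqs n) (σ : Mem) (tr : ℕ → FTree n)
    (cnt : ℕ) (κ : ℤ) (H : Multiset (ℤ × ℕ)) (T : Multiset ℕ) (L : Multiset (ℤ × ℕ)) :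
    Prop where
  freqs : HoldsFreqs c lo σ tr cnt H T L
  pushing_iff : σ.reg pushing = 1 ↔ push = true
  key_eq : T ≠ 0 → σ.reg currentKey = κ
  descent : Descent push (2 ^ c) lo b S₀ tr κ H T L

/-- If the batch is empty, continue at the key of the top of the heap. -/
def startKey : Prog :=
  .ite (.le 1 (reg batchSize)) .skip (currentKey ≔ 0 - cell heapKey 0)

theorem startKey_spec (h : DescentAt push c lo b S₀ σ tr cnt κ H T L) (hHT : H ≠ 0 ∨ T ≠ 0) :
    Runs startKey σ fun σ' τ => τ ≤ 20 ∧ ∃ κ' : ℤ,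
      DescentAt push c lo b S₀ σ' tr cnt κ' H T L ∧ σ'.reg currentKey = κ' ∧
      (T = 0 → ∃ x ∈ H, x.1 = κ') := by
  apply Runs.ite
  · intro hb
    have hT : T ≠ 0 := by simpa [h.freqs.batch.size, Nat.one_le_iff_ne_zero] using hb
    exact Runs.skip ⟨by simp, κ, h, h.key_eq hT, fun hT' => absurd hT' hT⟩
  · intro hb
    obtain rfl : T = 0 := by simpa [h.freqs.batch.size] using hb
    obtain ⟨κ₁, hκ₁, hx, hmax⟩ := h.freqs.heap.exists_top (by simpa using hHT)
    apply Runs.setReg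
    refine ⟨by simp, κ₁, ⟨h.freqs.congr (by simp) rfl, by simpa using h.pushing_iff, by simp, ?_⟩,
      by simpa using neg_eq_iff_eq_neg.2 hκ₁, fun _ => hx⟩
    obtain ⟨x, hx, rfl⟩ := hx
    exact h.descent.move_of_empty (by positivity) (h.descent.heap_le x hx) hmax

/-- At the key `κ`, the descent combines, or takes a frequency out of the heap, or is done. -/
def ActsAt (push : Bool) (C lo : ℕ) (κ : ℤ) (H : Multiset (ℤ × ℕ)) (T : Multiset ℕ) : Prop :=
  T = 0 ∨ (push = true ∧ Active C lo κ ∧ T.card < combineArity C lo κ) → ∃ x ∈ H, x.1 = κ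

/-- Whether the batch is pushed down from the current key without any frequency being added. -/
def batchIsPushed : RTest :=
  .and (.and (.eq (reg pushing) 1) (.eq (reg active) 1))
    (.and (.lt (reg batchSize) (reg arity)) (.not topAtCurrentKey))

theorem batchIsPushed_holds (h : DescentAt push c lo b S₀ σ tr cnt κ H T L)
    (hk : HoldsKey σ (2 ^ c) lo κ) :
    batchIsPushed.holds σ ↔ (push = true ∧ Active (2 ^ c) lo κ) ∧
      T.card < combineArity (2 ^ c) lo κ ∧ ¬ ∃ x ∈ H, x.1 = κ := by
  have htop := topAtCurrentKey_holds h.freqs.heap hk.key_eq h.descent.heap_le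
  simp only [batchIsPushed, RTest.holds, RTest.holds_eq, RTest.holds_lt, htop, eval_one]
  simp only [h.pushing_iff, hk.active_iff, hk.arity_eq, h.freqs.batch.size, eval,
    Nat.cast_lt]

/-- Choose the key at which the descent continues. -/
def chooseKey : Prog :=
  startKey ;; classifyKey ;; .ite batchIsPushed (jumpKey ;; classifyKey) .skip

theorem DescentAt.classifyKey_spec (h : DescentAt push c lo b S₀ σ tr cnt κ H T L)
    (hkey : σ.reg currentKey = κ) :
    Runs classifyKey σ fun σ' τ => τ ≤ 60 ∧ DescentAt push c lo b S₀ σ' tr cnt κ H T L ∧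
      HoldsKey σ' (2 ^ c) lo κ := by
  refine (BambooGarden.classifyKey_spec hkey h.freqs.grid).frame.mono
    fun σ' τ ⟨hfr, hτ, hk⟩ => ⟨hτ, ⟨h.freqs.of_frame hfr (by decide) fun _ => rfl, ?_,
      fun _ => hk.key_eq, h.descent⟩, hk⟩
  rw [hfr.reg pushing rfl, h.pushing_iff]

theorem DescentAt.jumpKey_spec (h : DescentAt true c lo b S₀ σ tr cnt κ H T L)
    (hk : HoldsKey σ (2 ^ c) lo κ) (hact : Active (2 ^ c) lo κ)
    (hT : T.card < combineArity (2 ^ c) lo κ) :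
    Runs jumpKey σ fun σ' τ => τ ≤ 60 ∧ ∃ κ' : ℤ, DescentAt true c lo b S₀ σ' tr cnt κ' H T L ∧
      σ'.reg currentKey = κ' ∧
      (Active (2 ^ c) lo κ' → T.card < combineArity (2 ^ c) lo κ' → ∃ x ∈ H, x.1 = κ') := by
  have hC : 0 < 2 ^ c := by positivity
  refine (BambooGarden.jumpKey_spec h.freqs.heap h.freqs.batch.size hk.layer_eq
    h.freqs.grid).frame.mono fun σ' τ ⟨hfr, hτ, κ', hkey, hlayer, hr, hmax, hκ'⟩ => ?_
  have hle : κ' ≤ κ := by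
    rcases hκ' with rfl | rfl | ⟨x, hx, rfl⟩
    · exact Int.ediv_mul_le κ (by positivity)
    · have := combineArity_le hC hact
      lia
    · exact h.descent.heap_le x hx
  refine ⟨hτ, κ', ⟨h.freqs.of_frame hfr (by decide) fun _ => rfl, ?_, fun _ => hkey,
    h.descent.move_of_push hC hle hmax hact hT hlayer hr⟩, hkey, fun hact' hT' => ?_⟩
  · rw [hfr.reg pushing rfl, h.pushing_iff]
  · rcases hκ' with rfl | rfl | hx
    · exact absurd (Int.mul_emod_left _ _) hact'.2
    · have := combineArity_le hC hact'
      lia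
    · exact hx

theorem chooseKey_spec (h : DescentAt push c lo b S₀ σ tr cnt κ H T L) (hHT : H ≠ 0 ∨ T ≠ 0) :
    Runs chooseKey σ fun σ' τ => τ ≤ 260 ∧ ∃ κ' : ℤ,
      DescentAt push c lo b S₀ σ' tr cnt κ' H T L ∧ HoldsKey σ' (2 ^ c) lo κ' ∧
      ActsAt push (2 ^ c) lo κ' H T := by
  refine Runs.seq_of_spec (startKey_spec h hHT) fun σ₁ τ₁ _ ⟨hτ₁, κ₁, h₁, hkey₁, hempty⟩ => ?_
  refine Runs.seq_of_spec (h₁.classifyKey_spec hkey₁) fun σ₂ τ₂ _ ⟨hτ₂, h₂, hk₂⟩ => ?_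
  have hcost : batchIsPushed.cost ≤ 40 := by simp [batchIsPushed, topAtCurrentKey]
  apply Runs.ite <;> rw [batchIsPushed_holds h₂ hk₂] <;> intro hb
  · obtain ⟨⟨rfl, hact⟩, hT, hH⟩ := hb
    refine Runs.seq_of_spec (h₂.jumpKey_spec hk₂ hact hT)
      fun σ₃ τ₃ _ ⟨hτ₃, κ₃, h₃, hkey₃, hacts⟩ => ?_
    refine (h₃.classifyKey_spec hkey₃).mono fun σ₄ τ₄ ⟨hτ₄, h₄, hk₄⟩ => ?_
    refine ⟨by lia, κ₃, h₄, hk₄, ?_⟩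
    rintro (hT0 | ⟨-, hact₃, hT₃⟩)
    · exact absurd (hempty hT0) hH
    · exact hacts hact₃ hT₃
  · refine Runs.skip ⟨by lia, κ₁, h₂, hk₂, ?_⟩
    rintro (hT0 | ⟨hpush, hact, hT⟩)
    · exact hempty hT0
    · exact not_not.1 fun hH => hb ⟨⟨hpush, hact⟩, hT, hH⟩

end Descent

section Descent

variable {push : Bool} {c lo cnt : ℕ} {b κ : ℤ} {S₀ : Freqs n} {σ σ' : Mem} {tr : ℕ → FTree n}
  {H L : Multiset (ℤ × ℕ)} {T : Multiset ℕ}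

/-- A bound on the number of steps of an operation on a heap of at most `n` pairs and of what goes
with it. -/
def unitCost (n : ℕ) : ℕ := 150 * Nat.log 2 n + 700

/-- A bound on the number of steps of the rest of a descent. A frequency in the heap counts 9
since taking it out costs a unit and leaves a taken one, which counts 6; a combination of `r ≥ 2`
taken frequencies puts one back into the heap, and `6 * r ≥ 9 + 3`. -/
def descentBudget (n heap taken : ℕ) : ℕ := unitCost n * (9 * heap + 6 * taken)

/-- A descent is going on, and `B` is its budget. -/
def DescentWithin (push : Bool) (c lo : ℕ) (b : ℤ) (S₀ : Freqs n) (σ : Mem) (B : ℕ) : Prop :=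
  ∃ tr cnt κ H T L, DescentAt push c lo b S₀ σ tr cnt κ H T L ∧
    B = descentBudget n H.card T.card

/-- Compute the negated key of a combination of frequencies with the current key. -/
def setCombinedKey : Prog :=
  .ite (.eq (reg layer) (reg minLayer))
    (key ≔ 0 - (reg minLayer - reg halfMinLayer) * reg groups)
    (key ≔ reg groups - reg currentKey)

theorem setCombinedKey_spec (hgrid : HoldsGrid σ c lo) (hk : HoldsKey σ (2 ^ c) lo κ) :
    Runs setCombinedKey σ fun σ' τ => τ ≤ 30 ∧
      σ'.reg key = -((combinedKey c lo κ : ℤ) : ℝ) := by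
  have hlayer : ((κ / ((2 ^ c : ℕ) : ℤ) : ℤ) : ℝ) = lo ↔ κ / ((2 ^ c : ℕ) : ℤ) = lo := by norm_cast
  apply Runs.ite <;> intro hb <;>
    simp only [RTest.holds_eq, eval, hk.layer_eq, hgrid.minLayer_eq, hlayer] at hb <;>
    apply Runs.setReg <;> refine ⟨by simp, ?_⟩
  · rw [combinedKey, if_pos hb]
    simp [hgrid.minLayer_eq, hgrid.groups_eq, hgrid.halfMinLayer_eq]
  · rw [combinedKey, if_neg hb]
    simp [hgrid.groups_eq, hk.key_eq]

/-- Combine the frequencies of the batch. -/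
def combineAtKey : Prog := setCombinedKey ;; combineBatch

theorem descentBudget_combine {h r : ℕ} (hr : 2 ≤ r) (hn : h + r ≤ n) :
    30 * r + 60 * Nat.log 2 (h + 1) + 500 + descentBudget n (h + 1) 0 ≤ descentBudget n h r := by
  obtain ⟨r, rfl⟩ := Nat.exists_eq_add_of_le' hr
  have hlog : Nat.log 2 (h + 1) ≤ Nat.log 2 n := Nat.log_mono_right (by lia)
  have hunit : 700 * r ≤ unitCost n * r := Nat.mul_le_mul_right _ (by rw [unitCost]; lia)
  have hsplit : descentBudget n h (r + 2) =
      descentBudget n (h + 1) 0 + (3 * unitCost n + unitCost n * r * 6) := by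
    rw [descentBudget, descentBudget]
    ring
  have hdef : unitCost n = 150 * Nat.log 2 n + 700 := rfl
  lia

theorem combineAtKey_spec (h : DescentAt push c lo b S₀ σ tr cnt κ H T L)
    (hk : HoldsKey σ (2 ^ c) lo κ) (hact : Active (2 ^ c) lo κ)
    (hT : T.card = combineArity (2 ^ c) lo κ) :
    Runs combineAtKey σ fun σ' τ => ∃ B, DescentWithin push c lo b S₀ σ' B ∧
      τ + 350 + B ≤ descentBudget n H.card T.card := by
  have hcard : 2 ≤ T.card := hT ▸ two_le_combineArity (by positivity) hact
  refine Runs.seq_of_spec (setCombinedKey_spec h.freqs.grid hk) fun σ₁ τ₁ hfr₁ ⟨hτ₁, hkey⟩ => ?_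
  have h₁ := h.freqs.of_frame hfr₁ (by decide) fun _ => rfl
  refine (combineBatch_spec h₁.heap h₁.batch h₁.forest hkey hcard).frame.mono
    fun σ₂ τ₂ ⟨hfr₂, hτ₂, tr', t, hH₂, hT₂, hF₂, htr, hTt, _, hnode⟩ => ?_
  have hle : H.card + T.card ≤ n := (Nat.le_add_right _ _).trans h₁.card_le
  have hbudget := descentBudget_combine hcard hle
  refine ⟨_, ⟨tr', cnt + 1, κ, (combinedKey c lo κ, cnt) ::ₘ H, 0, L, ⟨⟨?_, hH₂, hT₂, ?_, ?_⟩, ?_,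
    by simp, ?_⟩, by rw [Multiset.card_cons, Multiset.card_zero]⟩, by lia⟩
  · exact h₁.grid.congr (hfr₂.reg _ rfl) (hfr₂.reg _ rfl) (hfr₂.reg _ rfl)
  · exact h₁.list.congr (hfr₂.reg _ rfl) (hfr₂.arr _ rfl) (hfr₂.arr _ rfl)
  · simpa using hF₂
  · rw [hfr₂.reg pushing rfl, hfr₁.reg pushing rfl, h.pushing_iff]
  · refine (hTt ▸ h.descent).combine hact hT (fun x hx => htr _ ?_) hnode
    exact h.freqs.forest.root_lt _ (Multiset.mem_add.2 (.inr (Multiset.mem_map_of_mem _ hx)))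

/-- Move the frequency at the top of the heap to the batch. -/
def takeTop : Prog :=
  heapPop ;; .setCell batch (reg batchSize) (reg name) ;; batchSize ≔ reg batchSize + 1

theorem HoldsBatch.cons {i : ℕ} (h : HoldsBatch σ T) (hsize : σ'.reg batchSize = T.card + 1)
    (hbatch : σ'.arr batch = Function.update (σ.arr batch) T.card i) :
    HoldsBatch σ' (i ::ₘ T) := by
  obtain ⟨-, t, hTt, ht⟩ := h
  refine ⟨by simpa using hsize, Function.update t T.card i, ?_, fun l hl => ?_⟩
  · rw [Multiset.card_cons, Multiset.range_succ, Multiset.map_cons, Function.update_self]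
    conv_lhs => rw [hTt]
    congr 1
    refine Multiset.map_congr rfl fun l hl => ?_
    rw [Function.update_of_ne (Multiset.mem_range.1 hl).ne]
  · rw [Multiset.card_cons] at hl
    rw [hbatch]
    rcases (Nat.lt_succ_iff.1 hl).eq_or_lt with rfl | hl
    · rw [Function.update_self, Function.update_self]
    · rw [Function.update_of_ne hl.ne, Function.update_of_ne hl.ne, ht l hl]

theorem descentBudget_take {h r : ℕ} (hn : h + 1 ≤ n) :
    150 * Nat.log 2 (h + 1) + 500 + descentBudget n h (r + 1) ≤ descentBudget n (h + 1) r := by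
  have hlog : Nat.log 2 (h + 1) ≤ Nat.log 2 n := Nat.log_mono_right hn
  have hsplit : descentBudget n (h + 1) r = descentBudget n h (r + 1) + 3 * unitCost n := by
    rw [descentBudget, descentBudget]
    ring
  have hdef : unitCost n = 150 * Nat.log 2 n + 700 := rfl
  lia

theorem takeTop_spec (h : DescentAt push c lo b S₀ σ tr cnt κ H T L) (hkey : σ.reg currentKey = κ)
    (hH : ∃ x ∈ H, x.1 = κ) (hT : Active (2 ^ c) lo κ → T.card < combineArity (2 ^ c) lo κ) :
    Runs takeTop σ fun σ' τ => ∃ B, DescentWithin push c lo b S₀ σ' B ∧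
      τ + 350 + B ≤ descentBudget n H.card T.card := by
  obtain ⟨x, hx, hxκ⟩ := hH
  have hH0 : H ≠ 0 := fun h => Multiset.notMem_zero x (h ▸ hx)
  refine Runs.seq_of_spec (heapPop_entry h.freqs.heap hH0)
    fun σ₁ τ₁ hfr ⟨hτ₁, κ₁, i, H', hHH', hmax, _, _, hname, hH'⟩ => ?_
  subst hHH'
  obtain rfl : κ₁ = κ := (h.descent.heap_le (κ₁, i) (Multiset.mem_cons_self _ _)).antisymm
    (hxκ ▸ hmax x hx)
  have hsize : σ₁.reg batchSize = T.card := (hfr.reg batchSize rfl).trans h.freqs.batch.size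
  have hbudget := descentBudget_take (n := n) (h := H'.card) (r := T.card) <| by
    have := h.freqs.card_le
    rw [Multiset.card_cons] at this
    lia
  apply Runs.seq
  apply Runs.setCell
  apply Runs.setReg
  refine ⟨_, ⟨tr, cnt, κ₁, H', i ::ₘ T, L, ⟨⟨?_, ?_, ?_, ?_, ?_⟩, ?_, fun _ => ?_,
    h.descent.pop hT⟩, rfl⟩, ?_⟩
  · exact h.freqs.grid.congr (by simpa using hfr.reg minLayer rfl)
      (by simpa using hfr.reg groups rfl) (by simpa using hfr.reg halfMinLayer rfl)
  · exact hH'.congr (by simp) (by funext; simp) (by funext; simp)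
  · refine h.freqs.batch.cons (by simp [hsize]) (funext fun j => ?_)
    simp [Function.update_apply, hsize, hname, hfr.arr batch rfl]
  · exact h.freqs.list.congr (by simpa using hfr.reg listSize rfl)
      (by funext; simp [hfr.arr listKey rfl]) (by funext; simp [hfr.arr listName rfl])
  · have hroots : i ::ₘ T + (H' + L).map Prod.snd = T + ((κ₁, i) ::ₘ H' + L).map Prod.snd := by
      simp
    rw [hroots]
    exact h.freqs.forest.congr (by simpa using hfr.reg nodeCount rfl)
      (by funext; simp [hfr.arr parent rfl]) (by funext; simp [hfr.arr childIndex rfl])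
      (by funext; simp [hfr.arr childCount rfl])
  · simpa [hfr.reg pushing rfl] using h.pushing_iff
  · simpa using (hfr.reg currentKey rfl).trans hkey
  · rw [Multiset.card_cons] at hτ₁ ⊢
    simp
    lia

theorem descentBudget_flush {h r : ℕ} (hr : 1 ≤ r) :
    40 * r + 500 + descentBudget n h 0 ≤ descentBudget n h r := by
  have hunit : 700 * r ≤ unitCost n * r := Nat.mul_le_mul_right _ (by rw [unitCost]; lia)
  have hsplit : descentBudget n h r = descentBudget n h 0 + unitCost n * r * 6 := by
    rw [descentBudget, descentBudget]
    ring
  lia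

theorem DescentAt.flushBatch_spec (h : DescentAt push c lo b S₀ σ tr cnt κ H T L)
    (hkey : σ.reg currentKey = κ) (hacts : ActsAt push (2 ^ c) lo κ H T)
    (hH : ¬ ∃ x ∈ H, x.1 = κ) (hT : Active (2 ^ c) lo κ → T.card < combineArity (2 ^ c) lo κ) :
    Runs flushBatch σ fun σ' τ => ∃ B, DescentWithin push c lo b S₀ σ' B ∧
      τ + 350 + B ≤ descentBudget n H.card T.card := by
  have hcard : 1 ≤ T.card := Multiset.card_pos.2 fun hT0 => hH (hacts (.inl hT0))
  have hlt : ∀ x ∈ H, x.1 < κ := fun x hx =>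
    (h.descent.heap_le x hx).lt_of_ne fun he => hH ⟨x, hx, he⟩
  have hdone : ¬ Active (2 ^ c) lo κ ∨ push = false := by
    by_contra! hcon
    exact hH (hacts (.inr ⟨by simpa using hcon.2, hcon.1, hT hcon.1⟩))
  refine (BambooGarden.flushBatch_spec h.freqs.batch h.freqs.list hkey).frame.mono
    fun σ₁ τ₁ ⟨hfr, hτ₁, hT₁, hL₁⟩ => ?_
  have hbudget := descentBudget_flush (n := n) (h := H.card) hcard
  refine ⟨_, ⟨tr, cnt, κ - 1, H, 0, L + T.map fun i => (κ, i), ⟨⟨?_, ?_, hT₁, hL₁, ?_⟩, ?_, by simp,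
    h.descent.flush (by positivity) hlt hT hdone⟩, by rw [Multiset.card_zero]⟩, by lia⟩
  · exact h.freqs.grid.congr (hfr.reg _ rfl) (hfr.reg _ rfl) (hfr.reg _ rfl)
  · exact h.freqs.heap.congr (hfr.reg _ rfl) (hfr.arr _ rfl) (hfr.arr _ rfl)
  · have hroots : 0 + (H + (L + T.map fun i => (κ, i))).map Prod.snd =
        T + (H + L).map Prod.snd := by
      simp only [Multiset.map_add, Multiset.map_map, Function.comp_def, Multiset.map_id']
      rw [zero_add, ← add_assoc, add_comm]
    rw [hroots]
    exact h.freqs.forest.congr (hfr.reg _ rfl) (hfr.arr _ rfl) (hfr.arr _ rfl) (hfr.arr _ rfl)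
  · rw [hfr.reg pushing rfl, h.pushing_iff]

/-- Combine the frequencies of the batch, or take another one out of the heap, or move those of the
batch to the list. -/
def descendAction : Prog :=
  .ite (.and (.eq (reg active) 1) (.eq (reg batchSize) (reg arity))) combineAtKey
    (.ite topAtCurrentKey takeTop flushBatch)

theorem descendAction_spec (h : DescentAt push c lo b S₀ σ tr cnt κ H T L)
    (hk : HoldsKey σ (2 ^ c) lo κ) (hacts : ActsAt push (2 ^ c) lo κ H T) :
    Runs descendAction σ fun σ' τ => ∃ B, DescentWithin push c lo b S₀ σ' B ∧
      τ + 300 + B ≤ descentBudget n H.card T.card := by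
  have hcost : topAtCurrentKey.cost ≤ 20 := by simp [topAtCurrentKey]
  apply Runs.ite <;> intro hb
  · obtain ⟨hact, hT⟩ : Active (2 ^ c) lo κ ∧ T.card = combineArity (2 ^ c) lo κ := by
      simpa [hk.active_iff, hk.arity_eq, h.freqs.batch.size] using hb
    refine (combineAtKey_spec h hk hact hT).mono fun σ' τ ⟨B, hB, hτ⟩ => ⟨B, hB, ?_⟩
    simp
    lia
  · replace hb : Active (2 ^ c) lo κ → T.card ≠ combineArity (2 ^ c) lo κ := by
      simpa [hk.active_iff, hk.arity_eq, h.freqs.batch.size] using hb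
    have hT : Active (2 ^ c) lo κ → T.card < combineArity (2 ^ c) lo κ := fun hact =>
      (h.descent.taken_le hact).lt_of_ne (hb hact)
    apply Runs.ite <;> rw [topAtCurrentKey_holds h.freqs.heap hk.key_eq h.descent.heap_le] <;>
      intro hH
    · refine (takeTop_spec h hk.key_eq hH hT).mono fun σ' τ ⟨B, hB, hτ⟩ => ⟨B, hB, ?_⟩
      simp
      lia
    · refine (h.flushBatch_spec hk.key_eq hacts hH hT).mono fun σ' τ ⟨B, hB, hτ⟩ => ⟨B, hB, ?_⟩
      simp
      lia

/-- Carry out all steps of a descent. -/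
def descend : Prog :=
  .loop (.le 1 (reg heapSize + reg batchSize)) (chooseKey ;; descendAction)

theorem descend_spec (h : DescentAt push c lo b S₀ σ tr cnt κ H T L) :
    Runs descend σ fun σ' τ => τ ≤ descentBudget n H.card T.card + 10 ∧
      ∃ tr' cnt' κ' L', DescentAt push c lo b S₀ σ' tr' cnt' κ' 0 0 L' := by
  have hguard : ∀ {σ : Mem} {tr cnt κ H T L}, DescentAt push c lo b S₀ σ tr cnt κ H T L →
      ((RTest.le 1 (reg heapSize + reg batchSize)).holds σ ↔ H ≠ 0 ∨ T ≠ 0) := by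
    intro σ tr cnt κ H T L h
    have hsum : (1 : ℝ) ≤ H.card + T.card ↔ 1 ≤ H.card + T.card := by norm_cast
    have hpos : 1 ≤ H.card + T.card ↔ H ≠ 0 ∨ T ≠ 0 := by
      rw [← Multiset.card_pos, ← Multiset.card_pos]
      lia
    simp [h.freqs.heap.size, h.freqs.batch.size, hsum, hpos]
  refine Runs.loop (DescentWithin push c lo b S₀) _ ⟨tr, cnt, κ, H, T, L, h, rfl⟩ ?_ ?_
  · rintro σ B ⟨tr, cnt, κ, H, T, L, h, rfl⟩ hb
    refine Runs.seq_of_spec (chooseKey_spec h ((hguard h).1 hb))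
      fun σ₁ τ₁ _ ⟨hτ₁, κ₁, h₁, hk, hacts⟩ => ?_
    refine (descendAction_spec h₁ hk hacts).mono fun σ₂ τ₂ ⟨B, hB, hτ₂⟩ => ⟨B, hB, ?_⟩
    simp
    lia
  · rintro σ' τ B' ⟨tr, cnt, κ, H, T, L, h, rfl⟩ hb hτ
    obtain ⟨rfl, rfl⟩ : H = 0 ∧ T = 0 := by simpa only [hguard h, not_or, not_not] using hb
    simp only [RTest.cost, RExpr.cost] at hτ
    exact ⟨by lia, tr, cnt, κ, L, h⟩

/-- Load the list into the heap, and carry out a descent, which pushes frequencies down if `flag` is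
`1`. -/
def descentPhase (flag : ℤ) : Prog := pushing ≔ const flag ;; loadList ;; descend

theorem descentPhase_cost_le {m : ℕ} (hm : m ≤ n) :
    m * (60 * Nat.log 2 m + 80) + descentBudget n m 0 ≤ 10 * unitCost n * n := by
  have hlog : Nat.log 2 m ≤ Nat.log 2 n := Nat.log_mono_right hm
  calc m * (60 * Nat.log 2 m + 80) + descentBudget n m 0
      ≤ n * unitCost n + unitCost n * (9 * n + 6 * 0) :=
        Nat.add_le_add (Nat.mul_le_mul hm (by rw [unitCost]; lia))
          (Nat.mul_le_mul_left _ (by lia))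
    _ = 10 * unitCost n * n := by ring

theorem descentPhase_spec {flag : ℤ} (hflag : flag = 1 ↔ push = true)
    (h : HoldsFreqs c lo σ tr cnt 0 0 L) (hb : ∀ x ∈ L, x.1 ≤ b)
    (hlo : (lo : ℤ) * (2 ^ c : ℕ) - 1 ≤ b) :
    Runs (descentPhase flag) σ fun σ' τ => τ ≤ 10 * unitCost n * n + 50 ∧ ∃ tr' cnt' L',
      HoldsFreqs c lo σ' tr' cnt' 0 0 L' ∧ (∀ x ∈ L', x.1 ≤ b) ∧
      StepsDown (KeyStep push (2 ^ c) lo) b (keyedFreqs (2 ^ c) tr L) (lo * (2 ^ c : ℕ) - 1)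
        (keyedFreqs (2 ^ c) tr' L') := by
  have hcard : L.card ≤ n := by
    have := h.card_le
    lia
  apply Runs.seq
  apply Runs.setReg
  have h₀ : HoldsFreqs c lo (σ.setReg pushing ((const flag).eval σ)) tr cnt 0 0 L :=
    h.congr (by simp) rfl
  refine Runs.seq_of_spec (loadList_spec h₀.heap h₀.list) fun σ₁ τ₁ hfr ⟨hτ₁, hH, hL⟩ => ?_
  have h₁ : DescentAt push c lo b (keyedFreqs (2 ^ c) tr L) σ₁ tr cnt b L 0 0 := by
    refine ⟨⟨?_, hH, ?_, hL, ?_⟩, ?_, by simp, Descent.start hb⟩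
    · exact h₀.grid.congr (hfr.reg _ rfl) (hfr.reg _ rfl) (hfr.reg _ rfl)
    · exact h₀.batch.congr (hfr.reg _ rfl) (hfr.arr _ rfl)
    · simpa using h₀.forest.congr (hfr.reg _ rfl) (hfr.arr _ rfl) (hfr.arr _ rfl) (hfr.arr _ rfl)
    · rw [hfr.reg pushing rfl, ← hflag]
      simp
  refine (descend_spec h₁).mono fun σ₂ τ₂ ⟨hτ₂, tr', cnt', κ', L', h₂⟩ => ⟨?_, tr', cnt', L',
    h₂.freqs, h₂.descent.list_le, h₂.descent.stepsDown (by positivity) hlo⟩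
  have hcost := descentPhase_cost_le hcard
  rw [Multiset.card_zero] at hτ₂
  simp
  lia

end Descent

section Merge

variable {C cnt ia ib : ℕ} {κa κb : ℤ} {σ : Mem} {tr tr' : ℕ → FTree n} {H : Multiset (ℤ × ℕ)}

/-! ### Merging the frequencies -/

theorem mergeLargest_keyedFreqs (hC : 0 < C) (hab : κa ≤ κb) (hmax : ∀ x ∈ H, x.1 ≤ κa)
    (htr : ∀ x ∈ H, tr' x.2 = tr x.2) (hnode : tr' cnt = .node 2 ![tr ia, tr ib]) :
    MergeLargest (keyedFreqs C tr ((κb, ib) ::ₘ (κa, ia) ::ₘ H))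
      (keyedFreqs C tr' ((κa - C, cnt) ::ₘ H)) := by
  have hrest : keyedFreqs C tr' H = keyedFreqs C tr H :=
    Multiset.map_congr rfl fun x hx => by rw [htr x hx]
  have hbefore : keyedFreqs C tr ((κb, ib) ::ₘ (κa, ia) ::ₘ H) =
      keyedFreqs C tr H + {(gridVal C κa, tr ia), (gridVal C κb, tr ib)} := by
    simp only [keyedFreqs, Multiset.map_cons, Multiset.insert_eq_cons]
    rw [add_comm, Multiset.cons_add, Multiset.singleton_add, Multiset.cons_swap]
  have hafter : keyedFreqs C tr' ((κa - C, cnt) ::ₘ H) =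
      keyedFreqs C tr H + {(gridVal C κa / 2, .node 2 ![tr ia, tr ib])} := by
    rw [← hrest, ← gridVal_sub hC, ← hnode, add_comm, Multiset.singleton_add, keyedFreqs,
      Multiset.map_cons, keyedFreqs]
  rw [hbefore, hafter]
  refine .mk _ _ _ _ _ ((gridVal_strictMono hC).monotone hab) fun x hx => ?_
  obtain ⟨y, hy, rfl⟩ := Multiset.mem_map.1 hx
  exact (gridVal_strictMono hC).monotone (hmax y hy)

/-- Move the two largest frequencies from the heap to the batch, and halve the smaller one. -/
def popTwo : Prog :=
  heapPop ;;
  .setCell batch 1 (reg name) ;;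
  heapPop ;;
  .setCell batch 0 (reg name) ;;
  key ≔ reg key + reg groups ;;
  batchSize ≔ 2

theorem popTwo_spec (hH : HoldsHeap σ (H.map entry)) (hgroups : σ.reg groups = C)
    (hcard : 2 ≤ H.card) :
    Runs popTwo σ fun σ' τ => τ ≤ 300 * Nat.log 2 H.card + 200 ∧
      ∃ κa ia κb ib H', H = (κb, ib) ::ₘ (κa, ia) ::ₘ H' ∧ κa ≤ κb ∧ (∀ x ∈ H', x.1 ≤ κa) ∧
        HoldsHeap σ' (H'.map entry) ∧ σ'.reg key = -((κa - C : ℤ) : ℝ) ∧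
        σ'.reg batchSize = 2 ∧ σ'.arr batch 0 = ia ∧ σ'.arr batch 1 = ib := by
  refine Runs.seq_of_spec (heapPop_entry hH (Multiset.card_pos.1 (by lia)))
    fun σ₁ τ₁ hfr₁ ⟨hτ₁, κb, ib, H₁, hHH₁, hmax₁, _, _, hname₁, hH₁⟩ => ?_
  subst hHH₁
  have hcard₁ : H₁.card + 1 = ((κb, ib) ::ₘ H₁).card := (Multiset.card_cons ..).symm
  apply Runs.seq
  apply Runs.setCell
  refine Runs.seq_of_spec (heapPop_entry (hH₁.congr (by simp) (by funext; simp) (by funext; simp))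
    (Multiset.card_pos.1 (by lia)))
    fun σ₂ τ₂ hfr₂ ⟨hτ₂, κa, ia, H₂, hHH₂, hmax₂, _, hkey₂, hname₂, hH₂⟩ => ?_
  subst hHH₂
  have hgroups₂ : σ₂.reg groups = C := by
    simpa [hfr₁.reg groups rfl, hgroups] using hfr₂.reg groups rfl
  have hbatch₂ : σ₂.arr batch 1 = ib := by rw [hfr₂.arr batch rfl]; simp [hname₁]
  have hlog : Nat.log 2 ((κa, ia) ::ₘ H₂).card ≤ Nat.log 2 ((κb, ib) ::ₘ (κa, ia) ::ₘ H₂).card :=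
    Nat.log_mono_right (Multiset.card_le_card (Multiset.le_cons_self _ _))
  simp only [Multiset.card_cons] at hτ₁ hτ₂ hlog
  repeat' with_reducible first | apply Runs.seq | apply Runs.setReg | apply Runs.setCell
  refine ⟨by simp; lia, κa, ia, κb, ib, H₂, rfl, hmax₁ (κa, ia) (by simp),
    fun x hx => hmax₂ x (Multiset.mem_cons_of_mem hx),
    hH₂.congr (by simp) (by funext; simp) (by funext; simp), ?_, by simp, by simp [hname₂],
    by simp [hbatch₂]⟩
  simp [hkey₂, hgroups₂]
  ring

/-- Replace two largest frequencies by one. -/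
def mergeTwo : Prog := popTwo ;; combineBatch

theorem FTree.node_eq_pair {r : ℕ} (hr : r = 2) (child : ℕ → FTree n) :
    FTree.node r (fun l => child l) = .node 2 ![child 0, child 1] := by
  subst hr
  congr 1
  funext l
  fin_cases l <;> rfl

theorem mergeTwo_spec (hC : 0 < C) (hH : HoldsHeap σ (H.map entry))
    (hF : HoldsForest σ tr cnt (H.map Prod.snd)) (hgroups : σ.reg groups = C)
    (hcard : 2 ≤ H.card) :
    Runs mergeTwo σ fun σ' τ => τ + 10 ≤ 3 * unitCost n ∧ ∃ tr' cnt' H',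
      HoldsHeap σ' (H'.map entry) ∧ HoldsForest σ' tr' cnt' (H'.map Prod.snd) ∧
      σ'.reg groups = C ∧ H.card = H'.card + 1 ∧
      MergeLargest (keyedFreqs C tr H) (keyedFreqs C tr' H') := by
  have hle : H.card ≤ n := by
    have := hF.card_le
    have := hF.le
    rw [Multiset.card_map] at *
    lia
  refine Runs.seq_of_spec (popTwo_spec hH hgroups hcard) fun σ₁ τ₁ hfr₁
    ⟨hτ₁, κa, ia, κb, ib, H', hHH', hab, hmax, hH', hkey, hsize, hbatch0, hbatch1⟩ => ?_
  subst hHH'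
  have hT : HoldsBatch σ₁ {ia, ib} := by
    refine ⟨by simpa using hsize, fun l => if l = 0 then ia else ib,
      by simpa [Multiset.range_succ] using Multiset.pair_comm ia ib, fun l hl => ?_⟩
    obtain rfl | rfl : l = 0 ∨ l = 1 := Nat.lt_succ_iff_lt_or_eq.1 hl |>.imp_left Nat.lt_one_iff.1
    · simpa using hbatch0
    · simpa using hbatch1
  have hF₁ : HoldsForest σ₁ tr cnt ({ia, ib} + H'.map Prod.snd) := by
    simpa [Multiset.cons_swap ia ib] using
      hF.congr (hfr₁.reg _ rfl) (hfr₁.arr _ rfl) (hfr₁.arr _ rfl) (hfr₁.arr _ rfl)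
  refine (combineBatch_spec hH' hT hF₁ hkey le_rfl).frame.mono
    fun σ₂ τ₂ ⟨hfr₂, hτ₂, tr', t, hH₂, _, hF₂, htr, _, ht, hnode⟩ => ?_
  obtain rfl : ia = t 0 := by exact_mod_cast hbatch0.symm.trans (ht 0 (by simp))
  obtain rfl : ib = t 1 := by exact_mod_cast hbatch1.symm.trans (ht 1 (by simp))
  refine ⟨?_, tr', cnt + 1, _, hH₂, by simpa using hF₂,
    (hfr₂.reg _ rfl).trans ((hfr₁.reg _ rfl).trans hgroups), by simp,
    mergeLargest_keyedFreqs hC hab hmax (fun x hx => htr _ (hF₁.root_lt _ ?_))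
      (hnode.trans (FTree.node_eq_pair rfl fun l => tr (t l)))⟩
  · rw [Multiset.card_cons, Multiset.card_cons] at hτ₁ hle
    have hlog₁ : Nat.log 2 (H'.card + 1 + 1) ≤ Nat.log 2 n := Nat.log_mono_right hle
    have hlog₂ : Nat.log 2 (H'.card + 1) ≤ Nat.log 2 n := Nat.log_mono_right (by lia)
    simp only [Multiset.insert_eq_cons, Multiset.card_cons, Multiset.card_singleton] at hτ₂
    rw [unitCost]
    lia
  · exact Multiset.mem_add.2 (.inr (Multiset.mem_map_of_mem _ hx))

theorem HoldsForest.last_mem {A : Multiset ℕ} (h : HoldsForest σ tr cnt A) (hn : 0 < n) :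
    cnt - 1 ∈ A := by
  have hle := h.le
  rcases h.root_or_hasParent (cnt - 1) (by lia) with hmem | ⟨p, _, _, _, hlt, hp, _⟩
  · exact hmem
  · lia

theorem exists_keyedFreqs_eq_singleton (hn : 0 < n)
    (hF : HoldsForest σ tr cnt (H.map Prod.snd)) (hcard : H.card ≤ 1) :
    H.map Prod.snd = {cnt - 1} ∧ ∃ v, keyedFreqs C tr H = {(v, tr (cnt - 1))} := by
  obtain ⟨⟨κ, i⟩, hmem, rfl : i = cnt - 1⟩ := Multiset.mem_map.1 (hF.last_mem hn)
  obtain ⟨x, rfl⟩ := Multiset.card_eq_one.1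
    (hcard.antisymm (Multiset.card_pos.2 fun h => Multiset.notMem_zero _ (h ▸ hmem)))
  obtain rfl := Multiset.mem_singleton.1 hmem
  exact ⟨Multiset.map_singleton _ _, gridVal C κ, Multiset.map_singleton _ _⟩

/-- Merge two largest frequencies until a single one is left. -/
def mergeProg : Prog := .loop (.le 2 (reg heapSize)) mergeTwo

theorem mergeProg_spec (hn : 0 < n) (hC : 0 < C) (hH : HoldsHeap σ (H.map entry))
    (hF : HoldsForest σ tr cnt (H.map Prod.snd)) (hgroups : σ.reg groups = C) :
    Runs mergeProg σ fun σ' τ => τ ≤ 3 * unitCost n * n + 10 ∧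
      ∃ tr' cnt' v, HoldsForest (n := n) σ' tr' cnt' {cnt' - 1} ∧
        Relation.ReflTransGen MergeLargest (keyedFreqs C tr H) {(v, tr' (cnt' - 1))} := by
  have hcard : H.card ≤ n := by
    have := hF.card_le
    have := hF.le
    rw [Multiset.card_map] at *
    lia
  refine Runs.loop (fun σ' B => ∃ tr' cnt' H', HoldsHeap σ' (H'.map entry) ∧
    HoldsForest σ' tr' cnt' (H'.map Prod.snd) ∧ σ'.reg groups = C ∧
    Relation.ReflTransGen MergeLargest (keyedFreqs C tr H) (keyedFreqs C tr' H') ∧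
    B = 3 * unitCost n * H'.card) _ ⟨tr, cnt, H, hH, hF, hgroups, .refl, rfl⟩ ?_ ?_
  · rintro σ B ⟨tr₁, cnt₁, H₁, hH₁, hF₁, hgroups₁, hmerge, rfl⟩ hb
    have hcard₁ : 2 ≤ H₁.card := by simpa [hH₁.size] using hb
    refine (mergeTwo_spec hC hH₁ hF₁ hgroups₁ hcard₁).mono
      fun σ₂ τ₂ ⟨hτ, tr₂, cnt₂, H₂, hH₂, hF₂, hgroups₂, hcard₂, hmerge₂⟩ =>
        ⟨_, ⟨tr₂, cnt₂, H₂, hH₂, hF₂, hgroups₂, hmerge.tail hmerge₂, rfl⟩, ?_⟩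
    rw [hcard₂, mul_add]
    simp
    lia
  · rintro σ' τ B' ⟨tr', cnt', H', hH', hF', -, hmerge, rfl⟩ hb hτ
    have hcard' : H'.card ≤ 1 := by
      have : ¬ 2 ≤ H'.card := by simpa [hH'.size] using hb
      lia
    obtain ⟨hroot, v, hfreq⟩ := exists_keyedFreqs_eq_singleton (C := C) hn hF' hcard'
    refine ⟨?_, tr', cnt', v, hroot ▸ hF', hfreq ▸ hmerge⟩
    have := Nat.mul_le_mul_left (3 * unitCost n) hcard
    simp only [RTest.cost, RExpr.cost] at hτ
    lia

end Merge

/-! ### Expanding the trees -/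

section Expand

variable {σ σ' : Mem} {tr : ℕ → FTree n} {cnt k : ℕ}

/-- The pairs of the trees named `k, …, cnt - 1` are known, if the last tree gets all
positions. -/
def PlacedFrom (σ : Mem) (tr : ℕ → FTree n) (cnt k : ℕ) : Prop :=
  ∀ i, k ≤ i → i < cnt → ∃ p q : ℕ, σ.arr start i = p ∧ σ.arr period i = q ∧
    ∀ i' p' q', Places (tr i) p q i' p' q' → Places (tr (cnt - 1)) 0 1 i' p' q'

theorem PlacedFrom.step (h : PlacedFrom σ tr cnt (k + 1)) (hk : HasParent σ tr cnt k)
    (hstart : ∀ i, σ'.arr start i = if i = k then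
      σ.arr start ⌊σ.arr parent k⌋₊ + σ.arr childIndex k * σ.arr period ⌊σ.arr parent k⌋₊
      else σ.arr start i)
    (hperiod : ∀ i, σ'.arr period i = if i = k then
      σ.arr childCount ⌊σ.arr parent k⌋₊ * σ.arr period ⌊σ.arr parent k⌋₊
      else σ.arr period i) : PlacedFrom σ' tr cnt k := by
  intro i hki hi
  rcases hki.eq_or_lt with rfl | hki
  · obtain ⟨t, m, child, l, hkt, ht, hparent, hindex, hcount, hnode, hchild⟩ := hk
    obtain ⟨p, q, hp, hq, hplaces⟩ := h t hkt ht
    refine ⟨p + l * q, m * q, ?_, ?_, fun i' p' q' hi' => hplaces i' p' q' ?_⟩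
    · simp [hstart, hparent, hindex, hp, hq]
    · simp [hperiod, hparent, hcount, hq]
    · rw [hnode]
      exact .node l (hchild ▸ hi')
  · rw [hstart, hperiod, if_neg hki.ne', if_neg hki.ne']
    exact h i hki hi

theorem PlacedFrom.exists_pairs (h : PlacedFrom σ tr cnt 0) (hF : HoldsForest σ' tr cnt {cnt - 1}) :
    ∃ p q : Fin n → ℕ, HoldsPairs σ p q ∧ ∀ i, Places (tr (cnt - 1)) 0 1 i (p i) (q i) := by
  have hitem : ∀ i : Fin n, ∃ p q : ℕ, σ.arr start i = p ∧ σ.arr period i = q ∧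
      Places (tr (cnt - 1)) 0 1 i p q := by
    intro i
    obtain ⟨p, q, hp, hq, hplaces⟩ := h i (Nat.zero_le _) (i.2.trans_le hF.le)
    exact ⟨p, q, hp, hq, hplaces _ _ _ (hF.leaf i ▸ .leaf i p q)⟩
  choose p q hp hq hplaces using hitem
  exact ⟨p, q, fun i => ⟨hp i, hq i⟩, hplaces⟩

/-- Compute the pair of the next tree from the one of its parent. -/
def expandNext : Prog :=
  counter ≔ reg counter - 1 ;;
  parentNode ≔ cell parent (reg counter) ;;
  .setCell start (reg counter) (cell start (reg parentNode) +
    cell childIndex (reg counter) * cell period (reg parentNode)) ;;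
  .setCell period (reg counter) (cell childCount (reg parentNode) * cell period (reg parentNode))

theorem expandNext_spec (hcounter : σ.reg counter = (k + 1 : ℕ)) (hk : HasParent σ tr cnt k)
    (h : PlacedFrom σ tr cnt (k + 1)) :
    Runs expandNext σ fun σ' τ => τ ≤ 35 ∧ σ'.reg counter = k ∧ PlacedFrom σ' tr cnt k := by
  have hpred : σ.reg counter - 1 = k := by simp [hcounter]
  unfold expandNext
  repeat' first | apply Runs.seq | apply Runs.setReg | apply Runs.setCell
  obtain ⟨t, _, _, _, _, _, hparent, _⟩ := id hk
  refine ⟨by simp, by simp [hpred], h.step hk (fun i => ?_) fun i => ?_⟩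
  · simp [hpred]
  · simp [hpred, hparent]

/-- Expand the trees: compute the pairs of all trees from those of their parents. -/
def expandProg : Prog :=
  counter ≔ reg nodeCount - 1 ;;
  .setCell start (reg counter) 0 ;;
  .setCell period (reg counter) 1 ;;
  .loop (.le 1 (reg counter)) expandNext

theorem expandProg_spec (hF : HoldsForest σ tr cnt {cnt - 1}) :
    Runs expandProg σ fun σ' τ => τ ≤ 80 * n + 50 ∧ ∃ p q : Fin n → ℕ, HoldsPairs σ' p q ∧
      ∀ i, Places (tr (cnt - 1)) 0 1 i (p i) (q i) := by
  have hcnt := hF.card_le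
  have hlast : cnt - 1 < cnt := hF.root_lt _ (Multiset.mem_singleton_self _)
  rw [Multiset.card_singleton] at hcnt
  have hlast_eq : σ.reg nodeCount - 1 = (cnt - 1 : ℕ) := by
    rw [hF.size, Nat.cast_sub (by lia), Nat.cast_one]
  unfold expandProg
  repeat' first | apply Runs.seq | apply Runs.setReg | apply Runs.setCell
  refine Runs.loop (fun σ' B => ∃ k < cnt, σ'.reg counter = k ∧ HoldsForest σ' tr cnt {cnt - 1} ∧
    PlacedFrom σ' tr cnt k ∧ B = 40 * k) (40 * (cnt - 1)) ?_ ?_ ?_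
  · refine ⟨cnt - 1, hlast, by simp [hlast_eq],
      hF.congr (by simp) (by funext; simp) (by funext; simp) (by funext; simp), ?_, rfl⟩
    intro i hi hicnt
    obtain rfl : i = cnt - 1 := by lia
    refine ⟨0, 1, ?_, ?_, fun _ _ _ h => h⟩ <;> simp [hlast_eq, -Nat.cast_pred]
  · rintro σ₁ B ⟨k, hk, hcounter, hF₁, hplaced, rfl⟩ hb
    have hk1 : 1 ≤ k := by simpa [hcounter] using hb
    obtain ⟨k, rfl⟩ := Nat.exists_eq_add_of_le' hk1
    have hparent : HasParent σ₁ tr cnt k := (hF₁.root_or_hasParent k (by lia)).resolve_left <| by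
      rw [Multiset.mem_singleton]
      lia
    refine (expandNext_spec hcounter hparent hplaced).frame.mono
      fun σ₂ τ₂ ⟨hfr, hτ, hcounter₂, hplaced₂⟩ => ⟨_, ⟨k, by lia, hcounter₂, hF₁.congr
        (hfr.reg _ rfl) (hfr.arr _ rfl) (hfr.arr _ rfl) (hfr.arr _ rfl), hplaced₂, rfl⟩, ?_⟩
    simp
    lia
  · rintro σ' τ B' ⟨k, -, hcounter, hF', hplaced, rfl⟩ hb hτ
    obtain rfl : k = 0 := by simpa [hcounter] using hb
    simp only [RTest.cost, RExpr.cost] at hτ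
    exact ⟨by simp; lia, hplaced.exists_pairs hF'⟩

end Expand

/-! ### The frequencies of the items -/

section Parameters

variable {σ : Mem} {c lo : ℕ}

/-- Compute the sum `H` of the growth rates. -/
def sumRates : Prog :=
  rateSum ≔ 0 ;;
  counter ≔ 0 ;;
  .loop (.lt (reg counter) (reg itemCount)) (
    rateSum ≔ reg rateSum + cell rate (reg counter) ;;
    counter ≔ reg counter + 1)

theorem sumRates_spec {h : Fin n → ℝ} (hn : σ.reg itemCount = n)
    (hrate : ∀ i : Fin n, σ.arr rate i = h i) :
    Runs sumRates σ fun σ' τ => τ ≤ 20 * n + 10 ∧ σ'.reg rateSum = ∑ i, h i := by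
  unfold sumRates
  iterate 2
    apply Runs.seq
    apply Runs.setReg
  refine Runs.loop (fun σ' B => ∃ s ≤ n, σ'.reg counter = s ∧ σ'.reg itemCount = n ∧
    σ'.arr = σ.arr ∧ σ'.reg rateSum = ∑ i ∈ Finset.range s, σ.arr rate i ∧ B = 20 * (n - s))
    (20 * n) ⟨0, n.zero_le, by simp, by simpa using hn, rfl, by simp, rfl⟩ ?_ ?_
  · rintro σ₁ B ⟨s, -, hs, hn, harr, hsum, rfl⟩ hb
    have hsn : s < n := by simpa only [RTest.holds_lt, eval, hs, hn, Nat.cast_lt] using hb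
    repeat' first | apply Runs.seq | apply Runs.setReg
    refine ⟨_, ⟨s + 1, hsn, by simp [hs], by simp [hn], by simp [harr], ?_, rfl⟩, ?_⟩
    · simp [hsum, hs, harr, Finset.sum_range_succ]
    · simp
      lia
  · rintro σ₁ τ B ⟨s, hs_le, hs, hn, -, hsum, rfl⟩ hb hτ
    have hns : n ≤ s := by
      simpa only [RTest.holds_lt, eval, hs, hn, Nat.cast_lt, not_lt] using hb
    obtain rfl : s = n := by lia
    simp only [RTest.cost_lt, RExpr.cost] at hτ
    refine ⟨by simp; lia, ?_⟩
    rw [hsum, Finset.sum_range]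
    exact Finset.sum_congr rfl fun i _ => hrate i

/-- Compute `C = 2 ^ c` from `c = ⌊lo / 2⌋`. -/
def setGroups : Prog :=
  groups ≔ 1 ;;
  counter ≔ reg halfMinLayer ;;
  .loop (.le 1 (reg counter)) (
    groups ≔ 2 * reg groups ;;
    counter ≔ reg counter - 1)

theorem setGroups_spec (hhalf : σ.reg halfMinLayer = c) :
    Runs setGroups σ fun σ' τ => τ ≤ 20 * c + 10 ∧ σ'.reg groups = (2 ^ c : ℕ) := by
  unfold setGroups
  iterate 2
    apply Runs.seq
    apply Runs.setReg
  refine Runs.loop (fun σ' B => ∃ s : ℕ, σ'.reg counter = s ∧ σ'.reg groups * 2 ^ s = 2 ^ c ∧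
    B = 20 * s) (20 * c) ⟨c, by simpa using hhalf, by simp, rfl⟩ ?_ ?_
  · rintro σ₁ B ⟨s, hs, hpow, rfl⟩ hb
    have hs1 : 1 ≤ s := by simpa [hs] using hb
    obtain ⟨s, rfl⟩ := Nat.exists_eq_add_of_le' hs1
    repeat' first | apply Runs.seq | apply Runs.setReg
    refine ⟨_, ⟨s, by simp [hs], ?_, rfl⟩, ?_⟩
    · rw [← hpow, pow_succ]
      simp
      ring
    · simp
      lia
  · rintro σ₁ τ B ⟨s, hs, hpow, rfl⟩ hb hτ
    obtain rfl : s = 0 := by simpa [hs] using hb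
    simp only [RTest.cost, RExpr.cost] at hτ
    exact ⟨by simp; lia, by simpa using hpow⟩

theorem floor_log_div_log_two {x : ℝ} {k : ℤ} (hl : (2 : ℝ) ^ k ≤ x) (hu : x < 2 ^ (k + 1)) :
    ⌊Real.log x / Real.log 2⌋ = k := by
  have h2 : 0 < Real.log 2 := Real.log_pos one_lt_two
  have hpow : (0 : ℝ) < 2 ^ k := by positivity
  have hlog_l := Real.log_le_log hpow hl
  have hlog_u := Real.log_lt_log (hpow.trans_le hl) hu
  rw [Real.log_zpow] at hlog_l hlog_u
  rw [Int.floor_eq_iff, le_div_iff₀ h2, div_lt_iff₀ h2]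
  exact ⟨hlog_l, by exact_mod_cast hlog_u⟩

/-- Compute `(1 + δ) H`, `lo`, `⌊lo / 2⌋` and `C`. -/
def initProg : Prog :=
  sumRates ;;
  scaledSum ≔ (1 + 3 * .sqrt (cell rate 0 / reg rateSum)) * reg rateSum ;;
  minLayer ≔ .floor (.log (reg scaledSum / cell rate 0) / .log 2) ;;
  halfMinLayer ≔ .floor (reg minLayer / 2) ;;
  setGroups

theorem initProg_spec (hn : 0 < n) (h : Fin n → ℝ)
    (hlo : (2 : ℝ) ^ lo ≤ initialFreq hn h ⟨0, hn⟩)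
    (hlo_succ : initialFreq hn h ⟨0, hn⟩ < (2 : ℝ) ^ (lo + 1)) :
    Runs initProg (inputMem h) fun σ' τ => τ ≤ 20 * n + 20 * lo + 100 ∧
      σ'.reg scaledSum = (1 + delta hn h) * ∑ j, h j ∧ HoldsGrid σ' (lo / 2) lo := by
  refine Runs.seq_of_spec (sumRates_spec (h := h) (by simp [inputMem]) (by simp [inputMem]))
    fun σ₁ τ₁ hfr₁ ⟨hτ₁, hsum⟩ => ?_
  have hrate : σ₁.arr rate 0 = h ⟨0, hn⟩ := by
    rw [hfr₁.arr rate rfl]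
    simp [inputMem, hn]
  have hscaled : (1 + 3 * √(h ⟨0, hn⟩ / σ₁.reg rateSum)) * σ₁.reg rateSum =
      (1 + delta hn h) * ∑ j, h j := by
    rw [hsum, delta]
  have hfloor : ⌊Real.log ((1 + delta hn h) * (∑ j, h j) / h ⟨0, hn⟩) / Real.log 2⌋ = lo :=
    floor_log_div_log_two (by exact_mod_cast hlo) (by exact_mod_cast hlo_succ)
  have hhalf : ((⌊(lo : ℝ) / 2⌋ : ℤ) : ℝ) = (lo / 2 : ℕ) := by
    rw [← natCast_floor_eq_intCast_floor (by positivity), Nat.floor_div_ofNat, Nat.floor_natCast]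
  iterate 3
    apply Runs.seq
    apply Runs.setReg
  refine (setGroups_spec (c := lo / 2) ?_).frame.mono fun σ₂ τ₂ ⟨hfr₂, hτ₂, hgroups⟩ =>
    ⟨?_, ?_, ⟨?_, hgroups, ?_⟩⟩
  · simp [hrate, hscaled, hfloor, hhalf]
  · simp
    lia
  · simp [hfr₂.reg scaledSum rfl, hrate, hscaled]
  · simp [hfr₂.reg minLayer rfl, hscaled, hrate, hfloor]
  · simp [hfr₂.reg halfMinLayer rfl, hscaled, hrate, hfloor, hhalf]

end Parameters

section Keys

variable {σ : Mem} {c d j : ℕ} {x y : ℝ}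

/-- The state of a bisection for the largest `j` with `log (1 + j / C) ≤ y`, for `C = 2 ^ c`: the
result is at least `j` and less than `j + 2 ^ d`. -/
structure GroupSearch (σ : Mem) (c : ℕ) (y : ℝ) (j d : ℕ) : Prop where
  group_eq : σ.reg group = j
  stride_eq : σ.reg stride = (2 ^ d : ℕ)
  groups_eq : σ.reg groups = (2 ^ c : ℕ)
  logRest_eq : σ.reg logRest = y
  le : j + 2 ^ d ≤ 2 ^ c
  lower : Real.log (1 + (j : ℝ) / (2 ^ c : ℕ)) ≤ y
  upper : y < Real.log (1 + ((j : ℝ) + (2 ^ d : ℕ)) / (2 ^ c : ℕ))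

/-- Halve the interval of the bisection. -/
def halveStride : Prog :=
  stride ≔ reg stride / 2 ;;
  .ite (.le (.log (1 + (reg group + reg stride) / reg groups)) (reg logRest))
    (group ≔ reg group + reg stride) .skip

theorem halveStride_spec (h : GroupSearch σ c y j (d + 1)) :
    Runs halveStride σ fun σ' τ => τ ≤ 30 ∧ ∃ j', GroupSearch σ' c y j' d := by
  have hstride : σ.reg stride / 2 = (2 ^ d : ℕ) := by simp [h.stride_eq, pow_succ]
  have hle := h.le
  have hupper := h.upper
  have hgroup := h.group_eq
  have hgroups := h.groups_eq
  have hrest := h.logRest_eq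
  rw [pow_succ, mul_two] at hle hupper
  push_cast at hupper
  apply Runs.seq
  apply Runs.setReg
  apply Runs.ite
  · intro hb
    have hb' : Real.log (1 + ((j : ℝ) + (2 ^ d : ℕ)) / (2 ^ c : ℕ)) ≤ y := by
      simpa [hstride, hgroup, hgroups, hrest] using hb
    apply Runs.setReg
    refine ⟨by simp, j + 2 ^ d, by simp [hgroup, hstride], by simp [hstride], by simp [hgroups],
      by simp [hrest], by lia, by exact_mod_cast hb', ?_⟩
    push_cast
    rwa [add_assoc]
  · intro hb
    have hb' : y < Real.log (1 + ((j : ℝ) + (2 ^ d : ℕ)) / (2 ^ c : ℕ)) := by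
      simpa [hstride, hgroup, hgroups, hrest] using hb
    apply Runs.skip
    exact ⟨by simp, j, by simp [hgroup], by simp [hstride], by simp [hgroups], by simp [hrest],
      by lia, h.lower, hb'⟩

/-- Find the largest `j < C` with `log (1 + j / C)` at most the value of `logRest`. -/
def findGroup : Prog :=
  group ≔ 0 ;;
  stride ≔ reg groups ;;
  .loop (.le 2 (reg stride)) halveStride

theorem findGroup_spec (hgroups : σ.reg groups = (2 ^ c : ℕ)) (hrest : σ.reg logRest = y)
    (hy0 : 0 ≤ y) (hy : y < Real.log 2) :
    Runs findGroup σ fun σ' τ => τ ≤ 40 * c + 10 ∧ ∃ j : ℕ, j < 2 ^ c ∧ σ'.reg group = j ∧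
      Real.log (1 + (j : ℝ) / (2 ^ c : ℕ)) ≤ y ∧
      y < Real.log (1 + ((j : ℝ) + 1) / (2 ^ c : ℕ)) := by
  unfold findGroup
  iterate 2
    apply Runs.seq
    apply Runs.setReg
  refine Runs.loop (fun σ' B => ∃ j d, GroupSearch σ' c y j d ∧ B = 40 * d) (40 * c)
    ⟨0, c, ⟨by simp, by simp [hgroups], by simp [hgroups], by simp [hrest], by simp, by simpa,
      ?_⟩, rfl⟩ ?_ ?_
  · have hC : ((2 ^ c : ℕ) : ℝ) ≠ 0 := by positivity
    rwa [Nat.cast_zero, zero_add, div_self hC, one_add_one_eq_two]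
  · rintro σ₁ B ⟨j, d, h, rfl⟩ hb
    have hd : d ≠ 0 := by
      rintro rfl
      simp [h.stride_eq] at hb
    obtain ⟨d, rfl⟩ := Nat.exists_eq_succ_of_ne_zero hd
    refine (halveStride_spec h).mono fun σ₂ τ₂ ⟨hτ, j', h'⟩ => ⟨_, ⟨j', d, h', rfl⟩, ?_⟩
    simp
    lia
  · rintro σ₁ τ B ⟨j, d, h, rfl⟩ hb hτ
    have hlt : 2 ^ d < 2 := by
      have : ((2 ^ d : ℕ) : ℝ) < (2 : ℕ) := by simpa [h.stride_eq] using hb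
      exact_mod_cast this
    obtain rfl : d = 0 := by
      rw [← Nat.lt_one_iff, ← Nat.pow_lt_pow_iff_right one_lt_two, pow_one]
      exact hlt
    simp only [RTest.cost, RExpr.cost] at hτ
    have hle := h.le
    exact ⟨by simp; lia, j, by simpa using hle, h.group_eq, h.lower, by simpa using h.upper⟩

theorem gridVal_le_of_log_le (hx : 0 < x) (hj : j < 2 ^ c) {k : ℤ}
    (h : Real.log (1 + (j : ℝ) / (2 ^ c : ℕ)) ≤ Real.log x - k * Real.log 2) :
    gridVal (2 ^ c) (k * (2 ^ c : ℕ) + j) ≤ x := by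
  have hpow : (0 : ℝ) < 2 ^ k := by positivity
  have hpos : (0 : ℝ) < 1 + (j : ℝ) / (2 ^ c : ℕ) := by positivity
  rw [gridVal_mul_add (by lia) (by exact_mod_cast hj), Int.cast_natCast,
    ← Real.log_le_log_iff (by positivity) hx, Real.log_mul hpow.ne' hpos.ne', Real.log_zpow]
  linarith

theorem lt_gridVal_of_lt_log (hx : 0 < x) (hj : j < 2 ^ c) {k : ℤ}
    (h : Real.log x - k * Real.log 2 < Real.log (1 + ((j : ℝ) + 1) / (2 ^ c : ℕ))) :
    x < gridVal (2 ^ c) (k * (2 ^ c : ℕ) + j + 1) := by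
  have hpow : (0 : ℝ) < 2 ^ k := by positivity
  have hpos : (0 : ℝ) < 1 + ((j : ℝ) + 1) / (2 ^ c : ℕ) := by positivity
  rw [gridVal_mul_add_succ (by lia) (by exact_mod_cast hj), Int.cast_natCast,
    ← Real.log_lt_log_iff hx (by positivity), Real.log_mul hpow.ne' hpos.ne', Real.log_zpow]
  linarith

/-- Compute the layer and the group of the frequency of the current item. -/
def computeKey : Prog :=
  logRest ≔ .log (reg scaledSum / cell rate (reg counter)) ;;
  layer ≔ .floor (reg logRest / .log 2) ;;
  logRest ≔ reg logRest - reg layer * .log 2 ;;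
  findGroup

theorem computeKey_spec {i : ℕ} (hx : 0 < x) (hi : σ.reg counter = i)
    (hgroups : σ.reg groups = (2 ^ c : ℕ)) (hquot : σ.reg scaledSum / σ.arr rate i = x) :
    Runs computeKey σ fun σ' τ => τ ≤ 40 * c + 40 ∧ ∃ κ : ℤ,
      σ'.reg layer * σ'.reg groups + σ'.reg group = κ ∧
      gridVal (2 ^ c) κ ≤ x ∧ x < gridVal (2 ^ c) (κ + 1) := by
  have h2 : 0 < Real.log 2 := Real.log_pos one_lt_two
  set k : ℤ := ⌊Real.log x / Real.log 2⌋ with hk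
  have hk_le : k * Real.log 2 ≤ Real.log x := (le_div_iff₀ h2).1 (Int.floor_le _)
  have hk_lt : Real.log x < (k + 1) * Real.log 2 := (div_lt_iff₀ h2).1 (Int.lt_floor_add_one _)
  iterate 3
    apply Runs.seq
    apply Runs.setReg
  refine (findGroup_spec (c := c) (y := Real.log x - k * Real.log 2) (by simp [hgroups])
    (by simp [hi, hquot, hk]) (by linarith) (by linarith)).frame.mono
    fun σ₁ τ₁ ⟨hfr, hτ, j, hj, hgroup, hlower, hupper⟩ => ⟨?_, k * (2 ^ c : ℕ) + j, ?_,
      gridVal_le_of_log_le hx hj hlower, lt_gridVal_of_lt_log hx hj hupper⟩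
  · simp
    lia
  · have hlayer : σ₁.reg layer = k := by rw [hfr.reg layer rfl]; simp [hi, hquot, hk]
    have hgroups₁ : σ₁.reg groups = (2 ^ c : ℕ) := by rw [hfr.reg groups rfl]; simp [hgroups]
    rw [hlayer, hgroups₁, hgroup]
    push_cast
    ring

/-- Append the key and the name of the current item to the list. -/
def storeKey : Prog :=
  .setCell listKey (reg counter) (0 - (reg layer * reg groups + reg group)) ;;
  .setCell listName (reg counter) (reg counter) ;;
  counter ≔ reg counter + 1

/-- Compute the keys of the items. -/
def keysProg : Prog :=
  counter ≔ 0 ;;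
  .loop (.lt (reg counter) (reg itemCount)) (computeKey ;; storeKey) ;;
  nodeCount ≔ reg itemCount ;;
  listSize ≔ reg itemCount

/-- The keys of the first `s` items are computed; `x i` is the frequency of item `i` before it is
rounded down to the grid. -/
structure HoldsKeys (σ : Mem) (c : ℕ) (x : Fin n → ℝ) (s : ℕ) : Prop where
  le : s ≤ n
  counter_eq : σ.reg counter = s
  itemCount_eq : σ.reg itemCount = n
  groups_eq : σ.reg groups = (2 ^ c : ℕ)
  quotient : ∀ i : Fin n, σ.reg scaledSum / σ.arr rate i = x i
  keys : ∀ i : Fin n, (i : ℕ) < s → ∃ κ : ℤ, (σ.arr listKey i, σ.arr listName i) = entry (κ, i) ∧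
    gridVal (2 ^ c) κ ≤ x i ∧ x i < gridVal (2 ^ c) (κ + 1)

theorem HoldsKeys.step {x : Fin n → ℝ} {s : ℕ} (hx : ∀ i, 0 < x i) (h : HoldsKeys σ c x s)
    (hs : s < n) :
    Runs (computeKey ;; storeKey) σ fun σ' τ => τ ≤ 40 * c + 80 ∧ HoldsKeys σ' c x (s + 1) := by
  refine Runs.seq_of_spec (computeKey_spec (hx _) h.counter_eq h.groups_eq (h.quotient ⟨s, hs⟩))
    fun σ₁ τ₁ hfr ⟨hτ, κ, hκ, hlower, hupper⟩ => ?_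
  have hcounter : σ₁.reg counter = s := (hfr.reg counter rfl).trans h.counter_eq
  unfold storeKey
  repeat' first | apply Runs.seq | apply Runs.setReg | apply Runs.setCell
  refine ⟨by simp; lia, hs, by simp [hcounter], ?_, ?_, fun i => ?_, fun i hi => ?_⟩
  · simpa [hfr.reg itemCount rfl] using h.itemCount_eq
  · simpa [hfr.reg groups rfl] using h.groups_eq
  · simpa [hfr.reg scaledSum rfl, hfr.arr rate rfl] using h.quotient i
  · rcases (Nat.lt_succ_iff.1 hi).lt_or_eq with hi | hi
    · obtain ⟨κ', hentry, hbounds⟩ := h.keys i hi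
      refine ⟨κ', ?_, hbounds⟩
      rw [← hentry]
      simp [hcounter, hi.ne, hfr.arr listKey rfl, hfr.arr listName rfl]
    · obtain rfl : i = ⟨s, hs⟩ := Fin.ext hi
      refine ⟨κ, ?_, hlower, hupper⟩
      have hkey : 0 - (σ₁.reg layer * σ₁.reg groups + σ₁.reg group) = -(κ : ℝ) := by
        rw [hκ, zero_sub]
      simpa [entry, hcounter] using hkey

theorem keysProg_spec {x : Fin n → ℝ} (hx : ∀ i, 0 < x i) (hn : σ.reg itemCount = n)
    (hgroups : σ.reg groups = (2 ^ c : ℕ))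
    (hquot : ∀ i : Fin n, σ.reg scaledSum / σ.arr rate i = x i) :
    Runs keysProg σ fun σ' τ => τ ≤ n * (40 * c + 100) + 50 ∧ σ'.reg nodeCount = n ∧
      ∃ κ : Fin n → ℤ, (∀ i, gridVal (2 ^ c) (κ i) ≤ x i ∧ x i < gridVal (2 ^ c) (κ i + 1)) ∧
        HoldsList σ' (Finset.univ.val.map fun i => (κ i, (i : ℕ))) := by
  apply Runs.seq
  apply Runs.setReg
  apply Runs.seq
  refine Runs.loop (fun σ' B => ∃ s, HoldsKeys σ' c x s ∧ B = (n - s) * (40 * c + 100))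
    (n * (40 * c + 100))
    ⟨0, ⟨n.zero_le, by simp, by simpa, by simpa using hgroups, by simpa, by simp⟩, rfl⟩ ?_ ?_
  · rintro σ₁ B ⟨s, h, rfl⟩ hb
    have hs : s < n := by
      simpa only [RTest.holds_lt, eval, h.counter_eq, h.itemCount_eq, Nat.cast_lt] using hb
    refine (h.step hx hs).mono fun σ₂ τ₂ ⟨hτ, h'⟩ => ⟨_, ⟨s + 1, h', rfl⟩, ?_⟩
    rw [show n - s = n - (s + 1) + 1 by lia, add_mul]
    simp
    lia
  · rintro σ₁ τ B ⟨s, h, rfl⟩ hb hτ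
    have hns : n ≤ s := by
      simpa only [RTest.holds_lt, eval, h.counter_eq, h.itemCount_eq, Nat.cast_lt, not_lt] using hb
    obtain rfl : s = n := h.le.antisymm hns
    choose κ hentry hbounds using fun i : Fin s => h.keys i i.2
    repeat' first | apply Runs.seq | apply Runs.setReg
    simp only [RTest.cost_lt, RExpr.cost] at hτ
    refine ⟨by simp; lia, by simp [h.itemCount_eq], κ, hbounds, by simp [h.itemCount_eq], ?_⟩
    rw [Multiset.map_map, Multiset.card_map, Finset.card_val, Finset.card_univ, Fintype.card_fin,
      ← map_univ_fin_eq_map_range]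
    exact Multiset.map_congr rfl fun i _ => by simpa using hentry i

end Keys

/-! ### The Main Algorithm -/

theorem isGreatest_setOf_two_pow_le {x : ℝ} {m : ℕ} (hle : (2 : ℝ) ^ m ≤ x)
    (hlt : x < (2 : ℝ) ^ (m + 1)) : IsGreatest {k : ℕ | (2 : ℝ) ^ k ≤ x} m :=
  ⟨hle, fun _ hk => Nat.lt_succ_iff.1 <|
    (pow_lt_pow_iff_right₀ (one_lt_two (α := ℝ))).1 (lt_of_le_of_lt hk hlt)⟩

theorem isLeast_setOf_lt_two_pow_succ {x : ℝ} {m : ℕ} (hle : (2 : ℝ) ^ m ≤ x)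
    (hlt : x < (2 : ℝ) ^ (m + 1)) : IsLeast {k : ℕ | x < (2 : ℝ) ^ (k + 1)} m :=
  ⟨hlt, fun _ hk => Nat.lt_succ_iff.1 <|
    (pow_lt_pow_iff_right₀ (one_lt_two (α := ℝ))).1 (lt_of_le_of_lt hle hk)⟩

section InitialFreq

variable {h : Fin n → ℝ}

theorem delta_nonneg (hn : 0 < n) (h : Fin n → ℝ) : 0 ≤ delta hn h := by
  unfold delta
  positivity

theorem one_le_initialFreq (hn : 0 < n) (hpos : ∀ i, 0 < h i) (i : Fin n) :
    1 ≤ initialFreq hn h i := by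
  have hsum : h i ≤ ∑ j, h j :=
    Finset.single_le_sum (fun j _ => (hpos j).le) (Finset.mem_univ i)
  rw [initialFreq, one_le_div (hpos i)]
  nlinarith [delta_nonneg hn h, hpos i]

theorem initialFreq_monotone (hn : 0 < n) (hpos : ∀ i, 0 < h i) (hanti : Antitone h) :
    Monotone (initialFreq hn h) := fun i j hij => by
  have hδ := delta_nonneg hn h
  have hsum : 0 ≤ ∑ j, h j := Finset.sum_nonneg fun i _ => (hpos i).le
  exact div_le_div_of_nonneg_left (by positivity) (hpos j) (hanti hij)

theorem initialFreq_zero_le (hn : 0 < n) (hpos : ∀ i, 0 < h i) (hanti : Antitone h) :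
    initialFreq hn h ⟨0, hn⟩ ≤ 4 * n := by
  have hle : h ⟨0, hn⟩ ≤ ∑ j, h j :=
    Finset.single_le_sum (fun j _ => (hpos j).le) (Finset.mem_univ _)
  have hsum : ∑ j, h j ≤ n * h ⟨0, hn⟩ := by
    simpa using Finset.sum_le_card_nsmul Finset.univ h (h ⟨0, hn⟩)
      fun i _ => hanti (Fin.mk_le_mk.2 (Nat.zero_le _))
  have hδ : delta hn h ≤ 3 := by
    have := Real.sqrt_le_one.2 (div_le_one_of_le₀ hle ((hpos _).le.trans hle))
    rw [delta]
    linarith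
  rw [initialFreq, div_le_iff₀ (hpos _)]
  nlinarith [hpos ⟨0, hn⟩]

theorem le_log_add_two (hn : 0 < n) {lo : ℕ} (hlo : (2 : ℝ) ^ lo ≤ 4 * n) :
    lo ≤ Nat.log 2 n + 2 := by
  have hpow : 2 ^ lo ≤ n * 2 * 2 := by
    rw [mul_assoc, mul_comm]
    exact_mod_cast hlo
  have := Nat.le_log_of_pow_le one_lt_two hpow
  rwa [Nat.log_mul_base one_lt_two (by positivity), Nat.log_mul_base one_lt_two hn.ne'] at this

end InitialFreq

section Rounding

variable {C lo hi : ℕ} {κ : ℤ} {x : ℝ}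

theorem gridVal_mul (hC : 0 < C) (k : ℕ) : gridVal C (k * C) = 2 ^ k := by
  simpa using gridVal_mul_add (k := k) le_rfl (Int.natCast_pos.2 hC)

theorem mul_le_of_two_pow_le (hC : 0 < C) (hx : (2 : ℝ) ^ lo ≤ x) (hκ : x < gridVal C (κ + 1)) :
    lo * C ≤ κ := by
  rw [← gridVal_mul hC] at hx
  exact Int.lt_add_one_iff.1 ((gridVal_strictMono hC).lt_iff_lt.1 (hx.trans_lt hκ))

theorem lt_mul_of_lt_two_pow (hC : 0 < C) (hx : x < (2 : ℝ) ^ hi) (hκ : gridVal C κ ≤ x) :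
    κ < hi * C := by
  rw [← gridVal_mul hC] at hx
  exact (gridVal_strictMono hC).lt_iff_lt.1 (hκ.trans_lt hx)

theorem isGreatest_gridVal (hC : 0 < C) (hlo : lo * C ≤ κ) (hle : gridVal C κ ≤ x)
    (hlt : x < gridVal C (κ + 1)) :
    IsGreatest {y : ℝ | y ≤ x ∧ ∃ k j : ℕ, lo ≤ k ∧ j < C ∧ y = gridFreq C k j}
      (gridVal C κ) := by
  refine ⟨⟨hle, (κ / C).toNat, (κ % C).toNat, ?_⟩, ?_⟩
  · have hmod := Int.emod_nonneg κ (show (C : ℤ) ≠ 0 by lia)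
    have hmod_lt := Int.emod_lt_of_pos κ (show (0 : ℤ) < C by lia)
    have hdiv : (lo : ℤ) ≤ κ / C := (Int.le_ediv_iff_mul_le (by lia)).2 hlo
    refine ⟨by lia, by lia, ?_⟩
    rw [gridFreq_eq_gridVal (by lia), Int.toNat_of_nonneg (by lia), Int.toNat_of_nonneg hmod,
      Int.ediv_mul_add_emod]
  · rintro y ⟨hy, k, j, -, hj, rfl⟩
    rw [gridFreq_eq_gridVal hj] at hy ⊢
    exact (gridVal_strictMono hC).monotone
      (Int.lt_add_one_iff.1 ((gridVal_strictMono hC).lt_iff_lt.1 (hy.trans_lt hlt)))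

end Rounding

section Steps

variable {C lo hi : ℕ} {S₀ S : Freqs n}

theorem StepsDown.exists_step3_step4 (hC : 0 < C) (hlo : lo ≤ hi)
    (h : StepsDown (KeyStep false C lo) ((hi + 1 : ℕ) * C - 1) S₀ (lo * C - 1) S) :
    ∃ S₃, Step3 lo hi C S₀ S₃ ∧ Step4 lo C S₃ S := by
  have hall := h.forEach_of_keyStep hC
    (G := fun k j => CombineAll (if k = lo then C + j else 2) (gridFreq C k j))
    fun k j S S' _ _ _ S₁ hS₁ hS' => by simpa [hS'] using hS₁
  rw [downTo_eq_append hlo] at hall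
  obtain ⟨S₃, hhigh, S', hlow, rfl⟩ := hall.exists_of_append
  refine ⟨S₃, hhigh.imp fun k hk _ _ hS => hS.imp fun j _ _ _ hS => ?_,
    hlow.imp fun j _ _ _ hS => ?_⟩
  · rwa [if_neg (Nat.ne_of_gt (mem_downTo.1 hk).1)] at hS
  · rwa [if_pos rfl] at hS

theorem StepsDown.step5 (hC : 0 < C)
    (h : StepsDown (KeyStep true C lo) ((hi + 1 : ℕ) * C - 1) S₀ (lo * C - 1) S) :
    Step5 lo hi C S₀ S :=
  h.forEach_of_keyStep hC fun _ _ _ _ _ _ _ S₁ hS₁ hS' => ⟨S₁, hS₁, by simpa using hS'⟩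

end Steps

section Programs

variable {σ : Mem} {c lo hi cnt : ℕ} {tr : ℕ → FTree n} {L : Multiset (ℤ × ℕ)}

/-- The trees of the initial frequencies: the name `i < n` is that of the leaf `i`. -/
def leafTree (hn : 0 < n) (i : ℕ) : FTree n := .leaf ⟨i % n, Nat.mod_lt i hn⟩

theorem leafTree_val (hn : 0 < n) (i : Fin n) : leafTree hn i = .leaf i := by
  simp [leafTree, Nat.mod_eq_of_lt i.2]

/-- The keys of the initial frequencies and the names of their trees. -/
def initialKeys (κ : Fin n → ℤ) : Multiset (ℤ × ℕ) :=
  Finset.univ.val.map fun i => (κ i, (i : ℕ))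

theorem map_snd_initialKeys (κ : Fin n → ℤ) :
    (initialKeys κ).map Prod.snd = Multiset.range n := by
  rw [initialKeys, Multiset.map_map]
  simpa using map_univ_fin_eq_map_range n fun i => i

theorem keyedFreqs_initialKeys (hn : 0 < n) (C : ℕ) (κ : Fin n → ℤ) :
    keyedFreqs C (leafTree hn) (initialKeys κ) =
      Finset.univ.val.map fun i => (gridVal C (κ i), FTree.leaf i) := by
  simp only [keyedFreqs, initialKeys, Multiset.map_map, Function.comp_def, leafTree_val]

theorem holdsForest_range (hn : 0 < n) (hcnt : σ.reg nodeCount = n) :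
    HoldsForest σ (leafTree hn) n (Multiset.range n) where
  size := hcnt
  leaf := leafTree_val hn
  le := le_rfl
  root_lt _ := Multiset.mem_range.1
  nodup := Multiset.nodup_range n
  root_or_hasParent _ hi := .inl (Multiset.mem_range.2 hi)
  card_le := by rw [Multiset.card_range, two_mul]

theorem holdsHeap_zero (hsize : σ.reg heapSize = 0) : HoldsHeap σ 0 :=
  ⟨by simpa using hsize, rfl, fun _ _ hi => absurd hi (Nat.not_lt_zero _)⟩

/-- Steps 1 and 2. -/
def roundProg : Prog := initProg ;; keysProg

theorem roundProg_spec (hn : 0 < n) {h : Fin n → ℝ} (hpos : ∀ i, 0 < h i) (hanti : Antitone h)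
    (hlo : (2 : ℝ) ^ lo ≤ initialFreq hn h ⟨0, hn⟩)
    (hlo_succ : initialFreq hn h ⟨0, hn⟩ < (2 : ℝ) ^ (lo + 1)) :
    Runs roundProg (inputMem h) fun σ' τ => τ ≤ unitCost n * n ∧ ∃ κ : Fin n → ℤ,
      (∀ i, gridVal (2 ^ (lo / 2)) (κ i) ≤ initialFreq hn h i ∧
        initialFreq hn h i < gridVal (2 ^ (lo / 2)) (κ i + 1)) ∧
      HoldsFreqs (lo / 2) lo σ' (leafTree hn) n 0 0 (initialKeys κ) := by
  have hlog := le_log_add_two hn (hlo.trans (initialFreq_zero_le hn hpos hanti))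
  refine Runs.seq_of_spec (initProg_spec hn h hlo hlo_succ) fun σ₁ τ₁ hfr₁ ⟨hτ₁, hscaled, hG⟩ => ?_
  refine (keysProg_spec (x := initialFreq hn h) ?_ ?_ hG.groups_eq ?_).frame.mono
    fun σ₂ τ₂ ⟨hfr₂, hτ₂, hcnt, κ, hκ, hL⟩ => ⟨?_, κ, hκ, ⟨?_, ?_, ?_, hL, ?_⟩⟩
  · exact fun i => one_pos.trans_le (one_le_initialFreq hn hpos i)
  · simpa [inputMem] using hfr₁.reg itemCount rfl
  · intro i
    rw [hscaled, hfr₁.arr rate rfl]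
    simp [inputMem, initialFreq]
  · have hc : 40 * (lo / 2) ≤ 20 * Nat.log 2 n + 40 := by lia
    unfold unitCost
    nlinarith
  · exact hG.congr (hfr₂.reg minLayer rfl) (hfr₂.reg groups rfl) (hfr₂.reg halfMinLayer rfl)
  · exact holdsHeap_zero (by rw [hfr₂.reg heapSize rfl, hfr₁.reg heapSize rfl]; simp [inputMem])
  · exact .zero (by rw [hfr₂.reg batchSize rfl, hfr₁.reg batchSize rfl]; simp [inputMem])
  · rw [zero_add, zero_add, map_snd_initialKeys]
    exact holdsForest_range hn hcnt

/-- Steps 3, 4 and 5. -/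
def combineProg : Prog := descentPhase 0 ;; descentPhase 1

theorem combineProg_spec (hn : 0 < n) (hlo : lo ≤ hi) (h : HoldsFreqs c lo σ tr cnt 0 0 L)
    (hL : ∀ x ∈ L, x.1 < (hi + 1 : ℕ) * (2 ^ c : ℕ)) :
    Runs combineProg σ fun σ' τ => τ ≤ 21 * unitCost n * n ∧ ∃ tr' cnt' L' S₃ S₄,
      HoldsFreqs c lo σ' tr' cnt' 0 0 L' ∧ Step3 lo hi (2 ^ c) (keyedFreqs (2 ^ c) tr L) S₃ ∧
      Step4 lo (2 ^ c) S₃ S₄ ∧ Step5 lo hi (2 ^ c) S₄ (keyedFreqs (2 ^ c) tr' L') := by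
  have hlo' : (lo : ℤ) * (2 ^ c : ℕ) - 1 ≤ (hi + 1 : ℕ) * (2 ^ c : ℕ) - 1 := by
    gcongr
    lia
  refine Runs.seq_of_spec (descentPhase_spec (push := false) (by simp) h
    (fun x hx => Int.le_sub_one_of_lt (hL x hx)) hlo')
    fun σ₁ τ₁ _ ⟨hτ₁, tr₁, cnt₁, L₁, h₁, hL₁, hsteps₁⟩ => ?_
  refine (descentPhase_spec (push := true) (by simp) h₁ hL₁ hlo').mono
    fun σ₂ τ₂ ⟨hτ₂, tr₂, cnt₂, L₂, h₂, _, hsteps₂⟩ => ?_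
  obtain ⟨S₃, h3, h4⟩ := hsteps₁.exists_step3_step4 (by positivity) hlo
  refine ⟨?_, tr₂, cnt₂, L₂, S₃, _, h₂, h3, h4, hsteps₂.step5 (by positivity)⟩
  unfold unitCost at *
  nlinarith

/-- Step 6. -/
def placeProg : Prog := loadList ;; mergeProg ;; expandProg

theorem placeProg_spec (hn : 0 < n) (h : HoldsFreqs c lo σ tr cnt 0 0 L) :
    Runs placeProg σ fun σ' τ => τ ≤ 5 * unitCost n * n ∧ ∃ p q : Fin n → ℕ,
      HoldsPairs σ' p q ∧ Step6 (keyedFreqs (2 ^ c) tr L) p q := by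
  have hcard : L.card ≤ n := by simpa using h.card_le
  have hlog : Nat.log 2 L.card ≤ Nat.log 2 n := Nat.log_mono_right hcard
  have hforest : HoldsForest σ tr cnt (L.map Prod.snd) := by simpa using h.forest
  refine Runs.seq_of_spec (loadList_spec h.heap h.list) fun σ₁ τ₁ hfr₁ ⟨hτ₁, hheap, _⟩ => ?_
  refine Runs.seq_of_spec (mergeProg_spec hn (by positivity) hheap
    (hforest.congr (hfr₁.reg nodeCount rfl) (hfr₁.arr parent rfl) (hfr₁.arr childIndex rfl)
      (hfr₁.arr childCount rfl)) ((hfr₁.reg groups rfl).trans h.grid.groups_eq))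
    fun σ₂ τ₂ _ ⟨hτ₂, tr₂, cnt₂, v, hforest₂, hmerge⟩ => ?_
  refine (expandProg_spec hforest₂).mono fun σ₃ τ₃ ⟨hτ₃, p, q, hpq, hplaces⟩ =>
    ⟨?_, p, q, hpq, v, _, hmerge, hplaces⟩
  have hload : L.card * (60 * Nat.log 2 L.card + 80) ≤ n * (60 * Nat.log 2 n + 80) := by gcongr
  unfold unitCost at *
  nlinarith

/-- The Main Algorithm. -/
def mainProg : Prog := roundProg ;; combineProg ;; placeProg

theorem mainProg_spec (hn : 0 < n) {h : Fin n → ℝ} (hpos : ∀ i, 0 < h i) (hanti : Antitone h) :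
    Runs mainProg (inputMem h) fun σ' τ => τ ≤ 30 * unitCost n * n ∧ ∃ p q : Fin n → ℕ,
      HoldsPairs σ' p q ∧ MainAlgorithm hn h p q := by
  have hmono := initialFreq_monotone hn hpos hanti
  have hfirst (i : Fin n) : initialFreq hn h ⟨0, hn⟩ ≤ initialFreq hn h i :=
    hmono (Fin.mk_le_mk.2 (Nat.zero_le _))
  have hlast (i : Fin n) : initialFreq hn h i ≤ initialFreq hn h ⟨n - 1, Nat.sub_lt hn one_pos⟩ :=
    hmono (Fin.mk_le_mk.2 (Nat.le_sub_one_of_lt i.2))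
  obtain ⟨lo, hlo, hlo_succ⟩ :=
    exists_nat_pow_near (one_le_initialFreq hn hpos ⟨0, hn⟩) one_lt_two
  obtain ⟨hi, hhi, hhi_succ⟩ :=
    exists_nat_pow_near (one_le_initialFreq hn hpos ⟨n - 1, Nat.sub_lt hn one_pos⟩) one_lt_two
  have hlohi : lo ≤ hi := Nat.lt_succ_iff.1 <| (pow_lt_pow_iff_right₀ (one_lt_two (α := ℝ))).1
    ((hlo.trans (hfirst _)).trans_lt hhi_succ)
  have hC : 0 < 2 ^ (lo / 2) := by positivity
  refine Runs.seq_of_spec (roundProg_spec hn hpos hanti hlo hlo_succ)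
    fun σ₁ τ₁ _ ⟨hτ₁, κ, hκ, h₁⟩ => ?_
  have hkeys : ∀ x ∈ initialKeys κ, x.1 < (hi + 1 : ℕ) * (2 ^ (lo / 2) : ℕ) := fun x hx => by
    obtain ⟨i, -, rfl⟩ := Multiset.mem_map.1 hx
    exact lt_mul_of_lt_two_pow hC ((hlast i).trans_lt hhi_succ) (hκ i).1
  refine Runs.seq_of_spec (combineProg_spec hn hlohi h₁ hkeys)
    fun σ₂ τ₂ _ ⟨hτ₂, tr, cnt, L, S₃, S₄, h₂, h3, h4, h5⟩ => ?_
  refine (placeProg_spec hn h₂).mono fun σ₃ τ₃ ⟨hτ₃, p, q, hpq, h6⟩ => ⟨by lia, p, q, hpq, ?_⟩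
  rw [keyedFreqs_initialKeys] at h3
  exact ⟨lo, hi, _, _, S₃, S₄, _, isGreatest_setOf_two_pow_le hlo hlo_succ,
    isLeast_setOf_lt_two_pow_succ hhi hhi_succ, rfl,
    fun i => isGreatest_gridVal hC (mul_le_of_two_pow_le hC (hlo.trans (hfirst i)) (hκ i).2)
      (hκ i).1 (hκ i).2, h3, h4, h5, h6⟩

end Programs

/-! ### The number of steps -/

theorem log_add_one_le (hn : 0 < n) :
    (Nat.log 2 n : ℝ) + 1 ≤ 2 / Real.log 2 * Real.log (n + 1) := by
  have hlog : (Nat.log 2 n : ℝ) * Real.log 2 ≤ Real.log (n + 1) := by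
    rw [← Real.log_pow]
    apply Real.log_le_log (by positivity)
    exact_mod_cast (Nat.pow_log_le_self 2 hn.ne').trans n.le_succ
  have htwo : Real.log 2 ≤ Real.log (n + 1) :=
    Real.log_le_log two_pos (by exact_mod_cast Nat.succ_le_succ hn)
  rw [div_mul_eq_mul_div, le_div_iff₀ (Real.log_pos one_lt_two)]
  linarith

/-- The constant of the time bounds. -/
noncomputable def timeConstant : ℝ := 42000 / Real.log 2

theorem unitCost_le (hn : 0 < n) : 30 * (unitCost n : ℝ) ≤ timeConstant * Real.log (n + 1) := by
  rw [unitCost, timeConstant,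
    show (42000 : ℝ) / Real.log 2 = 21000 * (2 / Real.log 2) by ring, mul_assoc]
  push_cast
  linarith [log_add_one_le hn, (Nat.cast_nonneg (Nat.log 2 n) : (0 : ℝ) ≤ _)]

theorem setupProg_cost_le (hn : 0 < n) :
    n * (60 * Nat.log 2 n + 60) + 10 ≤ 30 * unitCost n * n := by
  unfold unitCost
  nlinarith

theorem nextProg_cost_le (n : ℕ) : 150 * Nat.log 2 n + 80 ≤ unitCost n := by
  unfold unitCost
  lia

theorem le_timeConstant_mul_log (hn : 0 < n) {τ : ℕ} (hτ : τ ≤ unitCost n) :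
    (τ : ℝ) ≤ timeConstant * Real.log (n + 1) := by
  have hτ' : (τ : ℝ) ≤ unitCost n := by exact_mod_cast hτ
  linarith [unitCost_le hn, (Nat.cast_nonneg τ : (0 : ℝ) ≤ _)]

theorem le_timeConstant_mul (hn : 0 < n) {τ : ℕ} (hτ : τ ≤ 30 * unitCost n * n) :
    (τ : ℝ) ≤ timeConstant * (n * Real.log (n + 1)) :=
  calc (τ : ℝ) ≤ 30 * unitCost n * n := by exact_mod_cast hτ
    _ ≤ timeConstant * Real.log (n + 1) * n :=
      mul_le_mul_of_nonneg_right (unitCost_le hn) n.cast_nonneg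
    _ = timeConstant * (n * Real.log (n + 1)) := by ring

end BambooGarden

theorem mainTheorem7 :
    ∃ (main setup next : BambooGarden.Prog) (c : ℝ),
      -- the Main Algorithm in time `O(n log n)`
      (∀ (n : ℕ) (hn : 0 < n) (h : Fin n → ℝ), (∀ i, 0 < h i) → Antitone h →
        ∃ (σ : BambooGarden.Mem) (τ : ℕ) (p q : Fin n → ℕ),
          BambooGarden.Exec main (BambooGarden.inputMem h) σ τ ∧
          (τ : ℝ) ≤ c * (n * Real.log (n + 1)) ∧
          BambooGarden.HoldsPairs σ p q ∧
          BambooGarden.MainAlgorithm hn h p q ∧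
          BambooGarden.IsCyclicSchedule p q) ∧
      -- the schedule step by step from the pairs, in time `O(log n)` per step
      (∀ (n : ℕ) (p q : Fin n → ℕ), BambooGarden.IsCyclicSchedule p q →
        ∃ (σ : ℕ → BambooGarden.Mem) (t : ℕ → Fin n → ℕ) (item : ℕ → Fin n) (τ₀ : ℕ) (τ : ℕ → ℕ),
          BambooGarden.Exec setup (BambooGarden.pairsMem p q) (σ 0) τ₀ ∧
          (τ₀ : ℝ) ≤ c * (n * Real.log (n + 1)) ∧
          t 0 = p ∧
          ∀ T : ℕ,
            BambooGarden.HoldsQueue (σ T) (t T) ∧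
            (∀ i, t T (item T) ≤ t T i) ∧
            t (T + 1) = Function.update (t T) (item T) (t T (item T) + q (item T)) ∧
            BambooGarden.Exec next (σ T) (σ (T + 1)) (τ T) ∧
            (τ T : ℝ) ≤ c * Real.log (n + 1) ∧
            (σ (T + 1)).reg 1 = ((item T : ℕ) : ℝ) ∧
            ∃ k : ℕ, T = p (item T) + k * q (item T)) := by
  refine ⟨BambooGarden.mainProg, BambooGarden.setupProg, BambooGarden.nextProg,
    BambooGarden.timeConstant, fun n hn h hpos hanti => ?_, fun n p q hpq => ?_⟩
  · obtain ⟨σ, τ, hexec, hτ, p, q, hpairs, hmain⟩ := BambooGarden.mainProg_spec hn hpos hanti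
    exact ⟨σ, τ, p, q, hexec, BambooGarden.le_timeConstant_mul hn hτ, hpairs, hmain,
      hmain.isCyclicSchedule⟩
  · obtain ⟨i, -⟩ := hpq.2 0
    obtain ⟨σ, t, item, τ₀, τ, hsetup, hτ₀, ht, hnext⟩ := BambooGarden.exists_queue_run hpq
    refine ⟨σ, t, item, τ₀, τ, hsetup, BambooGarden.le_timeConstant_mul i.pos
      (hτ₀.trans (BambooGarden.setupProg_cost_le i.pos)), ht, fun T => ?_⟩
    obtain ⟨hqueue, hmin, hupdate, hexec, hτ, hout, hitem⟩ := hnext T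
    exact ⟨hqueue, hmin, hupdate, hexec, BambooGarden.le_timeConstant_mul_log i.pos
      (hτ.trans (BambooGarden.nextProg_cost_le n)), hout, hitem⟩
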